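/- Let $n\ge 1$. For an open connected set $W$ of points $(t,x,\psi)\in\mathbb R\times\mathbb R^n\times(\mathbb C\setminus\{0\})$ let $\mathscr V$ be the class of nonlinear Schrödinger equations $$ i\psi_t+\psi_{aa}+f(\rho)\psi+V(t,x)\psi=0,\qquad \rho=|\psi|, $$ on $W$ with the arbitrary elements $(f,V)$, where $f$ is a smooth complex-valued function with $f_\rho\ne0$ everywhere on the range of $\rho$, $V$ is a smooth complex-valued function of $(t,x)$, and summation over repeated indices $a,b=1,\dots,n$ is understood. Let $\mathscr V'$ and $\mathscr P_\lambda$, $\lambda\in\mathbb R$, be the subclasses of $\mathscr V$ singled out by the conditions that $\rho f_{\rho\rho}/f_\rho$ is not a real constant and that $\rho f_{\rho\rho}/f_\rho=\lambda-1$, respectively. A point transformation is a smooth injective map $\varphi$ of a domain of the space of $(t,x,\psi)$ into $\mathbb R\times\mathbb R^n\times(\mathbb C\setminus\{0\})$ with nondegenerate differential (smoothness and differentials are over $\mathbb R$, which means that $\psi$ and $\psi^*$ are treated as independent coordinates); it maps an equation on $W$ to an equation on $\varphi(W)$ if its second prolongation maps the manifold defined by the first equation in the space of second-order jets to the one defined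 by the second equation, wherever this prolongation is defined. An equivalence transformation of a class over $W$ is a point transformation $(p,v)\mapsto(\varphi(p),\Lambda(p,v))$ in the joint space of the variables $p=(t,x,\psi)\in W$ and of the values $v$ of the arbitrary elements, with $\Lambda(p,\cdot)$ bijective, that maps the class on $W$ onto the class on $\varphi(W)$, each equation being mapped by $\varphi$ to the equation with the transformed arbitrary elements. A class is normalized over $W$ if for each point transformation $\varphi$ with the domain $W$ that maps an equation of the class on $W$ to an equation of the class on $\varphi(W)$ there is an equivalence transformation with the same $\varphi$ that maps the arbitrary elements of the first equation to those of the second one. Let $W=I\times D\times A$, where $I\subseteq\mathbb R$ is a nonempty open interval and $D\subseteq\mathbb R^n$, $A\subseteq\mathbb C\setminus\{0\}$ are nonempty open connected sets. (i) The class $\mathscr V$ is not normalized over $W$. Its equivalence transformations over $W$ are exactly the transformations $$ \tilde t=T,\quad \tilde x_a=|T_t|^{1/2}O^{ab}x_b+\mathcal X^a,\quad \tilde\psi=\exp\Big(\frac i8\frac{T_{tt}}{|T_t|}x_ax_a+\frac i2\frac{\varepsilon'\mathcal X^b_t}{|T_t|^{1/2}}O^{ba}x_a+i\Sigma+Z\Big)\hat\psi,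 $$ $$ \tilde f=\frac{\hat f}{|T_t|}+c,\quad \tilde V=\frac{\hat V}{|T_t|}+\frac{\mathcal X^b_{tt}}{2|T_t|^{3/2}}O^{ba}x_a+\frac{\Sigma_t}{T_t}-\frac{\mathcal X^a_t\mathcal X^a_t}{4T_t^2}-c, $$ where $T$, $\mathcal X^a$, $\Sigma$ are smooth real-valued functions of $t\in I$ with $T_t\ne0$ and $T_{tt}=0$, $Z$ is a real constant, $c$ is a complex constant, $O=(O^{ab})$ is a constant orthogonal $n\times n$ matrix, $\varepsilon'=\operatorname{sgn}T_t$, and $\hat\beta=\beta$ if $T_t>0$, $\hat\beta=\beta^*$ if $T_t<0$. (ii) On every open connected subset of $\mathbb R\times\mathbb R^n\times(\mathbb C\setminus\{0\})$, $\mathscr V=\mathscr V'\sqcup\bigsqcup_{\lambda\in\mathbb R}\mathscr P_\lambda$ (disjoint union). (iii) The class $\mathscr V'$, with the arbitrary elements $(f,V)$, is normalized over $W$. For each $\lambda\in\mathbb R$, on every open connected subset of $\mathbb R\times\mathbb R^n\times(\mathbb C\setminus\{0\})$ the class $\mathscr P_\lambda$ consists of the same equations as the class of equations with $f=\delta\rho^\lambda$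 if $\lambda\ne0$ and $f=\delta\ln\rho$ if $\lambda=0$, where $\delta$ is an arbitrary nonzero complex constant; parameterized in this way by the arbitrary elements $(\delta,V)$, the class $\mathscr P_\lambda$ is normalized over $W$. (iv) No point transformation with the domain $W$ maps an equation on $W$ from one of the subclasses $\mathscr V'$, $\mathscr P_\lambda$, $\lambda\in\mathbb R$, to an equation on the image of $W$ from another one. -/

import Mathlib

open scoped ContDiff Topology

noncomputable section

namespace NLS

/-- The real vector space `ℝⁿ` of the space variables, with the Euclidean structure. -/
abbrev Space (n : ℕ) : Type := EuclideanSpace ℝ (Fin n)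

/-- The space of the variables `(t, x, ψ)`. The coordinates `ψ, ψ*` of the literature are encoded by
regarding `ℂ` as a real vector space: smooth functions of `(ψ, ψ*)` are real-smooth functions
of `ψ`. -/
abbrev Var (n : ℕ) : Type := ℝ × Space n × ℂ

/-- The point over `(t, x)` of the graph of `u`. -/
def graphPt {n : ℕ} (u : ℝ × Space n → ℂ) (q : ℝ × Space n) : Var n := (q.1, q.2, u q)

/-- The projection `(t, x, ψ) ↦ (t, x)`. -/
def base {n : ℕ} (p : Var n) : ℝ × Space n := (p.1, p.2.1)

/-- `i u_t + Δ u + S(t, x, u) u = 0` at the single point `q = (t, x)`; this is a condition on the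
second-order jet of `u` at `q`. -/
def SatisfiesAt {n : ℕ} (S : Var n → ℂ) (u : ℝ × Space n → ℂ) (q : ℝ × Space n) : Prop :=
  Complex.I * deriv (fun s : ℝ => u (s, q.2)) q.1
    + Laplacian.laplacian (fun y : Space n => u (q.1, y)) q.2
    + S (graphPt u q) * u q = 0

/-- Domains of the equations: open connected sets of points `(t, x, ψ)` with `ψ ≠ 0`. -/
def IsEqDomain {n : ℕ} (W : Set (Var n)) : Prop :=
  IsOpen W ∧ IsConnected W ∧ ∀ p ∈ W, p.2.2 ≠ 0

/-- A point transformation with the domain `W`: a smooth injective map with nondegenerate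
differential. -/
structure IsPointTransf {E : Type*} [NormedAddCommGroup E] [NormedSpace ℝ E]
    (W : Set E) (φ : E → E) : Prop where
  smooth : ContDiffOn ℝ ∞ φ W
  inj : Set.InjOn φ W
  nondeg : ∀ p ∈ W, Function.Bijective (fderiv ℝ φ p)

/-- A point transformation in the space of the variables `(t, x, ψ)`, with the domain `W`, whose
image lies where `ψ ≠ 0`. -/
structure IsVarTransf {n : ℕ} (W : Set (Var n)) (φ : Var n → Var n) : Prop where
  pointTransf : IsPointTransf W φ
  ne_zero : ∀ p ∈ W, (φ p).2.2 ≠ 0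

/-- The second prolongation of `φ` maps the equation with the coefficient `S` on `W` to the equation
with the coefficient `S'` on `φ '' W`. Second-order jets are represented by
functions: whenever `φ` maps the graph of `u` near its point over `q` into the graph of `u'`, the
2-jet of `u` at `q` satisfies the first equation iff the 2-jet of `u'` at the corresponding
point satisfies the second one. -/
def MapsEquation {n : ℕ} (W : Set (Var n)) (φ : Var n → Var n) (S S' : Var n → ℂ) : Prop :=
  ∀ (q : ℝ × Space n) (u u' : ℝ × Space n → ℂ),
    graphPt u q ∈ W →
    ContDiffAt ℝ ∞ u q →
    ContDiffAt ℝ ∞ u' (base (φ (graphPt u q))) →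
    (∀ᶠ r in 𝓝 q, φ (graphPt u r) = graphPt u' (base (φ (graphPt u r)))) →
    (SatisfiesAt S u q ↔ SatisfiesAt S' u' (base (φ (graphPt u q))))

/-- A class of equations `i ψ_t + Δ ψ + S ψ = 0` parameterized by a `k`-tuple `θ` of
complex arbitrary elements, which are functions of `(t, x, ψ)`: for each domain `W`,
`elems W` is the set of admitted values of `θ` on `W`, and the coefficient `S` at the point `p`
is `coeff (θ p) p`. -/
structure EqClass (n k : ℕ) where
  elems : Set (Var n) → Set (Var n → Fin k → ℂ)
  coeff : (Fin k → ℂ) → Var n → ℂ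

namespace EqClass

variable {n k : ℕ}

/-- The coefficient `S` of the equation with the value `θ` of the arbitrary elements. -/
def S (C : EqClass n k) (θ : Var n → Fin k → ℂ) (p : Var n) : ℂ := C.coeff (θ p) p

/-- The equation on `W` with the coefficient `S` belongs to the class. -/
def ContainsEquation (C : EqClass n k) (W : Set (Var n)) (S : Var n → ℂ) : Prop :=
  ∃ θ ∈ C.elems W, ∀ p ∈ W, S p = C.S θ p

/-- `(θ, φ, θ')` is an admissible transformation with the domain `W`: `φ` is a point
transformation that maps the equation of the class `C` with `θ` on `W` to the equation of the
class `C'` with `θ'` on `φ '' W`. -/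
structure IsAdmissible {k' : ℕ} (C : EqClass n k) (C' : EqClass n k') (W : Set (Var n))
    (θ : Var n → Fin k → ℂ) (φ : Var n → Var n) (θ' : Var n → Fin k' → ℂ) : Prop where
  transf : IsVarTransf W φ
  source : θ ∈ C.elems W
  target : θ' ∈ C'.elems (φ '' W)
  maps : MapsEquation W φ (C.S θ) (C'.S θ')

/-- Equivalence transformations of the class over `W`: the point transformations
`(p, v) ↦ (φ p, Λ p v)` in the joint space of the variables `p = (t, x, ψ)` and of the arbitrary
elements `v`, projectable to the space of the variables, that map the class onto itself, each equation
being mapped by `φ` to the equation with the transformed arbitrary elements. -/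
structure IsEquivTransf (C : EqClass n k) (W : Set (Var n)) (φ : Var n → Var n)
    (Λ : Var n → (Fin k → ℂ) → (Fin k → ℂ)) : Prop where
  transf : IsVarTransf W φ
  joint : IsPointTransf (W ×ˢ (Set.univ : Set (Fin k → ℂ)))
    (fun q : Var n × (Fin k → ℂ) => (φ q.1, Λ q.1 q.2))
  surj : ∀ p ∈ W, Function.Surjective (Λ p)
  elems_iff : ∀ θ θ' : Var n → Fin k → ℂ, (∀ p ∈ W, θ' (φ p) = Λ p (θ p)) →
    (θ ∈ C.elems W ↔ θ' ∈ C.elems (φ '' W))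
  maps : ∀ θ θ' : Var n → Fin k → ℂ, (∀ p ∈ W, θ' (φ p) = Λ p (θ p)) →
    θ ∈ C.elems W → MapsEquation W φ (C.S θ) (C.S θ')

/-- The class is normalized over `W`: each admissible transformation within the class is induced
by an equivalence transformation of the class. -/
def IsNormalized (C : EqClass n k) (W : Set (Var n)) : Prop :=
  ∀ (θ : Var n → Fin k → ℂ) (φ : Var n → Var n) (θ' : Var n → Fin k → ℂ),
    C.IsAdmissible C W θ φ θ' →
    ∃ Λ : Var n → (Fin k → ℂ) → (Fin k → ℂ),
      C.IsEquivTransf W φ Λ ∧ ∀ p ∈ W, θ' (φ p) = Λ p (θ p)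

end EqClass

/-- The range of `ρ = |ψ|` on `W`. -/
def rhoRange {n : ℕ} (W : Set (Var n)) : Set ℝ := (fun p : Var n => ‖p.2.2‖) '' W

/-- Potentials on `W`: smooth complex-valued functions of `(t, x)`. -/
def IsPotential {n : ℕ} (W : Set (Var n)) (V : ℝ × Space n → ℂ) : Prop :=
  ContDiffOn ℝ ∞ V (base '' W)

/-- Modular nonlinearities on `W`: smooth complex-valued functions `f` of `ρ` with `f_ρ ≠ 0`. -/
def IsNonlinearity {n : ℕ} (W : Set (Var n)) (f : ℝ → ℂ) : Prop :=
  ContDiffOn ℝ ∞ f (rhoRange W) ∧ ∀ ρ ∈ rhoRange W, deriv f ρ ≠ 0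

/-- The ratio `ρ f_ρρ / f_ρ`. -/
def ratio (f : ℝ → ℂ) (ρ : ℝ) : ℂ := ρ * deriv (deriv f) ρ / deriv f ρ

/-- The class of the equations `i ψ_t + Δ ψ + f(|ψ|) ψ + V(t,x) ψ = 0`, with the arbitrary elements
`(f, V)`, where on each domain `W` the nonlinearity `f` satisfies the condition `P W f`. -/
def modularClass (n : ℕ) (P : Set (Var n) → (ℝ → ℂ) → Prop) : EqClass n 2 where
  elems W := {θ | ∃ (f : ℝ → ℂ) (V : ℝ × Space n → ℂ), IsNonlinearity W f ∧ P W f ∧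
    IsPotential W V ∧ ∀ p ∈ W, θ p = ![f ‖p.2.2‖, V (base p)]}
  coeff v _ := v 0 + v 1

/-- The class `𝒱`. -/
def classV (n : ℕ) : EqClass n 2 := modularClass n fun _ _ => True

/-- The subclass `𝒱'` of `𝒱`: `ρ f_ρρ / f_ρ` is not a real constant. -/
def classV' (n : ℕ) : EqClass n 2 :=
  modularClass n fun W f => ¬ ∃ r : ℝ, ∀ ρ ∈ rhoRange W, ratio f ρ = r

/-- The subclass `𝒫_lam` of `𝒱`: `ρ f_ρρ / f_ρ = lam - 1`. -/
def classP (n : ℕ) (lam : ℝ) : EqClass n 2 :=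
  modularClass n fun W f => ∀ ρ ∈ rhoRange W, ratio f ρ = ((lam - 1 : ℝ) : ℂ)

/-- The subclasses of the partition: `𝒱'` (index `none`) and `𝒫_lam` (index `some lam`). -/
def subclass (n : ℕ) : Option ℝ → EqClass n 2
  | none => classV' n
  | some lam => classP n lam

/-- The class `𝒫_lam` reparameterized by `(δ, V)`, where `δ` is a nonzero complex constant:
`i ψ_t + Δ ψ + δ |ψ|^lam ψ + V ψ = 0` if `lam ≠ 0` and
`i ψ_t + Δ ψ + δ ψ ln |ψ| + V ψ = 0` if `lam = 0`. -/
def classPδ (n : ℕ) (lam : ℝ) : EqClass n 2 where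
  elems W := {θ | ∃ (δ : ℂ) (V : ℝ × Space n → ℂ), δ ≠ 0 ∧ IsPotential W V ∧
    ∀ p ∈ W, θ p = ![δ, V (base p)]}
  coeff v p :=
    v 0 * ((if lam = 0 then Real.log ‖p.2.2‖ else ‖p.2.2‖ ^ lam : ℝ) : ℂ) + v 1

/-- `hat τ β` is `β` if `τ > 0` and the conjugate `β*` otherwise; it is used with `τ = T_t ≠ 0`. -/
def hat (τ : ℝ) (β : ℂ) : ℂ := if 0 < τ then β else starRingEnd ℂ β

/-- The transformation of the variables with the parameters `T`, `O`, `X`, `Sig`, `Z`: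
`t̃ = T`, `x̃ = |T_t|^{1/2} O x + X`,
`ψ̃ = exp(i/8 T_tt/|T_t| |x|² + i/2 ε' |T_t|^{-1/2} X_t · O x + i Sig + Z) ψ̂`,
where `ε' = sgn T_t`. -/
def varTransf {n : ℕ} (T : ℝ → ℝ) (O : Space n ≃ₗᵢ[ℝ] Space n) (X : ℝ → Space n)
    (Sig Z : ℝ → ℝ) (p : Var n) : Var n :=
  let t := p.1
  let x := p.2.1
  let T₁ := deriv T t
  let T₂ := deriv (deriv T) t
  (T t, Real.sqrt |T₁| • O x + X t,
    Complex.exp (Complex.I *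
        ((1 / 8 * (T₂ / |T₁|) * ‖x‖ ^ 2
          + 1 / 2 * (Real.sign T₁ / Real.sqrt |T₁|) * inner ℝ (deriv X t) (O x)
          + Sig t : ℝ) : ℂ) + (Z t : ℂ))
      * hat T₁ p.2.2)

/-- The transformation of the arbitrary elements `v = (f, V)` of the class `𝒱` at the point `p`:
`f̃ = f̂/|T_t| + c`,
`Ṽ = V̂/|T_t| + X_tt · O x / (2 |T_t|^{3/2}) + Sig_t/T_t - |X_t|²/(4 T_t²) - c`. -/
def elemTransf {n : ℕ} (T : ℝ → ℝ) (O : Space n ≃ₗᵢ[ℝ] Space n) (X : ℝ → Space n)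
    (Sig : ℝ → ℝ) (c : ℂ) (p : Var n) (v : Fin 2 → ℂ) : Fin 2 → ℂ :=
  let t := p.1
  let x := p.2.1
  let T₁ := deriv T t
  ![hat T₁ (v 0) / (|T₁| : ℝ) + c,
    hat T₁ (v 1) / (|T₁| : ℝ)
      + ((inner ℝ (deriv (deriv X) t) (O x) / (2 * |T₁| ^ (3 / 2 : ℝ))
          + deriv Sig t / T₁ - ‖deriv X t‖ ^ 2 / (4 * T₁ ^ 2) : ℝ) : ℂ) - c]

end NLS

end

/-! The determining equations of a point transformation (T, X, Ψ) are solved pointwise, on 2-jets.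
The equation sees the second derivatives of u only through the Laplacian, so changing them by a form
with zero spatial trace must not be felt by the transformed equation (`JetCondition.trace`). This
forces T_x = T_ψ = 0. Varying u_t shows that the induced action on the ψ-direction commutes or
anticommutes with i according to the sign of T_t, and it fixes the scale |T_t|: the x-part is
conformal for every slope of u, hence free of ψ (`JetCondition.differential`). A conformal map whose
factor depends on t alone is affine in x (`IsFibredJet.of_maps`). What remains is the identity
`errTerm` = 0, a quadratic polynomial in the spatial gradient of u (`mapsEquation_iff_errTerm`,
`errTerm_split`). Its quadratic part gives Ψ_ψψ = 0, its linear part the gradient of log Ψ₁ in ψ' =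
Ψ₁ψ̂ + Ψ₀, its free part the relation of the coefficients.

A nonconstant function of |ψ| does not survive a shift of ψ, so Ψ₀ = 0 (`shift_eq_zero`). The
integrability of the gradient of log Ψ₁ makes the matrix of the x-part |T_t|^{1/2} times a constant
orthogonal one, and integrating it yields the quadratic phase up to a factor exp(iΣ + Z) depending
on t. Hence `exists_varTransf`; conversely, `mapsEquation_varTransf_iff` computes the action of
every such transformation on the coefficients.

At this point T and Z are still arbitrary functions of t. The ρ-derivative of the relation between f
and f', differentiated once more in t, reads T_tt/T_t + Z_t (1 + ρ f'_ρρ/f'_ρ) = 0. If the ratio is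
not a real constant, then Z_t = T_tt = 0 (`ModularMap.rigid`), and separating ρ from (t, x) leaves
one constant c. This normalizes `classV'`. It also gives the equivalence group of `classV`, since an
equivalence transformation acts in particular on one equation with a nonreal ratio.

For a power or a logarithm the relation says only that |T_t| exp(λZ) is a constant κ. Then δ is
conjugated or not and divided by κ, and for the logarithm the term with Z goes into the potential;
with δ as the arbitrary element this is an equivalence transformation. The logarithm with Z = t
therefore admits a transformation outside the group of `classV`, which is not normalized. Finally,
the ratio is preserved up to conjugation and scaling of ρ, so the subclasses cannot be mapped to
each other. -/

open scoped ContDiff Topology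

noncomputable section

namespace NLS

/-! ### Second derivatives, prescribed jets and the inverse function theorem. -/

section Calculus

variable {E F G : Type*} [NormedAddCommGroup E] [NormedSpace ℝ E]
  [NormedAddCommGroup F] [NormedSpace ℝ F] [NormedAddCommGroup G] [NormedSpace ℝ G]

theorem two_le_infty : (2 : WithTop ℕ∞) ≤ ∞ := ENat.LEInfty.out

theorem differentiableAt_fderiv {f : E → F} {x : E} (hf : ContDiffAt ℝ ∞ f x) :
    DifferentiableAt ℝ (fderiv ℝ f) x :=
  ((hf.of_le (m := 2) two_le_infty).fderiv_right (m := 1)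
    (by norm_num)).differentiableAt (by simp)

theorem contDiffAt_eventually {f : E → F} {x : E} (hf : ContDiffAt ℝ ∞ f x) :
    ∀ᶠ y in 𝓝 x, ContDiffAt ℝ 2 f y :=
  (hf.of_le (m := 2) two_le_infty).eventually (by simp)

/-- The chain rule for second derivatives. -/
theorem fderiv_fderiv_comp {g : F → G} {f : E → F} {x : E}
    (hg : ContDiffAt ℝ ∞ g (f x)) (hf : ContDiffAt ℝ ∞ f x) (v w : E) :
    fderiv ℝ (fderiv ℝ fun y => g (f y)) x v w =
      fderiv ℝ (fderiv ℝ g) (f x) (fderiv ℝ f x v) (fderiv ℝ f x w)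
        + fderiv ℝ g (f x) (fderiv ℝ (fderiv ℝ f) x v w) := by
  have h1 : fderiv ℝ (fun y => g (f y)) =ᶠ[𝓝 x]
      fun y => (fderiv ℝ g (f y)).comp (fderiv ℝ f y) := by
    filter_upwards [contDiffAt_eventually hf,
      hf.continuousAt.eventually (contDiffAt_eventually hg)] with y hy1 hy2
    exact fderiv_comp y (hy2.differentiableAt (by simp)) (hy1.differentiableAt (by simp))
  have hf1 : DifferentiableAt ℝ f x := hf.differentiableAt (by simp)
  have hgf : HasFDerivAt (fun y => fderiv ℝ g (f y))
      ((fderiv ℝ (fderiv ℝ g) (f x)).comp (fderiv ℝ f x)) x :=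
    (differentiableAt_fderiv hg).hasFDerivAt.comp x hf1.hasFDerivAt
  rw [h1.fderiv_eq, (hgf.clm_comp (differentiableAt_fderiv hf).hasFDerivAt).fderiv]
  simp [add_comm]

/-- The second derivative along a straight line. -/
theorem fderiv_fderiv_apply_self {f : E → F} {x : E} (hf : ContDiffAt ℝ ∞ f x) (v : E) :
    fderiv ℝ (fderiv ℝ f) x v v = deriv (deriv fun s : ℝ => f (x + s • v)) 0 := by
  have hline : ∀ s : ℝ, HasDerivAt (fun s : ℝ => x + s • v) v s := fun s => by
    simpa using ((hasDerivAt_id s).smul_const v).const_add x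
  have hx : Filter.Tendsto (fun s : ℝ => x + s • v) (𝓝 0) (𝓝 x) := by
    simpa using (hline 0).continuousAt.tendsto
  have h1 : deriv (fun s : ℝ => f (x + s • v)) =ᶠ[𝓝 0] fun s => fderiv ℝ f (x + s • v) v := by
    filter_upwards [hx.eventually (contDiffAt_eventually hf)] with s hs
    exact ((hs.differentiableAt (by simp)).hasFDerivAt.comp_hasDerivAt s (hline s)).deriv
  have h2 : HasDerivAt (fun s : ℝ => fderiv ℝ f (x + s • v)) (fderiv ℝ (fderiv ℝ f) x v) 0 := by
    have h0 : HasFDerivAt (fderiv ℝ f) (fderiv ℝ (fderiv ℝ f) x) (x + (0 : ℝ) • v) := by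
      simpa using (differentiableAt_fderiv hf).hasFDerivAt
    exact h0.comp_hasDerivAt 0 (hline 0)
  rw [h1.deriv_eq, (h2.clm_apply (hasDerivAt_const 0 v)).deriv]
  simp

theorem fderiv_fderiv_symm {f : E → F} {x : E} (hf : ContDiffAt ℝ ∞ f x) (v w : E) :
    fderiv ℝ (fderiv ℝ f) x v w = fderiv ℝ (fderiv ℝ f) x w v :=
  (hf.isSymmSndFDerivAt (by simpa using two_le_infty)).eq v w

/-- A linear relation satisfied by the first derivative on an open set is inherited by the
second derivative. -/
theorem clm_fderiv_fderiv_eq_zero {f : E → F} {W : Set E} (hW : IsOpen W)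
    (hf : ContDiffOn ℝ ∞ f W) (A : F →L[ℝ] G) {w : E} (h : ∀ x ∈ W, A (fderiv ℝ f x w) = 0)
    {x : E} (hx : x ∈ W) (v : E) : A (fderiv ℝ (fderiv ℝ f) x v w) = 0 := by
  have hd := (differentiableAt_fderiv (hf.contDiffAt (hW.mem_nhds hx))).hasFDerivAt
  have h1 : HasFDerivAt (fun y => A (fderiv ℝ f y w))
      (A.comp ((fderiv ℝ (fderiv ℝ f) x).flip w)) x := by
    have := A.hasFDerivAt.comp x (hd.clm_apply (hasFDerivAt_const w x))
    refine this.congr_fderiv ?_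
    ext; simp
  have h2 : (fun y => A (fderiv ℝ f y w)) =ᶠ[𝓝 x] fun _ => 0 := by
    filter_upwards [hW.mem_nhds hx] with y hy using h y hy
  have h3 := h2.fderiv_eq (𝕜 := ℝ)
  rw [h1.fderiv] at h3
  simpa using congrArg (fun l => l v) h3

/-- A quadratic polynomial with a prescribed jet of the second order. -/
theorem exists_jet (x : E) (c : F) (L : E →L[ℝ] F) (Q : E →L[ℝ] E →L[ℝ] F)
    (hQ : ∀ v w, Q v w = Q w v) :
    ∃ u : E → F, ContDiff ℝ ∞ u ∧ u x = c ∧ fderiv ℝ u x = L ∧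
      fderiv ℝ (fderiv ℝ u) x = Q := by
  have hsub : ∀ y : E, HasFDerivAt (fun y => y - x) (ContinuousLinearMap.id ℝ E) y :=
    fun y => (hasFDerivAt_id y).sub_const x
  have h1 : ∀ y, HasFDerivAt (fun y => c + L (y - x) + (1 / 2 : ℝ) • Q (y - x) (y - x))
      (L + Q (y - x)) y := fun y => by
    have hL := L.hasFDerivAt.comp y (hsub y)
    have hq := (((Q.hasFDerivAt.comp y (hsub y)).clm_apply (hsub y)).const_smul (1 / 2 : ℝ))
    refine ((hL.const_add c).add hq).congr_fderiv ?_
    ext v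
    simp only [add_apply, ContinuousLinearMap.comp_apply, Function.comp_apply,
      smul_apply, ContinuousLinearMap.flip_apply, ContinuousLinearMap.id_apply]
    -- The symmetry of Q makes the two terms of the product rule equal, which uses up the factor
    -- 1/2.
    rw [hQ v, ← two_smul ℝ (Q (y - x) v), smul_smul]
    norm_num
  refine ⟨_, ?_, ?_, (h1 x).fderiv.trans (by simp), ?_⟩
  · fun_prop
  · simp
  · rw [funext fun y => (h1 y).fderiv]
    exact ((Q.hasFDerivAt.comp x (hsub x)).const_add L).fderiv

/-- The inverse function theorem, in terms of a bijective differential. -/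
theorem exists_local_inverse [FiniteDimensional ℝ E] {f : E → E} {x : E}
    (hf : ContDiffAt ℝ ∞ f x) (h : Function.Bijective (fderiv ℝ f x)) :
    ∃ g : E → E, ContDiffAt ℝ ∞ g (f x) ∧ g (f x) = x ∧ (∀ᶠ y in 𝓝 x, g (f y) = y) ∧
      ∀ᶠ y in 𝓝 (f x), f (g y) = y := by
  have : CompleteSpace E := FiniteDimensional.complete ℝ E
  let e : E ≃L[ℝ] E :=
    (LinearEquiv.ofBijective (fderiv ℝ f x).toLinearMap h).toContinuousLinearEquiv
  have he : HasFDerivAt f (e : E →L[ℝ] E) x := by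
    have : (e : E →L[ℝ] E) = fderiv ℝ f x := by ext; rfl
    rw [this]; exact (hf.differentiableAt (by simp)).hasFDerivAt
  have hs := hf.hasStrictFDerivAt' he (by simp)
  exact ⟨hf.localInverse he (by simp), hf.to_localInverse he (by simp),
    hf.localInverse_apply_image he (by simp), hs.eventually_left_inverse,
    hs.eventually_right_inverse⟩

theorem IsPointTransf.isOpen_image [FiniteDimensional ℝ E] {W : Set E} {φ : E → E}
    (hW : IsOpen W) (h : IsPointTransf W φ) {U : Set E} (hU : IsOpen U) (hUW : U ⊆ W) :
    IsOpen (φ '' U) := by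
  rw [isOpen_iff_mem_nhds]
  rintro _ ⟨x, hx, rfl⟩
  obtain ⟨g, hg, hgx, -, hr⟩ := exists_local_inverse
    (h.smooth.contDiffAt (hW.mem_nhds (hUW hx))) (h.nondeg x (hUW hx))
  have hU' : U ∈ 𝓝 (g (φ x)) := by rw [hgx]; exact hU.mem_nhds hx
  filter_upwards [hr, hg.continuousAt.preimage_mem_nhds hU'] with y hy1 hy2
  exact ⟨g y, hy2, hy1⟩

/-- The inverse of a point transformation is smooth. -/
theorem IsPointTransf.exists_inverse [FiniteDimensional ℝ E] {W : Set E} {φ : E → E}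
    (hW : IsOpen W) (h : IsPointTransf W φ) :
    ∃ g : E → E, ContDiffOn ℝ ∞ g (φ '' W) ∧ ∀ x ∈ W, g (φ x) = x := by
  classical
  by_cases hne : W.Nonempty
  swap
  · rw [Set.not_nonempty_iff_eq_empty] at hne
    subst hne
    exact ⟨id, by simp [contDiffOn_empty], by simp⟩
  have : Nonempty E := hne.to_type
  have hinv : ∀ x ∈ W, Function.invFunOn φ W (φ x) = x := fun x hx =>
    h.inj.leftInvOn_invFunOn hx
  refine ⟨Function.invFunOn φ W, ?_, hinv⟩
  rintro _ ⟨x, hx, rfl⟩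
  obtain ⟨g, hg, hgx, -, hr⟩ := exists_local_inverse
    (h.smooth.contDiffAt (hW.mem_nhds hx)) (h.nondeg x hx)
  have hU' : W ∈ 𝓝 (g (φ x)) := by rw [hgx]; exact hW.mem_nhds hx
  refine (hg.congr_of_eventuallyEq ?_).contDiffWithinAt
  filter_upwards [hr, hg.continuousAt.preimage_mem_nhds hU'] with y hy1 hy2
  conv_lhs => rw [← hy1]
  exact hinv _ hy2

end Calculus

/-! ### Graphs of functions, the residual of an equation, prolongation. -/

variable {n : ℕ}

/-- The projection `base` as a linear map. -/
def baseL (n : ℕ) : Var n →L[ℝ] ℝ × Space n :=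
  (ContinuousLinearMap.fst ℝ ℝ (Space n × ℂ)).prod
    ((ContinuousLinearMap.fst ℝ (Space n) ℂ).comp (ContinuousLinearMap.snd ℝ ℝ (Space n × ℂ)))

/-- The projection `(t, x, ψ) ↦ ψ` as a linear map. -/
def psiL (n : ℕ) : Var n →L[ℝ] ℂ :=
  (ContinuousLinearMap.snd ℝ (Space n) ℂ).comp (ContinuousLinearMap.snd ℝ ℝ (Space n × ℂ))

/-- The lift `v ↦ (v, L v)` of tangent vectors to a graph. -/
def liftL (L : ℝ × Space n →L[ℝ] ℂ) : ℝ × Space n →L[ℝ] Var n :=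
  (ContinuousLinearMap.fst ℝ ℝ (Space n)).prod ((ContinuousLinearMap.snd ℝ ℝ (Space n)).prod L)

theorem baseL_apply (p : Var n) : baseL n p = base p := rfl
theorem psiL_apply (p : Var n) : psiL n p = p.2.2 := rfl
theorem liftL_apply (L : ℝ × Space n →L[ℝ] ℂ) (v : ℝ × Space n) :
    liftL L v = (v.1, v.2, L v) := rfl

theorem var_ext {p p' : Var n} (h1 : baseL n p = baseL n p') (h2 : psiL n p = psiL n p') :
    p = p' := by
  have h3 := congrArg Prod.fst h1
  have h4 := congrArg Prod.snd h1
  exact Prod.ext h3 (Prod.ext h4 h2)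

theorem hasFDerivAt_graphPt {u : ℝ × Space n → ℂ} {q : ℝ × Space n}
    (hu : DifferentiableAt ℝ u q) : HasFDerivAt (graphPt u) (liftL (fderiv ℝ u q)) q :=
  hasFDerivAt_fst.prodMk (hasFDerivAt_snd.prodMk hu.hasFDerivAt)

theorem contDiffAt_graphPt {u : ℝ × Space n → ℂ} {q : ℝ × Space n}
    (hu : ContDiffAt ℝ ∞ u q) : ContDiffAt ℝ ∞ (graphPt u) q :=
  contDiffAt_fst.prodMk (contDiffAt_snd.prodMk hu)

theorem fderiv_fderiv_graphPt {u : ℝ × Space n → ℂ} {q : ℝ × Space n}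
    (hu : ContDiffAt ℝ ∞ u q) (v w : ℝ × Space n) :
    fderiv ℝ (fderiv ℝ (graphPt u)) q v w = (0, 0, fderiv ℝ (fderiv ℝ u) q v w) := by
  have h1 : fderiv ℝ (graphPt u) =ᶠ[𝓝 q] fun r => liftL (fderiv ℝ u r) := by
    filter_upwards [contDiffAt_eventually hu] with r hr
    exact (hasFDerivAt_graphPt (hr.differentiableAt (by simp))).fderiv
  have hd := (differentiableAt_fderiv hu).hasFDerivAt
  have h2 : HasFDerivAt (fun r => liftL (fderiv ℝ u r) w)
      ((0 : ℝ × Space n →L[ℝ] ℝ).prod ((0 : ℝ × Space n →L[ℝ] Space n).prod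
        ((fderiv ℝ (fderiv ℝ u) q).flip w))) q := by
    refine (hasFDerivAt_const w.1 q).prodMk ((hasFDerivAt_const w.2 q).prodMk ?_)
    refine (hd.clm_apply (hasFDerivAt_const w q)).congr_fderiv ?_
    ext <;> simp
  have h3 : HasFDerivAt (fun r => fderiv ℝ (graphPt u) r w)
      ((fderiv ℝ (fderiv ℝ (graphPt u)) q).flip w) q := by
    refine (((differentiableAt_fderiv (contDiffAt_graphPt hu)).hasFDerivAt).clm_apply
      (hasFDerivAt_const w q)).congr_fderiv ?_
    ext <;> simp
  have h4 : (fun r => fderiv ℝ (graphPt u) r w) =ᶠ[𝓝 q] fun r => liftL (fderiv ℝ u r) w := by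
    filter_upwards [h1] with r hr
    rw [hr]
  have h5 := h4.fderiv_eq (𝕜 := ℝ)
  rw [h2.fderiv, h3.fderiv] at h5
  simpa using congrArg (fun l => l v) h5

/-- The left-hand side of the equation `i u_t + Δ u + S(t, x, u) u = 0` at the point `q`. -/
def residual (S : Var n → ℂ) (u : ℝ × Space n → ℂ) (q : ℝ × Space n) : ℂ :=
  Complex.I * deriv (fun s : ℝ => u (s, q.2)) q.1
    + Laplacian.laplacian (fun y : Space n => u (q.1, y)) q.2
    + S (graphPt u q) * u q

theorem satisfiesAt_iff {S : Var n → ℂ} {u : ℝ × Space n → ℂ} {q : ℝ × Space n} :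
    SatisfiesAt S u q ↔ residual S u q = 0 := Iff.rfl

/-- The orthonormal basis is left free because the Laplacian of the transformed function is computed
in the basis adapted to the transformation. -/
theorem residual_eq (S : Var n → ℂ) {u : ℝ × Space n → ℂ} {q : ℝ × Space n}
    (hu : ContDiffAt ℝ ∞ u q) (b : OrthonormalBasis (Fin n) ℝ (Space n)) :
    residual S u q = Complex.I * fderiv ℝ u q (1, 0)
      + ∑ j, fderiv ℝ (fderiv ℝ u) q (0, b j) (0, b j) + S (graphPt u q) * u q := by
  have h1 : deriv (fun s : ℝ => u (s, q.2)) q.1 = fderiv ℝ u q (1, 0) := by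
    have hl : HasDerivAt (fun s : ℝ => (s, q.2)) ((1 : ℝ), (0 : Space n)) q.1 :=
      (hasDerivAt_id q.1).prodMk (hasDerivAt_const q.1 q.2)
    exact ((hu.differentiableAt (by simp)).hasFDerivAt.comp_hasDerivAt q.1 hl).deriv
  have hr : ∀ y, HasFDerivAt (fun y : Space n => (q.1, y))
      (ContinuousLinearMap.inr ℝ ℝ (Space n)) y := fun y => hasFDerivAt_prodMk_right q.1 y
  have h2 : ∀ y : Space n, fderiv ℝ (fderiv ℝ fun y : Space n => u (q.1, y)) q.2 y y
      = fderiv ℝ (fderiv ℝ u) q (0, y) (0, y) := fun y => by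
    rw [fderiv_fderiv_comp (g := u) (f := fun y : Space n => (q.1, y)) (x := q.2) hu
      (contDiffAt_const.prodMk contDiffAt_id), (hr q.2).fderiv,
      funext fun y => (hr y).fderiv, fderiv_fun_const]
    simp
  have h3 : Laplacian.laplacian (fun y : Space n => u (q.1, y)) q.2
      = ∑ j, fderiv ℝ (fderiv ℝ u) q (0, b j) (0, b j) := by
    rw [InnerProductSpace.laplacian_eq_iteratedFDeriv_orthonormalBasis _ b]
    refine Finset.sum_congr rfl fun j _ => ?_
    rw [iteratedFDeriv_two_apply]
    simpa using h2 (b j)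
  rw [residual, h1, h3]

/-- The prolongation formulas: the derivatives of the transformed function `u'` in terms of those
of `u`. -/
theorem prolongation {φ : Var n → Var n} {u u' : ℝ × Space n → ℂ} {q : ℝ × Space n}
    (hφ : ContDiffAt ℝ ∞ φ (graphPt u q)) (hu : ContDiffAt ℝ ∞ u q)
    (hu' : ContDiffAt ℝ ∞ u' (base (φ (graphPt u q))))
    (h : ∀ᶠ r in 𝓝 q, φ (graphPt u r) = graphPt u' (base (φ (graphPt u r)))) :
    (∀ v, psiL n (fderiv ℝ φ (graphPt u q) (liftL (fderiv ℝ u q) v))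
      = fderiv ℝ u' (base (φ (graphPt u q)))
        (baseL n (fderiv ℝ φ (graphPt u q) (liftL (fderiv ℝ u q) v)))) ∧
    (∀ v w, fderiv ℝ (fderiv ℝ u') (base (φ (graphPt u q)))
        (baseL n (fderiv ℝ φ (graphPt u q) (liftL (fderiv ℝ u q) v)))
        (baseL n (fderiv ℝ φ (graphPt u q) (liftL (fderiv ℝ u q) w)))
      = (psiL n - (fderiv ℝ u' (base (φ (graphPt u q)))).comp (baseL n))
        (fderiv ℝ (fderiv ℝ φ) (graphPt u q) (liftL (fderiv ℝ u q) v) (liftL (fderiv ℝ u q) w)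
        + fderiv ℝ φ (graphPt u q) (0, 0, fderiv ℝ (fderiv ℝ u) q v w))) := by
  have hg := contDiffAt_graphPt hu
  have hΦ : ContDiffAt ℝ ∞ (fun r => φ (graphPt u r)) q := hφ.comp q hg
  have hb : ContDiffAt ℝ ∞ (fun r => baseL n (φ (graphPt u r))) q :=
    (baseL n).contDiff.contDiffAt.comp q hΦ
  have hp : ContDiffAt ℝ ∞ (fun r => psiL n (φ (graphPt u r))) q :=
    (psiL n).contDiff.contDiffAt.comp q hΦ
  -- Both formulas come from this one identity, Ψ = u'(T, X) along the graph of u, differentiated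
  -- once and twice.
  have hrel : (fun r => psiL n (φ (graphPt u r))) =ᶠ[𝓝 q]
      fun r => u' (baseL n (φ (graphPt u r))) := by
    filter_upwards [h] with r hr
    have := congrArg (psiL n) hr
    exact this
  have hD1 : fderiv ℝ (fun r => φ (graphPt u r)) q
      = (fderiv ℝ φ (graphPt u q)).comp (liftL (fderiv ℝ u q)) := by
    have := fderiv_comp q (hφ.differentiableAt (by simp)) (hg.differentiableAt (by simp))
    rw [(hasFDerivAt_graphPt (hu.differentiableAt (by simp))).fderiv] at this
    exact this
  have hD2 : ∀ v w, fderiv ℝ (fderiv ℝ fun r => φ (graphPt u r)) q v w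
      = fderiv ℝ (fderiv ℝ φ) (graphPt u q) (liftL (fderiv ℝ u q) v) (liftL (fderiv ℝ u q) w)
        + fderiv ℝ φ (graphPt u q) (0, 0, fderiv ℝ (fderiv ℝ u) q v w) := fun v w => by
    rw [fderiv_fderiv_comp hφ hg, fderiv_fderiv_graphPt hu,
      (hasFDerivAt_graphPt (hu.differentiableAt (by simp))).fderiv]
  have hlin : ∀ {H : Type} [NormedAddCommGroup H] [NormedSpace ℝ H] (A : Var n →L[ℝ] H),
      fderiv ℝ (fun r => A (φ (graphPt u r))) q = A.comp (fderiv ℝ (fun r => φ (graphPt u r)) q) ∧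
      ∀ v w, fderiv ℝ (fderiv ℝ fun r => A (φ (graphPt u r))) q v w
        = A (fderiv ℝ (fderiv ℝ fun r => φ (graphPt u r)) q v w) := by
    intro H _ _ A
    refine ⟨(A.hasFDerivAt.comp q (hΦ.differentiableAt (by simp)).hasFDerivAt).fderiv,
      fun v w => ?_⟩
    rw [fderiv_fderiv_comp (g := A) A.contDiff.contDiffAt hΦ, A.fderiv,
      funext fun y => A.fderiv (x := y), fderiv_fun_const]
    simp
  constructor
  · intro v
    have h1 := hrel.fderiv_eq (𝕜 := ℝ)
    have h2 : fderiv ℝ (fun r => u' (baseL n (φ (graphPt u r)))) q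
        = (fderiv ℝ u' (base (φ (graphPt u q)))).comp
          (fderiv ℝ (fun r => baseL n (φ (graphPt u r))) q) :=
      fderiv_comp q (g := u') (f := fun r => baseL n (φ (graphPt u r)))
        (hu'.differentiableAt (by simp)) (hb.differentiableAt (by simp))
    rw [h2, (hlin (psiL n)).1, (hlin (baseL n)).1, hD1] at h1
    exact congrArg (fun l => l v) h1
  · intro v w
    have h1 := (hrel.fderiv (𝕜 := ℝ)).fderiv_eq (𝕜 := ℝ)
    have h2 := congrArg (fun l => l v w) h1
    rw [fderiv_fderiv_comp (g := u') (f := fun r => baseL n (φ (graphPt u r))) hu' hb,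
      (hlin (psiL n)).2, (hlin (baseL n)).2, (hlin (baseL n)).1, hD1, hD2] at h2
    simp only [sub_apply, ContinuousLinearMap.comp_apply] at h2 ⊢
    rw [h2]
    simp [baseL_apply]

/-- The transformed function exists whenever the transformed graph is transversal. -/
theorem exists_transformed {φ : Var n → Var n} {u : ℝ × Space n → ℂ} {q : ℝ × Space n}
    (hφ : ContDiffAt ℝ ∞ φ (graphPt u q)) (hu : ContDiffAt ℝ ∞ u q)
    (hbij : Function.Bijective
      ((baseL n).comp ((fderiv ℝ φ (graphPt u q)).comp (liftL (fderiv ℝ u q))))) :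
    ∃ u' : ℝ × Space n → ℂ, ContDiffAt ℝ ∞ u' (base (φ (graphPt u q))) ∧
      ∀ᶠ r in 𝓝 q, φ (graphPt u r) = graphPt u' (base (φ (graphPt u r))) := by
  have hΦ : ContDiffAt ℝ ∞ (fun r => φ (graphPt u r)) q := hφ.comp q (contDiffAt_graphPt hu)
  have hb : ContDiffAt ℝ ∞ (fun r => baseL n (φ (graphPt u r))) q :=
    (baseL n).contDiff.contDiffAt.comp q hΦ
  have hD : fderiv ℝ (fun r => baseL n (φ (graphPt u r))) q
      = (baseL n).comp ((fderiv ℝ φ (graphPt u q)).comp (liftL (fderiv ℝ u q))) :=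
    ((baseL n).hasFDerivAt.comp q ((hφ.differentiableAt (by simp)).hasFDerivAt.comp q
      (hasFDerivAt_graphPt (hu.differentiableAt (by simp))))).fderiv
  rw [← hD] at hbij
  obtain ⟨g, hg, hgq, hl, -⟩ := exists_local_inverse hb hbij
  refine ⟨fun r => psiL n (φ (graphPt u (g r))), ?_, ?_⟩
  · have h1 : ContDiffAt ℝ ∞ (fun r => psiL n (φ (graphPt u r)))
        (g (baseL n (φ (graphPt u q)))) := by
      rw [hgq]
      exact (psiL n).contDiff.contDiffAt.comp q hΦ
    exact h1.comp _ hg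
  · filter_upwards [hl] with r hr
    refine var_ext rfl ?_
    show _ = psiL n (φ (graphPt u (g (base (φ (graphPt u r))))))
    rw [← baseL_apply, hr]

/-! ### Existence of a slope transversal to a given differential. -/

section LinearAlgebra

/-- A surjective linear map `B × C → B` is bijective on the graph of a suitable linear map. -/
theorem exists_graph_bijective {B C : Type*} [AddCommGroup B] [Module ℝ B]
    [FiniteDimensional ℝ B] [AddCommGroup C] [Module ℝ C]
    (A₁ : B →ₗ[ℝ] B) (A₂ : C →ₗ[ℝ] B) (h : ∀ b, ∃ x y, A₁ x + A₂ y = b) :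
    ∃ L : B →ₗ[ℝ] C, Function.Bijective (A₁ + A₂ ∘ₗ L) := by
  -- Since A₂ covers the cokernel of A₁, and the cokernel has the dimension of the kernel, L can
  -- send the kernel of A₁ to lifts of the cokernel. A₁ + A₂L is then injective: modulo the range of
  -- A₁ it detects the kernel component, and on the rest it is A₁.
  let R := LinearMap.range A₁
  let K := LinearMap.ker A₁
  have hsurj : LinearMap.range (R.mkQ ∘ₗ A₂) = ⊤ := by
    rw [LinearMap.range_eq_top]
    intro c
    obtain ⟨b, rfl⟩ := R.mkQ_surjective c
    obtain ⟨x, y, hxy⟩ := h b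
    refine ⟨y, ?_⟩
    have : R.mkQ (A₁ x) = 0 := by
      rw [Submodule.mkQ_apply, Submodule.Quotient.mk_eq_zero]
      exact ⟨x, rfl⟩
    rw [← hxy, map_add, this, zero_add, LinearMap.comp_apply]
  obtain ⟨g, hg⟩ := LinearMap.exists_rightInverse_of_surjective _ hsurj
  have hdim : Module.finrank ℝ K = Module.finrank ℝ (B ⧸ R) := by
    have h1 := LinearMap.finrank_range_add_finrank_ker A₁
    have h2 := Submodule.finrank_quotient_add_finrank R
    simp only [R, K] at *
    omega
  let e : K ≃ₗ[ℝ] B ⧸ R := LinearEquiv.ofFinrankEq _ _ hdim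
  obtain ⟨pr, hpr⟩ := LinearMap.exists_leftInverse_of_injective K.subtype
    (LinearMap.ker_eq_bot.2 K.injective_subtype)
  let L : B →ₗ[ℝ] C := g ∘ₗ e.toLinearMap ∘ₗ pr
  have hinj : Function.Injective (A₁ + A₂ ∘ₗ L) := by
    rw [← LinearMap.ker_eq_bot, LinearMap.ker_eq_bot']
    intro b hb
    have h1 : R.mkQ (A₁ b) = 0 := by
      rw [Submodule.mkQ_apply, Submodule.Quotient.mk_eq_zero]
      exact ⟨b, rfl⟩
    have h2 : R.mkQ (A₂ (L b)) = e (pr b) := by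
      exact congrArg (fun l => l (e (pr b))) hg
    have h3 := congrArg R.mkQ hb
    rw [LinearMap.add_apply, map_add, h1, LinearMap.comp_apply, h2, zero_add, map_zero] at h3
    have h4 : pr b = 0 := by simpa using h3
    have h5 : L b = 0 := by simp [L, h4]
    have h6 : A₁ b = 0 := by simpa [h5] using hb
    have h7 := congrArg (fun l => l (⟨b, h6⟩ : K)) hpr
    simp only [LinearMap.comp_apply, Submodule.subtype_apply, h4, LinearMap.id_apply] at h7
    exact (congrArg Subtype.val h7).symm
  exact ⟨L, hinj, LinearMap.injective_iff_surjective.1 hinj⟩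

end LinearAlgebra

/-! ### The condition on 2-jets of a transformation. -/

/-- The standard orthonormal basis of the space of the variables `x`. -/
def stdB (n : ℕ) : OrthonormalBasis (Fin n) ℝ (Space n) := EuclideanSpace.basisFun (Fin n) ℝ

/-- The condition on the 2-jet at a point of a point transformation, with the first and second
differentials `D` and `D2`, to map a second-order evolution equation to another one. Here `L` and
`Q` are the derivatives of a function `u`, and `P` is the inverse of the differential of the induced
transformation of the independent variables. -/
def JetCondition (D : Var n →L[ℝ] Var n) (D2 : Var n →L[ℝ] Var n →L[ℝ] Var n) (σ σ' : ℂ) : Prop :=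
  ∀ (L : ℝ × Space n →L[ℝ] ℂ) (P : ℝ × Space n →L[ℝ] ℝ × Space n)
    (Q : ℝ × Space n →L[ℝ] ℝ × Space n →L[ℝ] ℂ), (∀ v w, Q v w = Q w v) →
    (∀ v, baseL n (D (liftL L (P v))) = v) →
    (Complex.I * L (1, 0) + ∑ j, Q (0, stdB n j) (0, stdB n j) + σ = 0 ↔
      Complex.I * psiL n (D (liftL L (P (1, 0))))
        + ∑ j, (psiL n - ((psiL n).comp (D.comp ((liftL L).comp P))).comp (baseL n))
          (D2 (liftL L (P (0, stdB n j))) (liftL L (P (0, stdB n j)))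
            + D (0, 0, Q (P (0, stdB n j)) (P (0, stdB n j)))) + σ' = 0)

/-- Every 2-jet over p is that of a quadratic polynomial u. A right inverse P makes its transformed
graph transversal, so u' exists, and `prolongation` expresses the jet of u' through D, D2, L, P and
Q. -/
theorem MapsEquation.jetCondition {W : Set (Var n)} {φ : Var n → Var n} {S S' : Var n → ℂ}
    (hW : IsOpen W) (hφ : ContDiffOn ℝ ∞ φ W) (h : MapsEquation W φ S S') {p : Var n}
    (hp : p ∈ W) :
    JetCondition (fderiv ℝ φ p) (fderiv ℝ (fderiv ℝ φ) p) (S p * p.2.2)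
      (S' (φ p) * (φ p).2.2) := by
  intro L P Q hQ hP
  obtain ⟨u, hu, hu0, hu1, hu2⟩ := exists_jet (base p) p.2.2 L Q hQ
  have hup : graphPt u (base p) = p := by
    unfold graphPt; rw [hu0]; rfl
  have hφp : ContDiffAt ℝ ∞ φ (graphPt u (base p)) := by
    rw [hup]; exact hφ.contDiffAt (hW.mem_nhds hp)
  have hsurj : Function.Surjective ((baseL n).comp ((fderiv ℝ φ (graphPt u (base p))).comp
      (liftL (fderiv ℝ u (base p))))) := fun v => ⟨P v, by rw [hup, hu1]; exact hP v⟩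
  have hbij : Function.Bijective ((baseL n).comp ((fderiv ℝ φ (graphPt u (base p))).comp
      (liftL (fderiv ℝ u (base p))))) :=
    ⟨(LinearMap.injective_iff_surjective
      (f := ((baseL n).comp ((fderiv ℝ φ (graphPt u (base p))).comp
      (liftL (fderiv ℝ u (base p))))).toLinearMap)).2 hsurj, hsurj⟩
  obtain ⟨u', hu', hrel⟩ := exists_transformed hφp hu.contDiffAt hbij
  have hiff := h (base p) u u' (by rw [hup]; exact hp) hu.contDiffAt hu' hrel
  obtain ⟨hpr1, hpr2⟩ := prolongation hφp hu.contDiffAt hu' hrel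
  rw [satisfiesAt_iff, satisfiesAt_iff, residual_eq S hu.contDiffAt (stdB n),
    residual_eq S' hu' (stdB n)] at hiff
  have hrel0 := hrel.self_of_nhds
  rw [← hrel0] at hiff
  have hv' : u' (base (φ (graphPt u (base p)))) = (φ p).2.2 := by
    have := congrArg (psiL n) hrel0
    rw [hup] at this ⊢
    exact this.symm
  rw [hv'] at hiff
  rw [hup] at hpr1 hpr2 hiff
  rw [hu0, hu1, hu2] at hiff
  rw [hu1] at hpr1 hpr2
  rw [hu2] at hpr2
  have hL' : fderiv ℝ u' (base (φ p))
      = (psiL n).comp ((fderiv ℝ φ p).comp ((liftL L).comp P)) := by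
    refine ContinuousLinearMap.ext fun v => ?_
    have := hpr1 (P v)
    rw [hP] at this
    exact this.symm
  have hsum : ∀ j, fderiv ℝ (fderiv ℝ u') (base (φ p)) (0, stdB n j) (0, stdB n j)
      = (psiL n - ((psiL n).comp ((fderiv ℝ φ p).comp ((liftL L).comp P))).comp (baseL n))
          (fderiv ℝ (fderiv ℝ φ) p (liftL L (P (0, stdB n j))) (liftL L (P (0, stdB n j)))
            + fderiv ℝ φ p (0, 0, Q (P (0, stdB n j)) (P (0, stdB n j)))) := fun j => by
    have := hpr2 (P (0, stdB n j)) (P (0, stdB n j))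
    rw [hP, hL'] at this
    exact this
  rw [Finset.sum_congr rfl fun j _ => hsum j, hL'] at hiff
  exact hiff

/-! ### The trace argument: the new time depends on t alone. -/

section Jets

variable {D : Var n →L[ℝ] Var n} {D2 : Var n →L[ℝ] Var n →L[ℝ] Var n} {σ σ' : ℂ}
  {L : ℝ × Space n →L[ℝ] ℂ} {P : ℝ × Space n →L[ℝ] ℝ × Space n}

/-- `P` is the inverse of the transformation of the independent variables induced by `D` on the
graph of `L`. -/
def IsInv (D : Var n →L[ℝ] Var n) (L : ℝ × Space n →L[ℝ] ℂ)
    (P : ℝ × Space n →L[ℝ] ℝ × Space n) : Prop :=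
  ∀ v, baseL n (D (liftL L (P v))) = v

theorem IsInv.left (hP : IsInv D L P) (v : ℝ × Space n) : P (baseL n (D (liftL L v))) = v := by
  have h : ((baseL n).comp (D.comp (liftL L))).toLinearMap ∘ₗ P.toLinearMap = LinearMap.id :=
    LinearMap.ext hP
  exact congrArg (fun l => l v) ((LinearMap.comp_eq_id_comm _ _).1 h)

theorem exists_isInv_of_bijective
    (h : Function.Bijective ((baseL n).comp (D.comp (liftL L)))) : ∃ P, IsInv D L P := by
  let e := (LinearEquiv.ofBijective ((baseL n).comp (D.comp (liftL L))).toLinearMap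
    h).toContinuousLinearEquiv
  exact ⟨e.symm, fun v => e.apply_symm_apply v⟩

/-- The zero slope need not be transversal, for instance when D exchanges ψ with space variables.
Some slope is, because the base components of a bijective D form a surjective map. -/
theorem exists_isInv (hD : Function.Bijective D) : ∃ L P, IsInv D L P := by
  let A : Var n →ₗ[ℝ] ℝ × Space n := (baseL n).toLinearMap ∘ₗ D.toLinearMap
  obtain ⟨L, hL⟩ := exists_graph_bijective (A ∘ₗ (liftL (0 : ℝ × Space n →L[ℝ] ℂ)).toLinearMap)
    (A ∘ₗ LinearMap.inr ℝ ℝ (Space n × ℂ) ∘ₗ LinearMap.inr ℝ (Space n) ℂ) (fun b => by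
      obtain ⟨Y, hY⟩ := hD.2 (b.1, b.2, 0)
      refine ⟨base Y, Y.2.2, ?_⟩
      rw [LinearMap.comp_apply, LinearMap.comp_apply A, ← map_add]
      have : (liftL (0 : ℝ × Space n →L[ℝ] ℂ)).toLinearMap (base Y)
          + (LinearMap.inr ℝ ℝ (Space n × ℂ) ∘ₗ LinearMap.inr ℝ (Space n) ℂ) Y.2.2 = Y := by
        simp [liftL_apply, base]
      rw [this]
      show baseL n (D Y) = b
      rw [hY]; rfl)
  refine ⟨L.toContinuousLinearMap, exists_isInv_of_bijective ?_⟩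
  convert hL using 1
  ext1 v
  simp only [A, LinearMap.add_apply, LinearMap.comp_apply]
  rw [← map_add, ← map_add]
  show baseL n (D _) = baseL n (D _)
  congr 2
  simp [liftL_apply]

/-- Transversality is an open condition. It allows the slope to be varied, so that an identity found
for one slope becomes a polynomial identity in ε. -/
theorem IsInv.perturb (hP : IsInv D L P) (K : ℝ × Space n →L[ℝ] ℂ) :
    ∀ᶠ ε : ℝ in 𝓝 0, ∃ P', IsInv D (L + ε • K) P' := by
  have hopen := ContinuousLinearEquiv.isOpen (𝕜 := ℝ) (E := ℝ × Space n) (F := ℝ × Space n)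
  have heq : ∀ ε : ℝ, (baseL n).comp (D.comp (liftL (L + ε • K)))
      = (baseL n).comp (D.comp (liftL L)) + ε • (baseL n).comp (D.comp
        ((ContinuousLinearMap.inr ℝ ℝ (Space n × ℂ)).comp
          ((ContinuousLinearMap.inr ℝ (Space n) ℂ).comp K))) := fun ε => by
    refine ContinuousLinearMap.ext fun v => ?_
    simp only [ContinuousLinearMap.comp_apply, add_apply, smul_apply]
    rw [← map_smul, ← map_smul, ← map_add, ← map_add]
    congr 2
    simp [liftL_apply]
  have hc : Continuous fun ε : ℝ => (baseL n).comp (D.comp (liftL (L + ε • K))) := by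
    simp_rw [heq]
    fun_prop
  have hbij : Function.Bijective ((baseL n).comp (D.comp (liftL L))) :=
    ⟨Function.LeftInverse.injective (g := P) hP.left,
      Function.RightInverse.surjective (g := P) hP⟩
  have h0 : (baseL n).comp (D.comp (liftL (L + (0 : ℝ) • K))) ∈
      Set.range (ContinuousLinearEquiv.toContinuousLinearMap (R₁ := ℝ) (R₂ := ℝ)
        (σ₁₂ := RingHom.id ℝ) (M₁ := ℝ × Space n) (M₂ := ℝ × Space n)) := by
    have hL0 : L + (0 : ℝ) • K = L := ContinuousLinearMap.ext fun v => by
      rw [add_apply, smul_apply, zero_smul, add_zero]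
    rw [hL0]
    refine ⟨(LinearEquiv.ofBijective ((baseL n).comp (D.comp (liftL L))).toLinearMap
      hbij).toContinuousLinearEquiv, ?_⟩
    refine ContinuousLinearMap.ext fun v => ?_
    simp
  filter_upwards [(hopen.preimage hc).mem_nhds h0] with ε hε
  obtain ⟨e, he⟩ := hε
  refine exists_isInv_of_bijective ?_
  have he' : (e : ℝ × Space n →L[ℝ] ℝ × Space n)
      = (baseL n).comp (D.comp (liftL (L + ε • K))) := he
  rw [← he']
  exact e.bijective

/-- The real-linear map `z ↦ Ψ_ψ z - u'_{t'} T_ψ z - u'_{x'} X_ψ z`. -/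
def transMap (D : Var n →L[ℝ] Var n) (L : ℝ × Space n →L[ℝ] ℂ)
    (P : ℝ × Space n →L[ℝ] ℝ × Space n) : ℂ →ₗ[ℝ] ℂ :=
  (psiL n - ((psiL n).comp (D.comp ((liftL L).comp P))).comp (baseL n)).toLinearMap ∘ₗ
    D.toLinearMap ∘ₗ LinearMap.inr ℝ ℝ (Space n × ℂ) ∘ₗ LinearMap.inr ℝ (Space n) ℂ

theorem transMap_apply (z : ℂ) : transMap D L P z =
    psiL n (D (0, 0, z)) - psiL n (D (liftL L (P (baseL n (D (0, 0, z)))))) := rfl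

/-- If the value is zero, then the image of the vertical vector (0, 0, z) is tangent to the
transformed graph. Since D is injective, (0, 0, z) is tangent to the original graph, which contains
no vertical directions. -/
theorem transMap_injective (hD : Function.Bijective D) (hP : IsInv D L P) {z : ℂ}
    (hz : transMap D L P z = 0) : z = 0 := by
  rw [transMap_apply, sub_eq_zero] at hz
  have h1 : D (0, 0, z) = D (liftL L (P (baseL n (D (0, 0, z))))) := var_ext (hP _).symm hz
  have h2 := hD.1 h1
  rw [liftL_apply] at h2
  have ha := congrArg (fun Y : Var n => Y.1) h2
  have hb := congrArg (fun Y : Var n => Y.2.1) h2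
  have hc := congrArg (fun Y : Var n => Y.2.2) h2
  simp only at ha hb hc
  have h3 : P (baseL n (D (0, 0, z))) = 0 := Prod.ext ha.symm hb.symm
  rw [hc, h3, map_zero]

/-- The bilinear form `(v, w) ↦ f(v) g(w) c`. -/
def bil (f g : ℝ × Space n →L[ℝ] ℝ) (c : ℂ) : ℝ × Space n →L[ℝ] ℝ × Space n →L[ℝ] ℂ :=
  f.smulRight (g.smulRight c)

theorem bil_apply (f g : ℝ × Space n →L[ℝ] ℝ) (c : ℂ) (v w : ℝ × Space n) :
    bil f g c v w = ((f v * g w : ℝ) : ℂ) * c := by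
  simp [bil, mul_assoc]

/-- The linear functional `(t, x) ↦ ⟨a, x⟩`. -/
def innerSnd (a : Space n) : ℝ × Space n →L[ℝ] ℝ :=
  (innerSL ℝ a).comp (ContinuousLinearMap.snd ℝ ℝ (Space n))

theorem innerSnd_apply (a : Space n) (v : ℝ × Space n) : innerSnd a v = inner ℝ a v.2 := rfl

/-- The bilinear form `(v, w) ↦ ⟨v₂, w₂⟩ c`. -/
def bilInner (c : ℂ) : ℝ × Space n →L[ℝ] ℝ × Space n →L[ℝ] ℂ :=
  ∑ j, bil (innerSnd (stdB n j)) (innerSnd (stdB n j)) c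

theorem bilInner_apply (c : ℂ) (v w : ℝ × Space n) :
    bilInner c v w = ((inner ℝ v.2 w.2 : ℝ) : ℂ) * c := by
  rw [bilInner, sum_apply, sum_apply]
  simp_rw [bil_apply, innerSnd_apply]
  rw [← Finset.sum_mul, ← Complex.ofReal_sum, ← (stdB n).sum_inner_mul_inner v.2 w.2]
  simp_rw [real_inner_comm v.2]

theorem sum_bilInner (hn : 1 ≤ n) (z : ℂ) :
    ∑ j, bilInner (z / n) (0, stdB n j) (0, stdB n j) = z := by
  have hn' : (n : ℂ) ≠ 0 := by exact_mod_cast (by omega : n ≠ 0)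
  simp_rw [bilInner_apply, real_inner_self_eq_norm_sq, OrthonormalBasis.norm_eq_one]
  simp only [one_pow, Complex.ofReal_one, one_mul, Finset.sum_const, Finset.card_univ,
    Fintype.card_fin, nsmul_eq_mul]
  field_simp

/-- The mean square of the inverse differential in the space directions. -/
def meanSq (P : ℝ × Space n →L[ℝ] ℝ × Space n) : ℝ :=
  (∑ j, ‖(P (0, stdB n j)).2‖ ^ 2) / n

/-- The initial equation restricts Q by its spatial trace only, and the transformed one depends on Q
through an injective map of the trace of its pullback by P. The pulled-back trace is therefore a
multiple of the original one; the factor is found on an isotropic form, whose existence with a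
prescribed trace requires n ≥ 1. -/
theorem JetCondition.trace (h : JetCondition D D2 σ σ') (hn : 1 ≤ n) (hD : Function.Bijective D)
    (hP : IsInv D L P) :
    (∀ Q : ℝ × Space n →L[ℝ] ℝ × Space n →L[ℝ] ℂ, (∀ v w, Q v w = Q w v) →
      ∑ j, Q (P (0, stdB n j)) (P (0, stdB n j))
        = meanSq P * ∑ j, Q (0, stdB n j) (0, stdB n j)) ∧
    Complex.I * psiL n (D (liftL L (P (1, 0))))
      + ∑ j, (psiL n - ((psiL n).comp (D.comp ((liftL L).comp P))).comp (baseL n))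
          (D2 (liftL L (P (0, stdB n j))) (liftL L (P (0, stdB n j))))
      + meanSq P * transMap D L P (-(Complex.I * L (1, 0)) - σ) + σ' = 0 := by
  set ℓ := psiL n - ((psiL n).comp (D.comp ((liftL L).comp P))).comp (baseL n) with hℓ
  have hsplit : ∀ Q : ℝ × Space n →L[ℝ] ℝ × Space n →L[ℝ] ℂ,
      ∑ j, ℓ (D2 (liftL L (P (0, stdB n j))) (liftL L (P (0, stdB n j)))
            + D (0, 0, Q (P (0, stdB n j)) (P (0, stdB n j))))
      = ∑ j, ℓ (D2 (liftL L (P (0, stdB n j))) (liftL L (P (0, stdB n j))))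
        + transMap D L P (∑ j, Q (P (0, stdB n j)) (P (0, stdB n j))) := fun Q => by
    rw [map_sum, ← Finset.sum_add_distrib]
    exact Finset.sum_congr rfl fun j _ => by rw [map_add]; rfl
  have hinner : ∀ c : ℂ, ∑ j, bilInner (c / n) (P (0, stdB n j)) (P (0, stdB n j))
      = meanSq P * c := fun c => by
    simp_rw [bilInner_apply, real_inner_self_eq_norm_sq]
    rw [← Finset.sum_mul, meanSq, ← Complex.ofReal_sum]
    push_cast
    ring
  have hsymm : ∀ (c : ℂ) (v w : ℝ × Space n), bilInner c v w = bilInner c w v := fun c v w => by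
    rw [bilInner_apply, bilInner_apply, real_inner_comm]
  set z₀ := -(Complex.I * L (1, 0)) - σ with hz₀
  have hA := (h L P (bilInner (z₀ / n)) (hsymm _) hP).1 (by rw [sum_bilInner hn, hz₀]; ring)
  rw [hsplit, hinner] at hA
  have hreal : transMap D L P (meanSq P * z₀) = meanSq P * transMap D L P z₀ := by
    rw [← Complex.real_smul, map_smul, Complex.real_smul]
  refine ⟨fun Q hQ => ?_, by rw [← hreal, ← hA]; ring⟩
  set tr := ∑ j, Q (0, stdB n j) (0, stdB n j) with htr
  -- A trace-free part is added to the isotropic form; the initial equation still holds, so the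
  -- difference with `hA` isolates the effect of that part.
  have hB := (h L P (bilInner (z₀ / n) + (Q - bilInner (tr / n)))
    (fun v w => by simp only [add_apply, sub_apply]; rw [hsymm, hQ, hsymm (tr / n)]) hP).1 (by
      simp only [add_apply, sub_apply]
      rw [Finset.sum_add_distrib, Finset.sum_sub_distrib, sum_bilInner hn, sum_bilInner hn, hz₀]
      ring)
  rw [hsplit] at hB
  simp only [add_apply, sub_apply] at hB
  rw [Finset.sum_add_distrib, Finset.sum_sub_distrib, hinner, hinner, map_add] at hB
  have hC : transMap D L P
      (∑ j, Q (P (0, stdB n j)) (P (0, stdB n j)) - meanSq P * tr) = 0 := by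
    linear_combination hB - hA
  exact sub_eq_zero.1 (transMap_injective hD hP hC)

/-- The form dt ⊗ dt has zero spatial trace, and the trace of its pullback is a sum of squares. -/
theorem JetCondition.inv_fst (h : JetCondition D D2 σ σ') (hn : 1 ≤ n) (hD : Function.Bijective D)
    (hP : IsInv D L P) (y : Space n) : (P (0, y)).1 = 0 := by
  have h1 := (h.trace hn hD hP).1
    (bil (ContinuousLinearMap.fst ℝ ℝ (Space n)) (ContinuousLinearMap.fst ℝ ℝ (Space n)) 1)
    (fun v w => by rw [bil_apply, bil_apply, mul_comm (ContinuousLinearMap.fst ℝ ℝ (Space n) v)])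
  simp_rw [bil_apply] at h1
  simp only [ContinuousLinearMap.coe_fst', mul_one, mul_zero, Complex.ofReal_zero,
    Finset.sum_const_zero] at h1
  rw [← Complex.ofReal_sum, Complex.ofReal_eq_zero,
    Finset.sum_eq_zero_iff_of_nonneg (fun j _ => mul_self_nonneg _)] at h1
  have h2 : ∀ j, (P (0, stdB n j)).1 = 0 := fun j => mul_self_eq_zero.1 (h1 j (Finset.mem_univ j))
  have h3 : ((LinearMap.fst ℝ ℝ (Space n)) ∘ₗ P.toLinearMap ∘ₗ LinearMap.inr ℝ ℝ (Space n)) = 0 :=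
    (stdB n).toBasis.ext fun j => by simpa using h2 j
  exact congrArg (fun l => l y) h3

/-- P maps spatial vectors to spatial ones and is onto, so it multiplies time components by a
nonzero number. Hence its inverse preserves spatial vectors too. -/
theorem JetCondition.fst_lift (h : JetCondition D D2 σ σ') (hn : 1 ≤ n)
    (hD : Function.Bijective D) (hP : IsInv D L P) (y : Space n) :
    (D (liftL L (0, y))).1 = 0 := by
  have h1 := hP.left (0, y)
  set Y := baseL n (D (liftL L (0, y))) with hY
  have hfst : ∀ v : ℝ × Space n, (P v).1 = v.1 * (P (1, 0)).1 := fun v => by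
    have hv : v = v.1 • ((1 : ℝ), (0 : Space n)) + (0, v.2) := by ext <;> simp
    conv_lhs => rw [hv]
    rw [map_add, map_smul]
    simp [h.inv_fst hn hD hP]
  have h2 : Y.1 * (P (1, 0)).1 = 0 := by rw [← hfst, h1]
  have h3 : (P (1, 0)).1 ≠ 0 := fun h0 => by
    have := congrArg Prod.fst (hP.left (1, 0))
    rw [hfst, h0] at this
    simp at this
  exact (mul_eq_zero.1 h2).resolve_right h3

/-- The previous lemma reads T_x + T_ψ u_x = 0 for all slopes near the given one. Varying u_x along
a unit vector, which exists as n ≥ 1, separates T_ψ = 0 from T_x = 0. -/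
theorem JetCondition.fst_eq_zero (h : JetCondition D D2 σ σ') (hn : 1 ≤ n)
    (hD : Function.Bijective D) (y : Space n) (z : ℂ) : (D (0, y, z)).1 = 0 := by
  obtain ⟨L, P, hP⟩ := exists_isInv hD
  let a : Space n := stdB n ⟨0, hn⟩
  have hna : ‖a‖ = 1 := OrthonormalBasis.norm_eq_one _ _
  have hz : ∀ z : ℂ, (D (0, 0, z)).1 = 0 := fun z => by
    obtain ⟨ε, ⟨P', hP'⟩, hε⟩ := (((hP.perturb ((innerSnd a).smulRight z)).filter_mono
      nhdsWithin_le_nhds).and (self_mem_nhdsWithin (s := {0}ᶜ) (a := (0 : ℝ)))).exists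
    have h1 := h.fst_lift hn hD hP' a
    have h2 := h.fst_lift hn hD hP a
    have h3 : liftL (L + ε • (innerSnd a).smulRight z) (0, a)
        = liftL L (0, a) + ε • ((0 : ℝ), (0 : Space n), z) := by
      simp [liftL_apply, innerSnd_apply, hna]
    rw [h3, map_add, map_smul, Prod.fst_add, h2, zero_add, Prod.smul_fst, smul_eq_mul] at h1
    exact (mul_eq_zero.1 h1).resolve_left hε
  have h1 := h.fst_lift hn hD hP y
  have h2 : ((0 : ℝ), y, z) = liftL L (0, y) + (0, 0, z - L (0, y)) := by simp [liftL_apply]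
  rw [h2, map_add, Prod.fst_add, h1, hz, add_zero]

end Jets

/-! ### Linearity in ψ up to conjugation, and conformality in x. -/

section Jets

variable {D : Var n →L[ℝ] Var n} {D2 : Var n →L[ℝ] Var n →L[ℝ] Var n} {σ σ' : ℂ}
  {L : ℝ × Space n →L[ℝ] ℂ} {P : ℝ × Space n →L[ℝ] ℝ × Space n}

theorem JetCondition.inv_time (h : JetCondition D D2 σ σ') (hn : 1 ≤ n)
    (hD : Function.Bijective D) (hP : IsInv D L P) :
    (P (1, 0)).1 * (D (1, 0, 0)).1 = 1 := by
  have h1 := congrArg Prod.fst (hP (1, 0))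
  set v := P (1, 0) with hv
  have h2 : liftL L v = v.1 • ((1 : ℝ), (0 : Space n), (0 : ℂ)) + (0, v.2, L v) := by
    simp [liftL_apply]
  rw [h2, map_add, map_smul, baseL_apply] at h1
  have h3 := h.fst_eq_zero hn hD v.2 (L v)
  simpa [base, h3] using h1

/-- Varying the time derivative of the function shows that `transMap` intertwines the
multiplications by `i`. -/
theorem JetCondition.intertwine (h : JetCondition D D2 σ σ') (hn : 1 ≤ n)
    (hD : Function.Bijective D) (hD2 : ∀ Y y z, (D2 Y (0, y, z)).1 = 0) (hP : IsInv D L P) (z : ℂ) :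
    Complex.I * ((P (1, 0)).1 * transMap D L P z)
      = meanSq P * transMap D L P (Complex.I * z) := by
  have hT := h.fst_eq_zero hn hD
  have hP0 := h.inv_fst hn hD hP
  set a := (P (1, 0)).1 with ha
  set c := (D (0, 0, z)).2.1 with hc
  have hbz : baseL n (D (0, 0, z)) = (0, c) := Prod.ext (hT 0 z) rfl
  set L₁ : ℝ × Space n →L[ℝ] ℂ := L + (ContinuousLinearMap.fst ℝ ℝ (Space n)).smulRight z with hL₁
  -- Adding z to u_t moves the image of the time direction by the spatial vector c = X_ψ z; this
  -- rank-one correction restores the inverse. The spatial restriction of P, and with it all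
  -- second-order terms, is unchanged.
  set P₁ : ℝ × Space n →L[ℝ] ℝ × Space n :=
    P - (((ContinuousLinearMap.fst ℝ ℝ (Space n)).comp P)).smulRight (P (0, c)) with hP₁
  have hL₁v : ∀ v, liftL L₁ v = liftL L v + v.1 • ((0 : ℝ), (0 : Space n), z) := fun v => by
    simp [liftL_apply, hL₁]
  have hP₁v : ∀ v, P₁ v = P v - (P v).1 • P (0, c) := fun v => by simp [hP₁]
  have hP₁1 : ∀ v, (P₁ v).1 = (P v).1 := fun v => by simp [hP₁v, hP0]
  have hinv : IsInv D L₁ P₁ := fun v => by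
    rw [hL₁v, hP₁1, hP₁v, map_sub, map_smul, map_add, map_sub, map_smul, map_smul, map_add, map_sub,
      map_smul, map_smul, hP, hP, hbz]
    simp
  have hP₁0 : ∀ y, P₁ (0, y) = P (0, y) := fun y => by simp [hP₁v, hP0]
  have hlift : ∀ y, liftL L₁ (P₁ (0, y)) = liftL L (P (0, y)) := fun y => by
    rw [hL₁v, hP₁0, hP0, zero_smul, add_zero]
  have hℓ : ∀ Y : Var n, Y.1 = 0 →
      (psiL n - ((psiL n).comp (D.comp ((liftL L₁).comp P₁))).comp (baseL n)) Y
        = (psiL n - ((psiL n).comp (D.comp ((liftL L).comp P))).comp (baseL n)) Y := fun Y hY => by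
    have hb : baseL n Y = (0, Y.2.1) := Prod.ext hY rfl
    simp only [sub_apply, ContinuousLinearMap.comp_apply, hb, hlift]
  have hM : ∀ w, transMap D L₁ P₁ w = transMap D L P w := fun w => hℓ _ (hT 0 w)
  have hs : meanSq P₁ = meanSq P := by simp only [meanSq, hP₁0]
  have hsum : ∀ j, (psiL n - ((psiL n).comp (D.comp ((liftL L₁).comp P₁))).comp (baseL n))
          (D2 (liftL L₁ (P₁ (0, stdB n j))) (liftL L₁ (P₁ (0, stdB n j))))
      = (psiL n - ((psiL n).comp (D.comp ((liftL L).comp P))).comp (baseL n))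
          (D2 (liftL L (P (0, stdB n j))) (liftL L (P (0, stdB n j)))) := fun j => by
    rw [hlift]
    refine hℓ _ ?_
    have : liftL L (P (0, stdB n j)) = (0, (P (0, stdB n j)).2, L (P (0, stdB n j))) :=
      Prod.ext (hP0 _) rfl
    conv_lhs => rw [this]
    exact hD2 _ _ _
  have h1 := (h.trace hn hD hP).2
  have h2 := (h.trace hn hD hinv).2
  rw [Finset.sum_congr rfl fun j _ => hsum j, hs, hM] at h2
  have hL₁1 : L₁ (1, 0) = L (1, 0) + z := by simp [hL₁]
  have hψ : psiL n (D (liftL L₁ (P₁ (1, 0))))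
      = psiL n (D (liftL L (P (1, 0)))) + a * transMap D L P z := by
    rw [hL₁v, hP₁1, hP₁v, transMap_apply, hbz]
    simp only [map_add, map_sub, map_smul, Complex.real_smul, ← ha]
    ring
  have hMz : transMap D L P (-(Complex.I * (L (1, 0) + z)) - σ)
      = transMap D L P (-(Complex.I * L (1, 0)) - σ) - transMap D L P (Complex.I * z) := by
    rw [← map_sub]; congr 1; ring
  rw [hL₁1, hψ, hMz] at h2
  linear_combination h2 - h1

/-- With M for `transMap`, the relation i a M(z) = s M(iz) applied to 1 and to i gives s² = a². As s
≥ 0 and aτ = 1, this means s = 1/|τ| and a = s sgn τ. -/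
theorem JetCondition.semilinear (h : JetCondition D D2 σ σ') (hn : 1 ≤ n)
    (hD : Function.Bijective D) (hD2 : ∀ Y y z, (D2 Y (0, y, z)).1 = 0) (hP : IsInv D L P) :
    meanSq P * |(D (1, 0, 0)).1| = 1 ∧ ∀ z, transMap D L P (Complex.I * z)
      = Real.sign (D (1, 0, 0)).1 * (Complex.I * transMap D L P z) := by
  have hint := h.intertwine hn hD hD2 hP
  have haτ := h.inv_time hn hD hP
  set a := (P (1, 0)).1
  set τ := (D (1, 0, 0)).1
  set s := meanSq P with hs
  have hs0 : 0 ≤ s := by rw [hs, meanSq]; positivity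
  have hM1 : transMap D L P 1 ≠ 0 := fun h0 => one_ne_zero (transMap_injective hD hP h0)
  have h1 := hint 1
  have h2 := hint (Complex.I * 1)
  have h3 : transMap D L P (Complex.I * (Complex.I * 1)) = -transMap D L P 1 := by
    rw [← map_neg]; congr 1; rw [← mul_assoc, Complex.I_mul_I]; ring
  rw [h3] at h2
  have h4 : ((s ^ 2 - a ^ 2 : ℝ) : ℂ) * transMap D L P 1 = 0 := by
    push_cast
    linear_combination (s : ℂ) * h2 + (Complex.I * a) * h1
      - (a : ℂ) ^ 2 * transMap D L P 1 * Complex.I_sq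
  have h5 : s ^ 2 = a ^ 2 := by
    have := (mul_eq_zero.1 h4).resolve_right hM1
    rw [Complex.ofReal_eq_zero] at this
    linarith
  have h6 : s = |a| := by rw [← Real.sqrt_sq hs0, h5, Real.sqrt_sq_eq_abs]
  have h7 : s * |τ| = 1 := by rw [h6, ← abs_mul, haτ, abs_one]
  have hs1 : s ≠ 0 := fun h0 => by rw [h0, zero_mul] at h7; exact zero_ne_one h7
  have hτ : τ ≠ 0 := fun h0 => by rw [h0, mul_zero] at haτ; exact zero_ne_one haτ
  refine ⟨h7, fun z => ?_⟩
  have h8 : a = s * Real.sign τ := by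
    have ha : a = τ⁻¹ := by field_simp; exact haτ
    rw [h6, ha]
    rcases lt_or_gt_of_ne hτ with h0 | h0
    · rw [Real.sign_of_neg h0, abs_of_neg (inv_lt_zero.2 h0)]; ring
    · rw [Real.sign_of_pos h0, abs_of_pos (inv_pos.2 h0)]; ring
  have h9 := hint z
  rw [h8] at h9
  have hs1' : (s : ℂ) ≠ 0 := by exact_mod_cast hs1
  refine mul_left_cancel₀ hs1' ?_
  rw [← h9]
  push_cast
  ring

/-- The trace identity on symmetrized products of linear forms says R Rᵀ = s Id for the spatial part
R of P. Therefore Rᵀ = s R⁻¹ (this is `hadj`), and the inverse of R is conformal with the factor 1/s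
= |τ|. -/
theorem JetCondition.conformal (h : JetCondition D D2 σ σ') (hn : 1 ≤ n)
    (hD : Function.Bijective D) (hD2 : ∀ Y y z, (D2 Y (0, y, z)).1 = 0) (hP : IsInv D L P)
    (y y' : Space n) :
    inner ℝ (D (liftL L (0, y))).2.1 (D (liftL L (0, y'))).2.1
      = |(D (1, 0, 0)).1| * inner ℝ y y' := by
  have hP0 := h.inv_fst hn hD hP
  have hs := (h.semilinear hn hD hD2 hP).1
  set s := meanSq P
  have hNP : ∀ y, (D (liftL L (P (0, y)))).2.1 = y := fun y => congrArg Prod.snd (hP (0, y))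
  have hPN : ∀ y, P (0, (D (liftL L (0, y))).2.1) = (0, y) := fun y => by
    rw [← hP.left (0, y)]
    congr 1
    exact Prod.ext (h.fst_lift hn hD hP y).symm (by rw [hP.left]; rfl)
  have htr : ∀ a b : Space n, ∑ j, inner ℝ a (P (0, stdB n j)).2 * inner ℝ b (P (0, stdB n j)).2
      = s * inner ℝ a b := fun a b => by
    have h1 := (h.trace hn hD hP).1 (bil (innerSnd a) (innerSnd b) 1
      + bil (innerSnd b) (innerSnd a) 1)
      (fun v w => by simp only [add_apply, bil_apply]; push_cast; ring)
    simp only [add_apply, bil_apply, innerSnd_apply, mul_one] at h1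
    norm_cast at h1
    rw [Finset.sum_add_distrib, Finset.sum_add_distrib] at h1
    have h2 : ∑ j, inner ℝ a (stdB n j) * inner ℝ b (stdB n j) = inner ℝ a b := by
      rw [← (stdB n).sum_inner_mul_inner a b]
      simp_rw [real_inner_comm b]
    simp_rw [mul_comm (inner ℝ b _) (inner ℝ a _)] at h1
    rw [h2] at h1
    linarith
  have hadj : ∀ b y, inner ℝ b (P (0, y)).2 = s * inner ℝ (D (liftL L (0, b))).2.1 y :=
    fun b y => by
    have h1 : (P (0, ∑ j, inner ℝ b (P (0, stdB n j)).2 • stdB n j)).2 = s • b := by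
      have hlin : (P (0, ∑ j, inner ℝ b (P (0, stdB n j)).2 • stdB n j))
          = ∑ j, inner ℝ b (P (0, stdB n j)).2 • P (0, stdB n j) := by
        have : ((0 : ℝ), ∑ j, inner ℝ b (P (0, stdB n j)).2 • stdB n j)
            = ∑ j, inner ℝ b (P (0, stdB n j)).2 • ((0 : ℝ), stdB n j) := by
          refine Prod.ext ?_ ?_
          · simp [Prod.fst_sum]
          · simp [Prod.snd_sum]
        rw [this, map_sum]
        simp_rw [map_smul]
      refine ext_inner_left ℝ fun a => ?_
      rw [hlin, Prod.snd_sum, inner_sum]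
      simp only [Prod.smul_snd, inner_smul_right]
      rw [← htr a b]
      exact Finset.sum_congr rfl fun j _ => mul_comm _ _
    have h2 : ∑ j, inner ℝ b (P (0, stdB n j)).2 • stdB n j
        = s • (D (liftL L (0, b))).2.1 := by
      rw [← hNP (∑ j, inner ℝ b (P (0, stdB n j)).2 • stdB n j)]
      have h3 : P (0, ∑ j, inner ℝ b (P (0, stdB n j)).2 • stdB n j) = s • ((0 : ℝ), b) :=
        Prod.ext (by simp [hP0]) h1
      rw [h3, map_smul, map_smul]
      rfl
    have h4 : ∀ j, inner ℝ b (P (0, stdB n j)).2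
        = s * inner ℝ (D (liftL L (0, b))).2.1 (stdB n j) := fun j => by
      have := congrArg (fun v => inner ℝ v (stdB n j)) h2
      simp only [inner_smul_left, sum_inner] at this
      simpa [(stdB n).inner_eq_ite] using this
    have h5 : (innerSL ℝ b).toLinearMap ∘ₗ LinearMap.snd ℝ ℝ (Space n) ∘ₗ P.toLinearMap ∘ₗ
        LinearMap.inr ℝ ℝ (Space n) = (s • innerSL ℝ (D (liftL L (0, b))).2.1).toLinearMap :=
      (stdB n).toBasis.ext fun j => by simpa using h4 j
    exact congrArg (fun l => l y) h5
  have h1 := hadj y (D (liftL L (0, y'))).2.1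
  rw [hPN] at h1
  rw [h1]
  linear_combination (-inner ℝ (D (liftL L (0, y))).2.1 (D (liftL L (0, y'))).2.1) * hs

/-- Conformality holds with the same factor for all nearby slopes, so |b + εc|² does not depend on
ε. Adding the relations for ε and −ε leaves ε²|c|² = 0. -/
theorem JetCondition.space_psi_eq_zero (h : JetCondition D D2 σ σ') (hn : 1 ≤ n)
    (hD : Function.Bijective D) (hD2 : ∀ Y y z, (D2 Y (0, y, z)).1 = 0) (z : ℂ) :
    (D (0, 0, z)).2.1 = 0 := by
  obtain ⟨L, P, hP⟩ := exists_isInv hD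
  let a : Space n := stdB n ⟨0, hn⟩
  have hna : ‖a‖ = 1 := OrthonormalBasis.norm_eq_one _ _
  set c := (D (0, 0, z)).2.1 with hc
  set b := (D (liftL L (0, a))).2.1 with hb
  have h0 := h.conformal hn hD hD2 hP a a
  have hev : ∀ᶠ ε : ℝ in 𝓝 0, 2 * ε * inner ℝ b c + ε ^ 2 * ‖c‖ ^ 2 = 0 := by
    filter_upwards [hP.perturb ((innerSnd a).smulRight z)] with ε ⟨P', hP'⟩
    have h1 := h.conformal hn hD hD2 hP' a a
    have h3 : liftL (L + ε • (innerSnd a).smulRight z) (0, a)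
        = liftL L (0, a) + ε • ((0 : ℝ), (0 : Space n), z) := by
      simp [liftL_apply, innerSnd_apply, hna]
    rw [h3, map_add, map_smul, ← h0, Prod.snd_add, Prod.fst_add, Prod.smul_snd, Prod.smul_fst,
      ← hb, ← hc, inner_add_add_self, inner_smul_left, inner_smul_right, inner_smul_left,
      inner_smul_right, real_inner_comm b c, real_inner_self_eq_norm_sq c] at h1
    simp only [conj_trivial] at h1
    linarith
  have h1 : Filter.Tendsto (fun ε : ℝ => -ε) (𝓝 0) (𝓝 0) := by
    simpa using (continuous_neg (G := ℝ)).tendsto 0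
  obtain ⟨ε, ⟨hε1, hε2⟩, hε⟩ := (((hev.and (h1.eventually hev)).filter_mono
      nhdsWithin_le_nhds).and (self_mem_nhdsWithin (s := {0}ᶜ) (a := (0 : ℝ)))).exists
  have h2 : ε ^ 2 * ‖c‖ ^ 2 = 0 := by linear_combination (hε1 + hε2) / 2
  have hε' : ε ≠ 0 := hε
  simpa [hε'] using h2

/-- The restrictions on the first differential of a point transformation between equations of the
considered form. -/
theorem JetCondition.differential (h : JetCondition D D2 σ σ') (hn : 1 ≤ n)
    (hD : Function.Bijective D) (hD2 : ∀ Y y z, (D2 Y (0, y, z)).1 = 0) :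
    (∀ z, baseL n (D (0, 0, z)) = 0) ∧ (D (1, 0, 0)).1 ≠ 0 ∧
    (∀ y y', inner ℝ (D (0, y, 0)).2.1 (D (0, y', 0)).2.1 = |(D (1, 0, 0)).1| * inner ℝ y y') ∧
    (∀ z, psiL n (D (0, 0, Complex.I * z))
      = Real.sign (D (1, 0, 0)).1 * (Complex.I * psiL n (D (0, 0, z)))) := by
  have hb : ∀ z, baseL n (D (0, 0, z)) = 0 := fun z =>
    Prod.ext (h.fst_eq_zero hn hD 0 z) (h.space_psi_eq_zero hn hD hD2 z)
  obtain ⟨L, P, hP⟩ := exists_isInv hD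
  -- The base components no longer see ψ, so the inverse found for one slope serves the zero slope.
  have hP' : IsInv D 0 P := fun v => by
    rw [← hP v, ← sub_eq_zero, ← map_sub, ← map_sub, hP]
    have : liftL 0 (P v) - liftL L (P v) = (0, 0, -L (P v)) := by simp [liftL_apply]
    rw [this, hb]
  have hsem := h.semilinear hn hD hD2 hP'
  refine ⟨hb, fun h0 => ?_, fun y y' => ?_, fun z => ?_⟩
  · have := hsem.1
    rw [h0] at this
    simp at this
  · have := h.conformal hn hD hD2 hP' y y'
    simpa [liftL_apply] using this
  · have := hsem.2 z
    simpa only [transMap_apply, hb, map_zero, sub_zero] using this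

end Jets

/-! ### Fibre-preserving transformations and the remaining determining equation. -/

/-- The properties of the differentials `D` and `D2` of a fibre-preserving point transformation at a
point, where `τ = T_t` and `m = X_x⁻¹ X_t`. -/
structure IsFibredJet (D : Var n →L[ℝ] Var n) (D2 : Var n →L[ℝ] Var n →L[ℝ] Var n)
    (τ : ℝ) (m : Space n) : Prop where
  bij : Function.Bijective D
  ne_zero : τ ≠ 0
  base_psi : ∀ z, baseL n (D (0, 0, z)) = 0
  fst_space : ∀ y, (D (0, y, 0)).1 = 0
  time : baseL n (D (1, -m, 0)) = (τ, 0)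
  conformal : ∀ y y', inner ℝ (D (0, y, 0)).2.1 (D (0, y', 0)).2.1 = |τ| * inner ℝ y y'
  base_second : ∀ y z, baseL n (D2 (0, y, z) (0, y, z)) = 0
  semilinear : ∀ z, psiL n (D (0, 0, Complex.I * z))
    = Real.sign τ * (Complex.I * psiL n (D (0, 0, z)))

/-- The part of the transformed equation that does not reduce to the initial one. -/
def errTerm (D : Var n →L[ℝ] Var n) (D2 : Var n →L[ℝ] Var n →L[ℝ] Var n)
    (τ : ℝ) (m : Space n) (σ σ' : ℂ) (ξ : Space n →L[ℝ] ℂ) : ℂ :=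
  Complex.I / τ * (psiL n (D (1, -m, 0)) - psiL n (D (0, 0, ξ m)))
    + ((|τ| : ℝ) : ℂ)⁻¹ * ∑ j, psiL n (D2 (0, stdB n j, ξ (stdB n j)) (0, stdB n j, ξ (stdB n j)))
    + σ' - ((|τ| : ℝ) : ℂ)⁻¹ * psiL n (D (0, 0, σ))

section

variable {D : Var n →L[ℝ] Var n} {D2 : Var n →L[ℝ] Var n →L[ℝ] Var n} {τ : ℝ} {m : Space n}

theorem IsFibredJet.base_lift (h : IsFibredJet D D2 τ m) (y : Space n) (z : ℂ) :
    baseL n (D (0, y, z)) = (0, (D (0, y, 0)).2.1) := by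
  have h1 : ((0 : ℝ), y, z) = (0, y, 0) + (0, 0, z) := by simp
  rw [h1, map_add, map_add, h.base_psi, add_zero]
  exact Prod.ext (h.fst_space y) rfl

theorem IsFibredJet.psi_injective (h : IsFibredJet D D2 τ m) {z : ℂ}
    (hz : psiL n (D (0, 0, z)) = 0) : z = 0 := by
  have h1 : D (0, 0, z) = D 0 := var_ext (by rw [h.base_psi, map_zero, map_zero])
    (by rw [hz, map_zero, map_zero])
  exact congrArg (psiL n) (h.bij.1 h1)

theorem IsFibredJet.norm_space (h : IsFibredJet D D2 τ m) (y : Space n) :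
    ‖(D (0, y, 0)).2.1‖ ^ 2 = |τ| * ‖y‖ ^ 2 := by
  rw [← real_inner_self_eq_norm_sq, h.conformal, real_inner_self_eq_norm_sq]

/-- An orthonormal basis adapted to the transformed space variables. -/
theorem IsFibredJet.exists_basis (h : IsFibredJet D D2 τ m) :
    ∃ b : OrthonormalBasis (Fin n) ℝ (Space n),
      ∀ j, b j = (Real.sqrt |τ|)⁻¹ • (D (0, stdB n j, 0)).2.1 := by
  have hτ : 0 < |τ| := abs_pos.2 h.ne_zero
  let A : Space n →ₗ[ℝ] Space n := (Real.sqrt |τ|)⁻¹ •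
    (LinearMap.fst ℝ (Space n) ℂ ∘ₗ LinearMap.snd ℝ ℝ (Space n × ℂ) ∘ₗ D.toLinearMap ∘ₗ
      LinearMap.inr ℝ ℝ (Space n × ℂ) ∘ₗ LinearMap.inl ℝ (Space n) ℂ)
  have hA : ∀ y, A y = (Real.sqrt |τ|)⁻¹ • (D (0, y, 0)).2.1 := fun y => rfl
  let e : Space n →ₗᵢ[ℝ] Space n := ⟨A, fun y => by
    rw [hA, norm_smul, ← sq_eq_sq₀ (by positivity) (by positivity), mul_pow, h.norm_space,
      norm_inv, Real.norm_of_nonneg (Real.sqrt_nonneg _), inv_pow, Real.sq_sqrt hτ.le]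
    field_simp⟩
  exact ⟨(stdB n).map (e.toLinearIsometryEquiv rfl), fun j => by
    rw [OrthonormalBasis.map_apply]; exact hA _⟩

/-- In contrast to the general situation, every graph is now transversal: in the basis formed by (1,
−m) and the spatial vectors, the induced map is block diagonal with invertible blocks. -/
theorem IsFibredJet.transversal (h : IsFibredJet D D2 τ m) (L : ℝ × Space n →L[ℝ] ℂ) :
    Function.Bijective ((baseL n).comp (D.comp (liftL L))) := by
  have hinj : Function.Injective ((baseL n).comp (D.comp (liftL L))).toLinearMap := by
    rw [← LinearMap.ker_eq_bot, LinearMap.ker_eq_bot']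
    rintro ⟨s, y⟩ hv
    have h1 : liftL L (s, y) = s • ((1 : ℝ), -m, (0 : ℂ)) + (0, y + s • m, L (s, y)) := by
      simp [liftL_apply]
    change baseL n (D (liftL L (s, y))) = 0 at hv
    rw [h1, map_add, map_add, map_smul, map_smul, h.time, h.base_lift] at hv
    have h2 := congrArg Prod.fst hv
    have h3 := congrArg Prod.snd hv
    simp only [Prod.smul_mk, smul_eq_mul, smul_zero, Prod.mk_add_mk, add_zero, zero_add,
      Prod.fst_zero, Prod.snd_zero] at h2 h3
    have hs : s = 0 := (mul_eq_zero.1 h2).resolve_right h.ne_zero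
    subst hs
    have h4 := h.norm_space (y + (0 : ℝ) • m)
    rw [h3] at h4
    have hτ : |τ| ≠ 0 := abs_ne_zero.2 h.ne_zero
    have h5 : y = 0 := by simpa [hτ] using h4
    rw [h5]; rfl
  exact ⟨hinj, LinearMap.injective_iff_surjective.1 hinj⟩

end

/-- The derivatives u_t and the Hessian of u enter the transformed equation in exactly the
combination in which they enter the initial one. The remainder `errTerm` depends only on the spatial
gradient of u, which makes a splitting with respect to that gradient possible. -/
theorem residual_transform {φ : Var n → Var n} {u u' : ℝ × Space n → ℂ} {q : ℝ × Space n}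
    {S S' : Var n → ℂ} {τ : ℝ} {m : Space n}
    (hj : IsFibredJet (fderiv ℝ φ (graphPt u q)) (fderiv ℝ (fderiv ℝ φ) (graphPt u q)) τ m)
    (hφ : ContDiffAt ℝ ∞ φ (graphPt u q)) (hu : ContDiffAt ℝ ∞ u q)
    (hu' : ContDiffAt ℝ ∞ u' (base (φ (graphPt u q))))
    (h : ∀ᶠ r in 𝓝 q, φ (graphPt u r) = graphPt u' (base (φ (graphPt u r)))) :
    residual S' u' (base (φ (graphPt u q)))
      = ((|τ| : ℝ) : ℂ)⁻¹ * psiL n (fderiv ℝ φ (graphPt u q) (0, 0, residual S u q))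
        + errTerm (fderiv ℝ φ (graphPt u q)) (fderiv ℝ (fderiv ℝ φ) (graphPt u q)) τ m
          (S (graphPt u q) * u q) (S' (φ (graphPt u q)) * psiL n (φ (graphPt u q)))
          ((fderiv ℝ u q).comp (ContinuousLinearMap.inr ℝ ℝ (Space n))) := by
  obtain ⟨hpr1, hpr2⟩ := prolongation hφ hu hu' h
  obtain ⟨b, hb⟩ := hj.exists_basis
  have h0 := h.self_of_nhds
  have hval : u' (base (φ (graphPt u q))) = psiL n (φ (graphPt u q)) := (congrArg (psiL n) h0).symm
  rw [residual_eq S' hu' b, residual_eq S hu (stdB n), ← h0, hval]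
  set p := graphPt u q
  set D := fderiv ℝ φ p
  set D2 := fderiv ℝ (fderiv ℝ φ) p
  set L := fderiv ℝ u q
  set L' := fderiv ℝ u' (base (φ p))
  have hτ : 0 < |τ| := abs_pos.2 hj.ne_zero
  have hτC : (τ : ℂ) ≠ 0 := by exact_mod_cast hj.ne_zero
  have htime : L' (1, 0) = (τ : ℂ)⁻¹ * (psiL n (D (1, -m, 0)) + psiL n (D (0, 0, L (1, 0)))
      - psiL n (D (0, 0, L (0, m)))) := by
    have h1 := hpr1 (1, -m)
    have h2 : liftL L (1, -m) = (1, -m, 0) + (0, 0, L (1, 0)) - (0, 0, L (0, m)) := by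
      have : L (1, -m) = L (1, 0) - L (0, m) := by rw [← map_sub]; simp
      simp [liftL_apply, this]
    rw [h2] at h1
    simp only [map_add, map_sub, hj.base_psi, hj.time, add_zero, sub_zero] at h1
    have h3 : ((τ, 0) : ℝ × Space n) = τ • (1, 0) := by simp
    rw [h3, map_smul, Complex.real_smul] at h1
    rw [h1]; field_simp
  have hspace : ∀ j, fderiv ℝ (fderiv ℝ u') (base (φ p)) (0, b j) (0, b j)
      = ((|τ| : ℝ) : ℂ)⁻¹ * (psiL n (D2 (0, stdB n j, L (0, stdB n j)) (0, stdB n j, L (0, stdB n j)))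
        + psiL n (D (0, 0, fderiv ℝ (fderiv ℝ u) q (0, stdB n j) (0, stdB n j)))) := fun j => by
    have h1 := hpr2 (0, stdB n j) (0, stdB n j)
    simp only [liftL_apply] at h1
    rw [hj.base_lift] at h1
    have h2 : ((0 : ℝ), b j) = (Real.sqrt |τ|)⁻¹ • ((0 : ℝ), (D (0, stdB n j, 0)).2.1) := by
      rw [hb]; simp
    rw [h2, map_smul, map_smul, smul_apply, h1, smul_smul, Complex.real_smul,
      ← mul_inv, Real.mul_self_sqrt hτ.le]
    simp only [sub_apply, ContinuousLinearMap.comp_apply, map_add, hj.base_second, hj.base_psi,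
      map_zero, sub_zero]
    push_cast
    ring
  have hsplit : psiL n (D (0, 0, Complex.I * L (1, 0)
      + ∑ j, fderiv ℝ (fderiv ℝ u) q (0, stdB n j) (0, stdB n j) + S p * u q))
      = Real.sign τ * (Complex.I * psiL n (D (0, 0, L (1, 0))))
        + ∑ j, psiL n (D (0, 0, fderiv ℝ (fderiv ℝ u) q (0, stdB n j) (0, stdB n j)))
        + psiL n (D (0, 0, S p * u q)) := by
    let A : ℂ →ₗ[ℝ] ℂ := (psiL n).toLinearMap ∘ₗ D.toLinearMap ∘ₗ
      LinearMap.inr ℝ ℝ (Space n × ℂ) ∘ₗ LinearMap.inr ℝ (Space n) ℂ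
    have h1 : A (Complex.I * L (1, 0)
        + ∑ j, fderiv ℝ (fderiv ℝ u) q (0, stdB n j) (0, stdB n j) + S p * u q)
        = A (Complex.I * L (1, 0)) + ∑ j, A (fderiv ℝ (fderiv ℝ u) q (0, stdB n j) (0, stdB n j))
          + A (S p * u q) := by
      rw [map_add, map_add, map_sum]
    rw [← hj.semilinear]
    exact h1
  -- This matches the coefficient of u_t, which comes with 1/τ, with that of the Laplacian, which
  -- comes with 1/|τ|: conjugation supplies the missing sign.
  have hsign : ((|τ| : ℝ) : ℂ)⁻¹ * (Real.sign τ : ℂ) = (τ : ℂ)⁻¹ := by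
    have : |τ|⁻¹ * Real.sign τ = τ⁻¹ := by
      rcases lt_or_gt_of_ne hj.ne_zero with h0 | h0
      · rw [Real.sign_of_neg h0, abs_of_neg h0, inv_neg]; ring
      · rw [Real.sign_of_pos h0, abs_of_pos h0]; ring
    exact_mod_cast this
  rw [htime, Finset.sum_congr rfl fun j _ => hspace j, hsplit, errTerm, ← Finset.mul_sum,
    Finset.sum_add_distrib]
  simp only [ContinuousLinearMap.comp_apply, ContinuousLinearMap.inr_apply]
  linear_combination (-(Complex.I * psiL n (D (0, 0, L (1, 0))))) * hsign

/-- Any gradient ξ occurs for a jet satisfying the initial equation: take u_t = 0 and an isotropic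
Hessian with trace −Sψ. On such jets the transformed residual is `errTerm`. The converse uses the
injectivity of the ψ-derivative. -/
theorem mapsEquation_iff_errTerm (hn : 1 ≤ n) {W : Set (Var n)} (hW : IsOpen W)
    {φ : Var n → Var n} (hφ : ContDiffOn ℝ ∞ φ W) {S S' : Var n → ℂ} {τ : Var n → ℝ}
    {m : Var n → Space n}
    (hj : ∀ p ∈ W, IsFibredJet (fderiv ℝ φ p) (fderiv ℝ (fderiv ℝ φ) p) (τ p) (m p)) :
    MapsEquation W φ S S' ↔ ∀ p ∈ W, ∀ ξ, errTerm (fderiv ℝ φ p) (fderiv ℝ (fderiv ℝ φ) p) (τ p)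
      (m p) (S p * psiL n p) (S' (φ p) * psiL n (φ p)) ξ = 0 := by
  constructor
  · intro h p hp ξ
    obtain ⟨u, hu, hu0, hu1, hu2⟩ := exists_jet (base p) p.2.2
      (ξ.comp (ContinuousLinearMap.snd ℝ ℝ (Space n))) (bilInner (-(S p * p.2.2) / n))
      (fun v w => by rw [bilInner_apply, bilInner_apply, real_inner_comm])
    have hup : graphPt u (base p) = p := by
      unfold graphPt; rw [hu0]; rfl
    have hφp : ContDiffAt ℝ ∞ φ (graphPt u (base p)) := by
      rw [hup]; exact hφ.contDiffAt (hW.mem_nhds hp)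
    have hj' := hj p hp
    rw [← hup] at hj'
    rw [← hup] at hp
    obtain ⟨u', hu', hrel⟩ := exists_transformed hφp hu.contDiffAt (hj'.transversal _)
    have hiff := h (base p) u u' hp hu.contDiffAt hu' hrel
    have hres : residual S u (base p) = 0 := by
      rw [residual_eq S hu.contDiffAt (stdB n), hu1, hu2, sum_bilInner hn, hup, hu0]
      simp
    have hres' := hiff.1 hres
    rw [satisfiesAt_iff, residual_transform (S := S) hj' hφp hu.contDiffAt hu' hrel, hres] at hres'
    rw [hup, hu1, hu0] at hres'
    have h0 : (((0 : ℝ), (0 : Space n), (0 : ℂ)) : Var n) = 0 := rfl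
    rw [h0, map_zero, map_zero, mul_zero, zero_add] at hres'
    exact hres'
  · intro h q u u' hq hu hu' hrel
    have hφp := hφ.contDiffAt (hW.mem_nhds hq)
    have hjq := hj _ hq
    have hq' : psiL n (graphPt u q) = u q := rfl
    rw [satisfiesAt_iff, satisfiesAt_iff, residual_transform (S := S) hjq hφp hu hu' hrel, ← hq',
      h _ hq, add_zero]
    have hτ : (((|τ (graphPt u q)| : ℝ) : ℂ))⁻¹ ≠ 0 :=
      inv_ne_zero (by exact_mod_cast abs_ne_zero.2 hjq.ne_zero)
    constructor
    · intro h0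
      rw [h0]
      have h0 : (((0 : ℝ), (0 : Space n), (0 : ℂ)) : Var n) = 0 := rfl
      rw [h0, map_zero, map_zero, mul_zero]
    · intro h0
      exact hjq.psi_injective ((mul_eq_zero.1 h0).resolve_left hτ)

/-! ### Affinity in x and the splitting in the gradient of u. -/

/-- The value at `p` of the vector `X_x⁻¹ X_t`, for a transformation with the differential `D`. -/
def drift (D : Var n →L[ℝ] Var n) : Space n :=
  |(D (1, 0, 0)).1|⁻¹ • ∑ j, inner ℝ (D (0, stdB n j, 0)).2.1 (D (1, 0, 0)).2.1 • stdB n j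

theorem conformal_surjective {D : Var n →L[ℝ] Var n} {τ : ℝ} (hτ : τ ≠ 0)
    (hc : ∀ y y', inner ℝ (D (0, y, 0)).2.1 (D (0, y', 0)).2.1 = |τ| * inner ℝ y y')
    (w : Space n) : ∃ y, (D (0, y, 0)).2.1 = w := by
  let A : Space n →ₗ[ℝ] Space n :=
    LinearMap.fst ℝ (Space n) ℂ ∘ₗ LinearMap.snd ℝ ℝ (Space n × ℂ) ∘ₗ D.toLinearMap ∘ₗ
      LinearMap.inr ℝ ℝ (Space n × ℂ) ∘ₗ LinearMap.inl ℝ (Space n) ℂ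
  have hinj : Function.Injective A := by
    rw [← LinearMap.ker_eq_bot, LinearMap.ker_eq_bot']
    intro y hy
    have h1 := hc y y
    change inner ℝ (A y) (A y) = _ at h1
    rw [hy, inner_zero_left, real_inner_self_eq_norm_sq] at h1
    simpa [hτ] using h1.symm
  exact LinearMap.injective_iff_surjective.1 hinj w

theorem inner_drift {D : Var n →L[ℝ] Var n} (v : Space n) :
    inner ℝ v (drift D) = |(D (1, 0, 0)).1|⁻¹ * inner ℝ (D (0, v, 0)).2.1 (D (1, 0, 0)).2.1 := by
  let A : Space n →ₗ[ℝ] Space n :=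
    LinearMap.fst ℝ (Space n) ℂ ∘ₗ LinearMap.snd ℝ ℝ (Space n × ℂ) ∘ₗ D.toLinearMap ∘ₗ
      LinearMap.inr ℝ ℝ (Space n × ℂ) ∘ₗ LinearMap.inl ℝ (Space n) ℂ
  have hA : ∀ y, (D (0, y, 0)).2.1 = A y := fun y => rfl
  simp only [drift, inner_smul_right, inner_sum, hA]
  congr 1
  conv_rhs => rw [← (stdB n).sum_repr' v]
  rw [map_sum, sum_inner]
  refine Finset.sum_congr rfl fun j _ => ?_
  rw [map_smul, inner_smul_left, mul_comm]
  simp [real_inner_comm]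

/-- The vector `drift` is defined through the adjoint of X_x; conformality turns the adjoint into
|τ| times the inverse. -/
theorem space_drift {D : Var n →L[ℝ] Var n} (hτ : (D (1, 0, 0)).1 ≠ 0)
    (hc : ∀ y y', inner ℝ (D (0, y, 0)).2.1 (D (0, y', 0)).2.1
      = |(D (1, 0, 0)).1| * inner ℝ y y') :
    (D (0, drift D, 0)).2.1 = (D (1, 0, 0)).2.1 := by
  refine ext_inner_left ℝ fun w => ?_
  obtain ⟨y, rfl⟩ := conformal_surjective hτ hc w
  rw [hc, inner_drift, mul_inv_cancel_left₀ (abs_ne_zero.2 hτ)]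

/-- The only new content is the vanishing of the second derivatives of (T, X) along the fibres t =
const. Those involving ψ vanish because the first derivatives in ψ do; X_xx = 0 follows from
conformality with a factor depending on t only. -/
theorem IsFibredJet.of_maps (hn : 1 ≤ n) {W : Set (Var n)} (hW : IsOpen W) {φ : Var n → Var n}
    (hφ : IsPointTransf W φ) {S S' : Var n → ℂ} (h : MapsEquation W φ S S') {p : Var n}
    (hp : p ∈ W) :
    IsFibredJet (fderiv ℝ φ p) (fderiv ℝ (fderiv ℝ φ) p) (fderiv ℝ φ p (1, 0, 0)).1
      (drift (fderiv ℝ φ p)) := by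
  have hjet : ∀ p ∈ W, _ := fun p hp => h.jetCondition hW hφ.smooth hp
  have hT : ∀ p ∈ W, ∀ y z, (fderiv ℝ φ p (0, y, z)).1 = 0 := fun p hp y z =>
    (hjet p hp).fst_eq_zero hn (hφ.nondeg p hp) y z
  have hT2 : ∀ p ∈ W, ∀ Y y z, (fderiv ℝ (fderiv ℝ φ) p Y (0, y, z)).1 = 0 := fun p hp Y y z =>
    clm_fderiv_fderiv_eq_zero hW hφ.smooth (ContinuousLinearMap.fst ℝ ℝ (Space n × ℂ))
      (fun x hx => hT x hx y z) hp Y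
  have hdiff : ∀ p ∈ W, _ := fun p hp =>
    (hjet p hp).differential hn (hφ.nondeg p hp) (hT2 p hp)
  have hψ2 : ∀ Y z, baseL n (fderiv ℝ (fderiv ℝ φ) p Y (0, 0, z)) = 0 := fun Y z =>
    clm_fderiv_fderiv_eq_zero hW hφ.smooth (baseL n) (fun x hx => (hdiff x hx).1 z) hp Y
  have hs := fderiv_fderiv_symm (hφ.smooth.contDiffAt (hW.mem_nhds hp))
  have hd2 := (differentiableAt_fderiv (hφ.smooth.contDiffAt (hW.mem_nhds hp))).hasFDerivAt
  obtain ⟨hb, hτ, hc, hsem⟩ := hdiff p hp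
  set D := fderiv ℝ φ p with hD
  set D2 := fderiv ℝ (fderiv ℝ φ) p with hD2
  -- differentiating the conformality condition
  have hvec : ∀ Y, HasFDerivAt (fun q => (fderiv ℝ φ q Y).2.1)
      ((ContinuousLinearMap.fst ℝ (Space n) ℂ).comp ((ContinuousLinearMap.snd ℝ ℝ (Space n × ℂ)).comp
        (D2.flip Y))) p := fun Y => by
    have h1 : HasFDerivAt (fun q => fderiv ℝ φ q Y) (D2.flip Y) p := by
      refine (hd2.clm_apply (hasFDerivAt_const Y p)).congr_fderiv ?_
      refine ContinuousLinearMap.ext fun v => ?_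
      simp
    exact h1.snd.fst
  have hτd : HasFDerivAt (fun q => (fderiv ℝ φ q (1, 0, 0)).1)
      ((ContinuousLinearMap.fst ℝ ℝ (Space n × ℂ)).comp (D2.flip (1, 0, 0))) p := by
    have h1 : HasFDerivAt (fun q => fderiv ℝ φ q (1, 0, 0)) (D2.flip (1, 0, 0)) p := by
      refine (hd2.clm_apply (hasFDerivAt_const _ p)).congr_fderiv ?_
      refine ContinuousLinearMap.ext fun v => ?_
      simp
    exact h1.fst
  have hskew : ∀ w y y', inner ℝ (D (0, y, 0)).2.1 (D2 (0, w, 0) (0, y', 0)).2.1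
      + inner ℝ (D2 (0, w, 0) (0, y, 0)).2.1 (D (0, y', 0)).2.1 = 0 := fun w y y' => by
    have h1 := (hvec (0, y, 0)).inner ℝ (hvec (0, y', 0))
    have h2 := ((hasDerivAt_abs hτ).comp_hasFDerivAt p hτd).mul_const (inner ℝ y y')
    have h3 : (fun q => inner ℝ (fderiv ℝ φ q (0, y, 0)).2.1 (fderiv ℝ φ q (0, y', 0)).2.1)
        =ᶠ[𝓝 p] fun q => |(fderiv ℝ φ q (1, 0, 0)).1| * inner ℝ y y' := by
      filter_upwards [hW.mem_nhds hp] with q hq using (hdiff q hq).2.2.1 y y'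
    have h4 := h3.fderiv_eq (𝕜 := ℝ)
    rw [h1.fderiv] at h4
    erw [h2.fderiv] at h4
    have h5 := congrArg (fun l => l (0, w, 0)) h4
    have h6 : (D2 (0, w, 0) (1, 0, 0)).1 = 0 := by rw [hs]; exact hT2 p hp _ _ _
    simpa [h6] using h5
  have hsym : ∀ w y, (D2 (0, w, 0) (0, y, 0)).2.1 = (D2 (0, y, 0) (0, w, 0)).2.1 := fun w y => by
    rw [hs]
  -- The trilinear form ⟨X_y', X_wy⟩ is skew in (y', y) by `hskew` and symmetric in (w, y). Six
  -- alternating exchanges turn it into its negative, as in the uniqueness proof for the Levi-Civita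
  -- connection.
  have hzero : ∀ w y, (D2 (0, w, 0) (0, y, 0)).2.1 = 0 := fun w y => by
    refine ext_inner_left ℝ fun v => ?_
    obtain ⟨y', rfl⟩ := conformal_surjective hτ hc v
    rw [inner_zero_right]
    have hsk : ∀ a b c, inner ℝ (D (0, b, 0)).2.1 (D2 (0, a, 0) (0, c, 0)).2.1
        = -inner ℝ (D (0, c, 0)).2.1 (D2 (0, a, 0) (0, b, 0)).2.1 := fun a b c => by
      have := hskew a b c
      rw [real_inner_comm (D (0, c, 0)).2.1] at this
      linarith
    have h1 : inner ℝ (D (0, y', 0)).2.1 (D2 (0, w, 0) (0, y, 0)).2.1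
        = -inner ℝ (D (0, y', 0)).2.1 (D2 (0, w, 0) (0, y, 0)).2.1 := by
      calc _ = -inner ℝ (D (0, y, 0)).2.1 (D2 (0, w, 0) (0, y', 0)).2.1 := hsk w y' y
        _ = -inner ℝ (D (0, y, 0)).2.1 (D2 (0, y', 0) (0, w, 0)).2.1 := by rw [hsym w y']
        _ = inner ℝ (D (0, w, 0)).2.1 (D2 (0, y', 0) (0, y, 0)).2.1 := by
          rw [hsk y' y w, neg_neg]
        _ = inner ℝ (D (0, w, 0)).2.1 (D2 (0, y, 0) (0, y', 0)).2.1 := by rw [hsym y' y]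
        _ = -inner ℝ (D (0, y', 0)).2.1 (D2 (0, y, 0) (0, w, 0)).2.1 := hsk y w y'
        _ = _ := by rw [hsym y w]
    linarith
  refine ⟨hφ.nondeg p hp, hτ, hb, fun y => hT p hp y 0, ?_, hc, fun y z => ?_, hsem⟩
  · have h1 : ((1 : ℝ), -drift D, (0 : ℂ)) = (1, 0, 0) - (0, drift D, 0) := by simp
    rw [h1, map_sub, map_sub]
    refine Prod.ext ?_ ?_
    · show (D (1, 0, 0)).1 - (D (0, drift D, 0)).1 = _
      rw [hT p hp, sub_zero]
    · show (D (1, 0, 0)).2.1 - (D (0, drift D, 0)).2.1 = _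
      rw [space_drift hτ hc, sub_self]
  · have h1 : ((0 : ℝ), y, z) = (0, y, 0) + (0, 0, z) := by simp
    have h2 : baseL n (D2 (0, y, 0) (0, y, 0)) = 0 := Prod.ext (hT2 p hp _ _ _) (hzero y y)
    have h3 : D2 (0, y, z) (0, y, z)
        = D2 (0, y, 0) (0, y, 0) + D2 (0, y, 0) (0, 0, z) + D2 (0, y, z) (0, 0, z) := by
      have h4 : D2 (0, y, z) (0, y, 0)
          = D2 (0, y, 0) (0, y, 0) + D2 (0, y, 0) (0, 0, z) := by
        rw [hs (0, y, z), ← map_add, ← h1]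
      rw [← h4, ← map_add, ← h1]
    rw [h3, map_add, map_add, h2, hψ2, hψ2, add_zero, add_zero]

/-- The splitting of the determining equation with respect to the first-order derivatives. -/
theorem errTerm_split (hn : 1 ≤ n) {D : Var n →L[ℝ] Var n} {D2 : Var n →L[ℝ] Var n →L[ℝ] Var n}
    {τ : ℝ} {m : Space n} {σ σ' : ℂ} (hτ : τ ≠ 0) (hs : ∀ Y Z, D2 Y Z = D2 Z Y)
    (h : ∀ ξ, errTerm D D2 τ m σ σ' ξ = 0) :
    (∀ z, psiL n (D2 (0, 0, z) (0, 0, z)) = 0) ∧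
    (∀ v z, ((|τ| : ℝ) : ℂ)⁻¹ * (2 * psiL n (D2 (0, v, 0) (0, 0, z)))
      = Complex.I / τ * ((inner ℝ v m : ℝ) * psiL n (D (0, 0, z)))) ∧
    Complex.I / τ * psiL n (D (1, -m, 0))
      + ((|τ| : ℝ) : ℂ)⁻¹ * ∑ j, psiL n (D2 (0, stdB n j, 0) (0, stdB n j, 0))
      + σ' - ((|τ| : ℝ) : ℂ)⁻¹ * psiL n (D (0, 0, σ)) = 0 := by
  -- Gradients of rank one, ξ = c⟨v, ·⟩z, suffice: `errTerm` is a quadratic polynomial in c, and the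
  -- values at c = 0, 1, −1 separate its three coefficients.
  have hexp : ∀ (c : ℝ) (v : Space n) (z : ℂ),
      errTerm D D2 τ m σ σ' ((innerSL ℝ v).smulRight (c • z))
      = errTerm D D2 τ m σ σ' 0
        + c * (((|τ| : ℝ) : ℂ)⁻¹ * (2 * psiL n (D2 (0, v, 0) (0, 0, z)))
          - Complex.I / τ * ((inner ℝ v m : ℝ) * psiL n (D (0, 0, z))))
        + c ^ 2 * (((|τ| : ℝ) : ℂ)⁻¹ * ((‖v‖ ^ 2 : ℝ) * psiL n (D2 (0, 0, z) (0, 0, z)))) := by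
    intro c v z
    have h0 : (((0 : ℝ), (0 : Space n), (0 : ℂ)) : Var n) = 0 := rfl
    have hD : psiL n (D (0, 0, (inner ℝ v m : ℝ) • c • z))
        = c * ((inner ℝ v m : ℝ) * psiL n (D (0, 0, z))) := by
      have : ((0 : ℝ), (0 : Space n), (inner ℝ v m : ℝ) • c • z)
          = (inner ℝ v m : ℝ) • c • ((0 : ℝ), (0 : Space n), z) := by simp
      rw [this, map_smul, map_smul, map_smul, map_smul, Complex.real_smul, Complex.real_smul]
      ring
    have hj : ∀ j, psiL n (D2 (0, stdB n j, (inner ℝ v (stdB n j) : ℝ) • c • z)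
          (0, stdB n j, (inner ℝ v (stdB n j) : ℝ) • c • z))
        = psiL n (D2 (0, stdB n j, 0) (0, stdB n j, 0))
          + 2 * c * ((inner ℝ v (stdB n j) : ℝ) * psiL n (D2 (0, stdB n j, 0) (0, 0, z)))
          + c ^ 2 * ((inner ℝ v (stdB n j) ^ 2 : ℝ) * psiL n (D2 (0, 0, z) (0, 0, z))) := by
      intro j
      set r : ℝ := inner ℝ v (stdB n j)
      have : ((0 : ℝ), stdB n j, r • c • z)
          = (0, stdB n j, 0) + r • c • ((0 : ℝ), (0 : Space n), z) := by simp
      rw [this]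
      simp only [map_add, map_smul, add_apply, smul_apply, hs (0, 0, z) (0, stdB n j, 0),
        Complex.real_smul]
      push_cast
      ring
    have hsum1 : ∑ j, ((inner ℝ v (stdB n j) : ℝ) : ℂ) * psiL n (D2 (0, stdB n j, 0) (0, 0, z))
        = psiL n (D2 (0, v, 0) (0, 0, z)) := by
      let A : Space n →ₗ[ℝ] ℂ := (psiL n).toLinearMap ∘ₗ (D2.flip (0, 0, z)).toLinearMap ∘ₗ
        LinearMap.inr ℝ ℝ (Space n × ℂ) ∘ₗ LinearMap.inl ℝ (Space n) ℂ
      have hA : A v = ∑ j, ((inner ℝ v (stdB n j) : ℝ) : ℂ) * A (stdB n j) := by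
        conv_lhs => rw [← (stdB n).sum_repr' v]
        rw [map_sum]
        exact Finset.sum_congr rfl fun j _ => by
          rw [map_smul, Complex.real_smul, real_inner_comm]
      exact hA.symm
    have hsum2 : ∑ j, (inner ℝ v (stdB n j) : ℝ) ^ 2 = ‖v‖ ^ 2 := by
      rw [← real_inner_self_eq_norm_sq, ← (stdB n).sum_inner_mul_inner v v]
      exact Finset.sum_congr rfl fun j _ => by rw [sq, real_inner_comm v]
    simp only [errTerm, ContinuousLinearMap.smulRight_apply, innerSL_apply_apply, zero_apply, h0,
      map_zero]
    rw [hD, Finset.sum_congr rfl fun j _ => hj j, Finset.sum_add_distrib, Finset.sum_add_distrib,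
      ← Finset.mul_sum, ← Finset.mul_sum, hsum1, ← Finset.sum_mul, ← Complex.ofReal_sum, hsum2]
    ring
  have hτ' : ((|τ| : ℝ) : ℂ)⁻¹ ≠ 0 := inv_ne_zero (by exact_mod_cast abs_ne_zero.2 hτ)
  have hq : ∀ (v : Space n) (z : ℂ),
      (((|τ| : ℝ) : ℂ)⁻¹ * (2 * psiL n (D2 (0, v, 0) (0, 0, z)))
          - Complex.I / τ * ((inner ℝ v m : ℝ) * psiL n (D (0, 0, z)))) = 0 ∧
      (((|τ| : ℝ) : ℂ)⁻¹ * ((‖v‖ ^ 2 : ℝ) * psiL n (D2 (0, 0, z) (0, 0, z)))) = 0 := by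
    intro v z
    have h1 := hexp 1 v z
    have h2 := hexp (-1) v z
    rw [h, h] at h1 h2
    push_cast at h1 h2 ⊢
    constructor
    · linear_combination (h2 - h1) / 2
    · linear_combination (-(h1 + h2)) / 2
  refine ⟨fun z => ?_, fun v z => sub_eq_zero.1 (hq v z).1, ?_⟩
  · have h1 := (hq (stdB n ⟨0, hn⟩) z).2
    rw [OrthonormalBasis.norm_eq_one] at h1
    simpa [hτ'] using h1
  · have h1 := h 0
    have h0 : (((0 : ℝ), (0 : Space n), (0 : ℂ)) : Var n) = 0 := rfl
    simpa [errTerm, h0] using h1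

/-! ### Conjugation according to the direction of time. -/

section Hat

/-- `hat τ` as a real-linear map. -/
def hatL (τ : ℝ) : ℂ →L[ℝ] ℂ :=
  if 0 < τ then ContinuousLinearMap.id ℝ ℂ else Complex.conjCLE.toContinuousLinearMap

theorem hatL_apply (τ : ℝ) (z : ℂ) : hatL τ z = hat τ z := by
  unfold hatL hat
  split_ifs <;> simp

theorem hat_mul (τ : ℝ) (z w : ℂ) : hat τ (z * w) = hat τ z * hat τ w := by
  unfold hat; split_ifs <;> simp

theorem hat_add (τ : ℝ) (z w : ℂ) : hat τ (z + w) = hat τ z + hat τ w := by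
  unfold hat; split_ifs <;> simp

theorem hat_sub (τ : ℝ) (z w : ℂ) : hat τ (z - w) = hat τ z - hat τ w := by
  unfold hat; split_ifs <;> simp

theorem hat_ofReal (τ r : ℝ) : hat τ (r : ℂ) = r := by
  unfold hat; split_ifs <;> simp

theorem hat_hat (τ : ℝ) (z : ℂ) : hat τ (hat τ z) = z := by
  unfold hat; split_ifs <;> simp

theorem norm_hat (τ : ℝ) (z : ℂ) : ‖hat τ z‖ = ‖z‖ := by
  unfold hat; split_ifs <;> simp

theorem hat_eq_zero {τ : ℝ} {z : ℂ} : hat τ z = 0 ↔ z = 0 := by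
  rw [← norm_eq_zero, norm_hat, norm_eq_zero]

theorem hat_I {τ : ℝ} (hτ : τ ≠ 0) : hat τ Complex.I = Real.sign τ * Complex.I := by
  unfold hat
  rcases lt_or_gt_of_ne hτ with h | h
  · rw [if_neg h.le.not_gt, Real.sign_of_neg h]; simp
  · rw [if_pos h, Real.sign_of_pos h]; simp

/-- A real-linear map which is complex-linear up to the sign of `τ`. -/
theorem eq_mul_hat {τ : ℝ} (hτ : τ ≠ 0) (A : ℂ →ₗ[ℝ] ℂ)
    (hA : ∀ z, A (Complex.I * z) = Real.sign τ * (Complex.I * A z)) (z : ℂ) :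
    A z = A 1 * hat τ z := by
  have h1 : z = z.re • (1 : ℂ) + z.im • (Complex.I * 1) := by
    apply Complex.ext <;> simp
  have h2 : A z = z.re * A 1 + z.im * (Real.sign τ * (Complex.I * A 1)) := by
    conv_lhs => rw [h1]
    rw [map_add, map_smul, map_smul, hA, Complex.real_smul, Complex.real_smul]
  have h3 : hat τ z = z.re + z.im * (Real.sign τ * Complex.I) := by
    conv_lhs => rw [← Complex.re_add_im z]
    rw [hat_add, hat_mul, hat_ofReal, hat_ofReal, hat_I hτ]
  rw [h2, h3]; ring

end Hat

/-! ### Exclusion of shifts of ψ. -/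

section Rotation

/-- The curve is a rotation about −k, along which |z + k| is constant while |z| in general is not.
-/
theorem hasDerivAt_norm_rotation {z k : ℂ} (hz : z ≠ 0) :
    HasDerivAt (fun α : ℝ => ‖(z + k) * Complex.exp (α * Complex.I) - k‖)
      (inner ℝ z ((z + k) * Complex.I) / ‖z‖) 0 := by
  have hγ : HasDerivAt (fun α : ℝ => (z + k) * Complex.exp (α * Complex.I) - k)
      ((z + k) * Complex.I) 0 := by
    have h1 : HasDerivAt (fun α : ℝ => (α : ℂ) * Complex.I) Complex.I 0 := by
      simpa using (Complex.ofRealCLM.hasDerivAt (x := (0 : ℝ))).mul_const Complex.I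
    simpa using (h1.cexp.const_mul (z + k)).sub_const k
  have h2 := hγ.norm_sq.sqrt (by simp [hz])
  simp only [Real.sqrt_sq (norm_nonneg _)] at h2
  refine h2.congr_deriv ?_
  simp
  field_simp

/-- A modular nonlinearity is not compatible with a shift of the dependent variable. -/
theorem shift_eq_zero {A : Set ℂ} (hA : IsOpen A) (hne : A.Nonempty) (h0 : (0 : ℂ) ∉ A)
    {F g : ℝ → ℂ} {b c k : ℂ} (hg : ∀ z ∈ A, DifferentiableAt ℝ g ‖z‖)
    (hg' : ∀ z ∈ A, deriv g ‖z‖ ≠ 0)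
    (h : ∀ z ∈ A, F ‖z + k‖ * (z + k) = g ‖z‖ * z + b * z + c) : k = 0 := by
  have hexp : ∀ w : ℂ, HasDerivAt (fun α : ℝ => w * Complex.exp (α * Complex.I))
      (w * Complex.I) 0 := fun w => by
    have h1 : HasDerivAt (fun α : ℝ => (α : ℂ) * Complex.I) Complex.I 0 := by
      simpa using (Complex.ofRealCLM.hasDerivAt (x := (0 : ℝ))).mul_const Complex.I
    simpa using h1.cexp.const_mul w
  -- The relation is differentiated along the rotation about −k. There F is frozen, so no regularity
  -- of F is needed; its value is then eliminated by the relation itself. The result involves g and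
  -- g' at |z| and a right-hand side free of z.
  have key : ∀ z ∈ A, deriv g ‖z‖ * (((inner ℝ z (k * Complex.I) / ‖z‖ : ℝ) : ℂ) * z)
      + Complex.I * g ‖z‖ * k = Complex.I * c - Complex.I * b * k := by
    intro z hz
    have hz0 : z ≠ 0 := fun h => h0 (h ▸ hz)
    have hγ := (hexp (z + k)).sub_const k
    have hmem : ∀ᶠ α : ℝ in 𝓝 0, (z + k) * Complex.exp (α * Complex.I) - k ∈ A := by
      refine hγ.continuousAt.preimage_mem_nhds (hA.mem_nhds ?_)
      simpa using hz
    have hgz : HasDerivAt g (deriv g ‖z‖)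
        ‖(z + k) * Complex.exp ((0 : ℝ) * Complex.I) - k‖ := by
      simpa using (hg z hz).hasDerivAt
    have hR := (((hgz.scomp 0 (hasDerivAt_norm_rotation (k := k) hz0)).mul hγ).add
      (hγ.const_mul b)).add_const c
    have hL := (hexp (z + k)).const_mul (F ‖z + k‖)
    have heq : (fun α : ℝ => F ‖z + k‖ * ((z + k) * Complex.exp (α * Complex.I))) =ᶠ[𝓝 0]
        fun α : ℝ => g ‖(z + k) * Complex.exp (α * Complex.I) - k‖
          * ((z + k) * Complex.exp (α * Complex.I) - k)
          + b * ((z + k) * Complex.exp (α * Complex.I) - k) + c := by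
      filter_upwards [hmem] with α hα
      rw [← h _ hα]
      simp [Complex.norm_exp_ofReal_mul_I]
    have hd := heq.deriv_eq
    rw [hL.deriv] at hd
    erw [hR.deriv] at hd
    have hz1 := h z hz
    have hin : inner ℝ z ((z + k) * Complex.I) = (inner ℝ z (k * Complex.I) : ℝ) := by
      rw [add_mul, inner_add_right]
      have : inner ℝ z (z * Complex.I) = (0 : ℝ) := by
        rw [Complex.inner]; simp; ring
      rw [this, zero_add]
    rw [hin] at hd
    simp only [Function.comp_apply, Complex.real_smul, Complex.ofReal_zero, zero_mul,
      Complex.exp_zero, mul_one, add_sub_cancel_right] at hd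
    linear_combination (-1 : ℂ) * hd + Complex.I * hz1
  obtain ⟨z, hz⟩ := hne
  have hz0 : z ≠ 0 := fun h => h0 (h ▸ hz)
  -- A second point of A with the same modulus: g and g' take the same values there, and subtraction
  -- leaves a'e^{iβ} = a with real a, a'. As sin β ≠ 0, both vanish, so k is parallel to two
  -- directions with different real spans.
  have hmem : ∀ᶠ β : ℝ in 𝓝 0, z * Complex.exp (β * Complex.I) ∈ A := by
    refine (hexp z).continuousAt.preimage_mem_nhds (hA.mem_nhds ?_)
    simpa using hz
  have hpi : ∀ᶠ β : ℝ in 𝓝[>] 0, β < Real.pi :=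
    nhdsWithin_le_nhds (eventually_lt_nhds Real.pi_pos)
  obtain ⟨β, ⟨hβA, hβpi⟩, hβ⟩ := (((hmem.filter_mono nhdsWithin_le_nhds).and hpi).and
    (self_mem_nhdsWithin (s := Set.Ioi 0) (a := (0 : ℝ)))).exists
  have hsin : Real.sin β ≠ 0 := (Real.sin_pos_of_pos_of_lt_pi hβ hβpi).ne'
  have h1 := key z hz
  have h2 := key _ hβA
  have hnorm : ‖z * Complex.exp (β * Complex.I)‖ = ‖z‖ := by
    simp [Complex.norm_exp_ofReal_mul_I]
  rw [hnorm] at h2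
  set a : ℝ := inner ℝ z (k * Complex.I) with ha
  set a' : ℝ := inner ℝ (z * Complex.exp (β * Complex.I)) (k * Complex.I) with ha'
  have h3 : deriv g ‖z‖ * z * ((‖z‖ : ℂ)⁻¹ * (a' * Complex.exp (β * Complex.I) - a)) = 0 := by
    push_cast at h1 h2
    linear_combination h2 - h1
  have hnz : (‖z‖ : ℂ)⁻¹ ≠ 0 := inv_ne_zero (by exact_mod_cast norm_ne_zero_iff.2 hz0)
  have h4 : (a' : ℂ) * Complex.exp (β * Complex.I) - a = 0 :=
    (mul_eq_zero.1 ((mul_eq_zero.1 h3).resolve_left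
      (mul_ne_zero (hg' z hz) hz0))).resolve_left hnz
  rw [Complex.exp_mul_I, ← Complex.ofReal_cos, ← Complex.ofReal_sin] at h4
  have him := congrArg Complex.im h4
  have hre := congrArg Complex.re h4
  simp at him hre
  have ha'0 : a' = 0 := him.resolve_right hsin
  have ha0 : a = 0 := by rw [ha'0] at hre; linarith
  have hcos : a' = a * Real.cos β + Real.sin β * (z.re * k.re + z.im * k.im) := by
    rw [ha', ha, Complex.inner, Complex.inner, Complex.exp_mul_I, ← Complex.ofReal_cos,
      ← Complex.ofReal_sin]
    simp [-Complex.ofReal_cos, -Complex.ofReal_sin]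
    ring
  have hk1 : z.re * k.re + z.im * k.im = 0 := by
    rw [ha0, ha'0, zero_mul, zero_add] at hcos
    exact (mul_eq_zero.1 hcos.symm).resolve_left hsin
  have hk2 : z.im * k.re - z.re * k.im = 0 := by
    have := ha0
    rw [ha, Complex.inner] at this
    simp at this
    linarith
  have hk3 : (starRingEnd ℂ z) * k = 0 := by
    apply Complex.ext
    · simp; linarith
    · simp; linarith
  exact (mul_eq_zero.1 hk3).resolve_left (by simpa using hz0)

end Rotation

/-! ### Integration over slices and the form of the transformation affine in x and ψ̂. -/

section Slices

variable {F : Type*} [NormedAddCommGroup F] [NormedSpace ℝ F]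

/-- A function on a product domain whose derivatives in `(x, ψ)` vanish depends only on `t`. -/
theorem eq_of_fderiv_space_psi {I : Set ℝ} {D : Set (Space n)} {A : Set ℂ}
    (hD : IsOpen D) (hD' : IsConnected D) (hA : IsOpen A) (hA' : IsConnected A)
    {f : Var n → F} (hf : ∀ p ∈ I ×ˢ D ×ˢ A, DifferentiableAt ℝ f p)
    (h : ∀ p ∈ I ×ˢ D ×ˢ A, ∀ y z, fderiv ℝ f p (0, y, z) = 0) {t : ℝ} (ht : t ∈ I)
    {x x' : Space n} {z z' : ℂ} (hx : x ∈ D) (hx' : x' ∈ D) (hz : z ∈ A) (hz' : z' ∈ A) :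
    f (t, x, z) = f (t, x', z') := by
  have hd : ∀ y ∈ D ×ˢ A, HasFDerivAt (fun y : Space n × ℂ => f (t, y))
      ((fderiv ℝ f (t, y)).comp (ContinuousLinearMap.inr ℝ ℝ (Space n × ℂ))) y := fun y hy =>
    (hf (t, y) ⟨ht, hy⟩).hasFDerivAt.comp y (hasFDerivAt_prodMk_right t y)
  refine (hD.prod hA).is_const_of_fderiv_eq_zero (f := fun y : Space n × ℂ => f (t, y)) (𝕜 := ℝ)
    (hD'.isPreconnected.prod hA'.isPreconnected)
    (fun y hy => (hd y hy).differentiableAt.differentiableWithinAt) (fun y hy => ?_)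
    (x := (x, z)) (y := (x', z')) ⟨hx, hz⟩ ⟨hx', hz'⟩
  rw [(hd y hy).fderiv]
  exact ContinuousLinearMap.ext fun w => h (t, y) ⟨ht, hy⟩ w.1 w.2

/-- A function on a product domain whose derivatives in `ψ` vanish depends only on `(t, x)`. -/
theorem eq_of_fderiv_psi {I : Set ℝ} {D : Set (Space n)} {A : Set ℂ}
    (hA : IsOpen A) (hA' : IsConnected A)
    {f : Var n → F} (hf : ∀ p ∈ I ×ˢ D ×ˢ A, DifferentiableAt ℝ f p)
    (h : ∀ p ∈ I ×ˢ D ×ˢ A, ∀ z, fderiv ℝ f p (0, 0, z) = 0) {t : ℝ} (ht : t ∈ I)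
    {x : Space n} {z z' : ℂ} (hx : x ∈ D) (hz : z ∈ A) (hz' : z' ∈ A) :
    f (t, x, z) = f (t, x, z') := by
  have hd : ∀ y ∈ A, HasFDerivAt (fun y : ℂ => f (t, x, y))
      ((fderiv ℝ f (t, x, y)).comp ((ContinuousLinearMap.inr ℝ ℝ (Space n × ℂ)).comp
        (ContinuousLinearMap.inr ℝ (Space n) ℂ))) y := fun y hy =>
    (hf (t, x, y) ⟨ht, hx, hy⟩).hasFDerivAt.comp y ((hasFDerivAt_prodMk_right t (x, y)).comp y
      (hasFDerivAt_prodMk_right x y))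
  refine hA.is_const_of_fderiv_eq_zero (f := fun y : ℂ => f (t, x, y)) (𝕜 := ℝ)
    hA'.isPreconnected
    (fun y hy => (hd y hy).differentiableAt.differentiableWithinAt) (fun y hy => ?_) hz hz'
  rw [(hd y hy).fderiv]
  exact ContinuousLinearMap.ext fun w => h (t, x, y) ⟨ht, hx, hy⟩ w

end Slices

/-- The quantities `B`, `X`, `Ψ₁`, `Ψ₀` in the form `t' = T(t)`, `x' = B(t) x + X(t)`,
`ψ' = Ψ₁(t,x) ψ̂ + Ψ₀(t,x)` of a point transformation, where `B` is conformal. -/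
structure FibredForm (I : Set ℝ) (D : Set (Space n)) (A : Set ℂ) (φ : Var n → Var n)
    (T : ℝ → ℝ) (B : ℝ → Space n →L[ℝ] Space n) (X : ℝ → Space n)
    (Ψ₁ Ψ₀ : ℝ × Space n → ℂ) : Prop where
  smooth_T : ContDiffOn ℝ ∞ T I
  smooth_B : ContDiffOn ℝ ∞ B I
  smooth_X : ContDiffOn ℝ ∞ X I
  smooth_Ψ₁ : ContDiffOn ℝ ∞ Ψ₁ (I ×ˢ D)
  smooth_Ψ₀ : ContDiffOn ℝ ∞ Ψ₀ (I ×ˢ D)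
  deriv_ne : ∀ t ∈ I, deriv T t ≠ 0
  conformal : ∀ t ∈ I, ∀ y y', inner ℝ (B t y) (B t y') = |deriv T t| * inner ℝ y y'
  ne_zero : ∀ q ∈ I ×ˢ D, Ψ₁ q ≠ 0
  eq : ∀ p ∈ I ×ˢ D ×ˢ A, φ p = (T p.1, B p.1 p.2.1 + X p.1,
    Ψ₁ (base p) * hat (deriv T p.1) p.2.2 + Ψ₀ (base p))
  fderiv_Ψ₁ : ∀ t ∈ I, ∀ x ∈ D, ∀ v, fderiv ℝ Ψ₁ (t, x) (0, v)
    = Complex.I / (2 * deriv T t) * (inner ℝ (B t v) (deriv B t x + deriv X t) : ℝ) * Ψ₁ (t, x)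
  psi_deriv : ∀ p ∈ I ×ˢ D ×ˢ A, ∀ z,
    psiL n (fderiv ℝ φ p (0, 0, z)) = Ψ₁ (base p) * hat (deriv T p.1) z
  time_eq : ∀ p ∈ I ×ˢ D ×ˢ A, (fderiv ℝ φ p (1, 0, 0)).1 = deriv T p.1
  space_eq : ∀ p ∈ I ×ˢ D ×ˢ A, ∀ y, (fderiv ℝ φ p (0, y, 0)).2.1 = B p.1 y
  space_time_eq : ∀ p ∈ I ×ˢ D ×ˢ A,
    (fderiv ℝ φ p (1, 0, 0)).2.1 = deriv B p.1 p.2.1 + deriv X p.1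

theorem polarize {E F : Type*} [NormedAddCommGroup E] [NormedSpace ℝ E] [NormedAddCommGroup F]
    [NormedSpace ℝ F] {Q : E →L[ℝ] E →L[ℝ] F} (hs : ∀ v w, Q v w = Q w v) {v w : E}
    (hv : Q v v = 0) (hw : Q w w = 0) (hvw : Q (v + w) (v + w) = 0) : Q v w = 0 := by
  simp only [map_add, add_apply, hv, hw, hs w v, zero_add, add_zero] at hvw
  rw [← two_smul ℝ] at hvw
  exact (smul_eq_zero.1 hvw).resolve_left two_ne_zero

/-- The pointwise relations T_x = T_ψ = X_ψ = X_xx = Ψ_ψψ = 0 are integrated over connected slices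
of the product domain, starting from a fixed point (x₀, ψ₀). The coefficient of `errTerm` linear in
the gradient becomes the differential equation for Ψ₁. -/
theorem exists_fibredForm (hn : 1 ≤ n) {I : Set ℝ} {D : Set (Space n)} {A : Set ℂ}
    (hI : IsOpen I) (hD : IsOpen D) (hD' : IsConnected D) (hA : IsOpen A) (hA' : IsConnected A)
    {φ : Var n → Var n} (hφ : IsPointTransf (I ×ˢ D ×ˢ A) φ) {S S' : Var n → ℂ}
    (h : MapsEquation (I ×ˢ D ×ˢ A) φ S S') :
    ∃ T B X Ψ₁ Ψ₀, FibredForm I D A φ T B X Ψ₁ Ψ₀ := by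
  obtain ⟨x₀, hx₀⟩ := hD'.nonempty
  obtain ⟨ψ₀, hψ₀⟩ := hA'.nonempty
  have hW : IsOpen (I ×ˢ D ×ˢ A) := hI.prod (hD.prod hA)
  have hsm : ∀ p ∈ I ×ˢ D ×ˢ A, ContDiffAt ℝ ∞ φ p := fun p hp =>
    hφ.smooth.contDiffAt (hW.mem_nhds hp)
  have hdφ : ∀ p ∈ I ×ˢ D ×ˢ A, HasFDerivAt φ (fderiv ℝ φ p) p := fun p hp =>
    ((hsm p hp).differentiableAt (by simp)).hasFDerivAt
  have hj : ∀ p ∈ I ×ˢ D ×ˢ A, _ := fun p hp => IsFibredJet.of_maps hn hW hφ h hp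
  have hsym : ∀ p ∈ I ×ˢ D ×ˢ A, _ := fun p hp => fderiv_fderiv_symm (hsm p hp)
  have herr := (mapsEquation_iff_errTerm hn hW hφ.smooth hj).1 h
  have hsp : ∀ p ∈ I ×ˢ D ×ˢ A, _ := fun p hp =>
    errTerm_split hn (hj p hp).ne_zero (hsym p hp) (herr p hp)
  have hd1 : ∀ (Y : Var n), ∀ p ∈ I ×ˢ D ×ˢ A, HasFDerivAt (fun q => fderiv ℝ φ q Y)
      ((fderiv ℝ (fderiv ℝ φ) p).flip Y) p := fun Y p hp => by
    refine ((differentiableAt_fderiv (hsm p hp)).hasFDerivAt.clm_apply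
      (hasFDerivAt_const Y p)).congr_fderiv ?_
    refine ContinuousLinearMap.ext fun v => ?_
    simp
  have hbase2 : ∀ p ∈ I ×ˢ D ×ˢ A, ∀ y z y' z',
      baseL n (fderiv ℝ (fderiv ℝ φ) p (0, y, z) (0, y', z')) = 0 := fun p hp y z y' z' => by
    have h1 := polarize (Q := (ContinuousLinearMap.compL ℝ (Var n) (Var n) (ℝ × Space n)
      (baseL n)).comp (fderiv ℝ (fderiv ℝ φ) p)) (v := (0, y, z)) (w := (0, y', z'))
      (fun v w => congrArg (baseL n) (hsym p hp v w)) ((hj p hp).base_second y z)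
      ((hj p hp).base_second y' z') (by
        have h2 := (hj p hp).base_second (y + y') (z + z')
        simpa using h2)
    exact h1
  have hpsi2 : ∀ p ∈ I ×ˢ D ×ˢ A, ∀ z z',
      psiL n (fderiv ℝ (fderiv ℝ φ) p (0, 0, z) (0, 0, z')) = 0 := fun p hp z z' => by
    have h1 := polarize (Q := (ContinuousLinearMap.compL ℝ (Var n) (Var n) ℂ
      (psiL n)).comp (fderiv ℝ (fderiv ℝ φ) p)) (v := (0, 0, z)) (w := (0, 0, z'))
      (fun v w => congrArg (psiL n) (hsym p hp v w)) ((hsp p hp).1 z)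
      ((hsp p hp).1 z') (by
        have h2 := (hsp p hp).1 (z + z')
        simpa using h2)
    exact h1
  -- the transformation of the independent variables
  let line : ℝ → Var n := fun t => (t, x₀, ψ₀)
  have hline : ContDiff ℝ ∞ line := contDiff_id.prodMk contDiff_const
  have hmaps : Set.MapsTo line I (I ×ˢ D ×ˢ A) := fun t ht => ⟨ht, hx₀, hψ₀⟩
  let T : ℝ → ℝ := fun t => (φ (t, x₀, ψ₀)).1
  let B : ℝ → Space n →L[ℝ] Space n := fun t =>
    (ContinuousLinearMap.fst ℝ (Space n) ℂ).comp ((ContinuousLinearMap.snd ℝ ℝ (Space n × ℂ)).comp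
      ((fderiv ℝ φ (t, x₀, ψ₀)).comp ((ContinuousLinearMap.inr ℝ ℝ (Space n × ℂ)).comp
        (ContinuousLinearMap.inl ℝ (Space n) ℂ))))
  let X : ℝ → Space n := fun t => (φ (t, x₀, ψ₀)).2.1 - B t x₀
  let Ψ₁ : ℝ × Space n → ℂ := fun q => psiL n (fderiv ℝ φ (q.1, q.2, ψ₀) (0, 0, 1))
  let Ψ₀ : ℝ × Space n → ℂ := fun q => psiL n (φ (q.1, q.2, ψ₀)) - Ψ₁ q * hat (deriv T q.1) ψ₀
  have hTs : ContDiffOn ℝ ∞ T I := contDiff_fst.comp_contDiffOn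
    (hφ.smooth.comp hline.contDiffOn hmaps)
  have hfs : ContDiffOn ℝ ∞ (fderiv ℝ φ) (I ×ˢ D ×ˢ A) :=
    hφ.smooth.fderiv_of_isOpen hW (by simp)
  have hBs : ContDiffOn ℝ ∞ B I :=
    contDiffOn_const.clm_comp (contDiffOn_const.clm_comp
      ((hfs.comp hline.contDiffOn hmaps).clm_comp contDiffOn_const))
  have hXs : ContDiffOn ℝ ∞ X I :=
    ((contDiff_fst.comp contDiff_snd).comp_contDiffOn
      (hφ.smooth.comp hline.contDiffOn hmaps)).sub (hBs.clm_apply contDiffOn_const)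
  have hT : ∀ p ∈ I ×ˢ D ×ˢ A, (φ p).1 = T p.1 := fun p hp =>
    eq_of_fderiv_space_psi hD hD' hA hA' (f := fun p => (φ p).1)
      (fun p hp => (hdφ p hp).fst.differentiableAt)
      (fun p hp y z => by
        rw [(hdφ p hp).fst.fderiv]
        exact congrArg Prod.fst ((hj p hp).base_lift y z)) hp.1 hp.2.1 hx₀ hp.2.2 hψ₀
  have hB : ∀ p ∈ I ×ˢ D ×ˢ A, ∀ y, (fderiv ℝ φ p (0, y, 0)).2.1 = B p.1 y := fun p hp y =>
    eq_of_fderiv_space_psi hD hD' hA hA' (f := fun p => (fderiv ℝ φ p (0, y, 0)).2.1)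
      (fun p hp => (hd1 _ p hp).snd.fst.differentiableAt)
      (fun p hp y' z' => by
        rw [(hd1 _ p hp).snd.fst.fderiv]
        exact congrArg Prod.snd (hbase2 p hp y' z' y 0)) hp.1 hp.2.1 hx₀ hp.2.2 hψ₀
  have hX : ∀ p ∈ I ×ˢ D ×ˢ A, (φ p).2.1 = B p.1 p.2.1 + X p.1 := fun p hp => by
    have hdB : ∀ p' : Var n, HasFDerivAt (fun p' : Var n => B p.1 p'.2.1)
        ((B p.1).comp ((ContinuousLinearMap.fst ℝ (Space n) ℂ).comp
          (ContinuousLinearMap.snd ℝ ℝ (Space n × ℂ)))) p' := fun p' =>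
      (B p.1).hasFDerivAt.comp p' (hasFDerivAt_snd.fst)
    -- The time interval is shrunk to one point: B is frozen at that time, so X − Bx has zero
    -- derivative only along the fibre.
    have h1 := eq_of_fderiv_space_psi (I := {p.1}) hD hD' hA hA'
      (f := fun p' => (φ p').2.1 - B p.1 p'.2.1)
      (fun p' hp' => ((hdφ p' ⟨hp'.1 ▸ hp.1, hp'.2⟩).snd.fst.sub (hdB p')).differentiableAt)
      (fun p' hp' y z => by
        have hp'' : p' ∈ I ×ˢ D ×ˢ A := ⟨hp'.1 ▸ hp.1, hp'.2⟩
        have h0 := congrArg (fun l => l (0, y, z)) ((hdφ p' hp'').snd.fst.sub (hdB p')).fderiv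
        refine h0.trans ?_
        have h2 := congrArg Prod.snd ((hj p' hp'').base_lift y z)
        have h3 := hB p' hp'' y
        have h4 : p'.1 = p.1 := hp'.1
        rw [h4] at h3
        exact sub_eq_zero.2 (h2.trans h3)) rfl hp.2.1 hx₀ hp.2.2 hψ₀
    rw [← sub_eq_iff_eq_add']
    exact h1
  have htime : ∀ p ∈ I ×ˢ D ×ˢ A, HasDerivAt (fun s : ℝ => φ (s, p.2))
      (fderiv ℝ φ p (1, 0, 0)) p.1 :=
    fun p hp => (hdφ p hp).comp_hasDerivAt (f := fun s : ℝ => ((s, p.2) : Var n)) p.1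
      ((hasDerivAt_id p.1).prodMk (hasDerivAt_const p.1 p.2))
  have hT' : ∀ p ∈ I ×ˢ D ×ˢ A, (fderiv ℝ φ p (1, 0, 0)).1 = deriv T p.1 := fun p hp => by
    have h1 : (fun s : ℝ => (φ (s, p.2)).1) =ᶠ[𝓝 p.1] T := by
      filter_upwards [hI.mem_nhds hp.1] with s hs using hT (s, p.2) ⟨hs, hp.2⟩
    rw [← h1.deriv_eq]
    exact ((ContinuousLinearMap.fst ℝ ℝ (Space n × ℂ)).hasFDerivAt.comp_hasDerivAt p.1
      (htime p hp)).deriv.symm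
  have hX' : ∀ p ∈ I ×ˢ D ×ˢ A,
      (fderiv ℝ φ p (1, 0, 0)).2.1 = deriv B p.1 p.2.1 + deriv X p.1 := fun p hp => by
    have h1 : (fun s : ℝ => (φ (s, p.2)).2.1) =ᶠ[𝓝 p.1] fun s => B s p.2.1 + X s := by
      filter_upwards [hI.mem_nhds hp.1] with s hs using hX (s, p.2) ⟨hs, hp.2⟩
    have h2 : HasDerivAt B (deriv B p.1) p.1 :=
      ((hBs.contDiffAt (hI.mem_nhds hp.1)).differentiableAt (by simp)).hasDerivAt
    have h3 : HasDerivAt X (deriv X p.1) p.1 :=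
      ((hXs.contDiffAt (hI.mem_nhds hp.1)).differentiableAt (by simp)).hasDerivAt
    have h4 := ((h2.clm_apply (hasDerivAt_const p.1 p.2.1)).add h3).deriv
    have h5 := (((ContinuousLinearMap.fst ℝ (Space n) ℂ).comp
      (ContinuousLinearMap.snd ℝ ℝ (Space n × ℂ))).hasFDerivAt.comp_hasDerivAt p.1
        (htime p hp)).deriv
    refine h5.symm.trans (h1.deriv_eq.trans (h4.trans ?_))
    simp
  have hτ : ∀ t ∈ I, deriv T t ≠ 0 := fun t ht => by
    rw [← hT' (t, x₀, ψ₀) ⟨ht, hx₀, hψ₀⟩]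
    exact (hj (t, x₀, ψ₀) ⟨ht, hx₀, hψ₀⟩).ne_zero
  -- the transformation of the dependent variable
  have hΨ₁ : ∀ p ∈ I ×ˢ D ×ˢ A, ∀ z,
      psiL n (fderiv ℝ φ p (0, 0, z)) = Ψ₁ (base p) * hat (deriv T p.1) z := fun p hp z => by
    have h1 : psiL n (fderiv ℝ φ p (0, 0, 1)) = Ψ₁ (base p) :=
      eq_of_fderiv_psi hA hA' (f := fun p => psiL n (fderiv ℝ φ p (0, 0, 1)))
        (fun p hp => ((psiL n).hasFDerivAt.comp p (hd1 _ p hp)).differentiableAt)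
        (fun p hp z => by
          have := ((psiL n).hasFDerivAt.comp p (hd1 (0, 0, 1) p hp)).fderiv
          have h2 := congrArg (fun l => l (0, 0, z)) this
          exact h2.trans (hpsi2 p hp z 1)) hp.1 hp.2.1 hp.2.2 hψ₀
    let L : ℂ →ₗ[ℝ] ℂ := (psiL n).toLinearMap ∘ₗ (fderiv ℝ φ p).toLinearMap ∘ₗ
      LinearMap.inr ℝ ℝ (Space n × ℂ) ∘ₗ LinearMap.inr ℝ (Space n) ℂ
    rw [← h1]
    refine eq_mul_hat (hτ p.1 hp.1) L (fun z => ?_) z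
    have := (hj p hp).semilinear z
    rw [hT' p hp] at this
    exact this
  have hslice : ContDiff ℝ ∞ fun q : ℝ × Space n => ((q.1, q.2, ψ₀) : Var n) := by fun_prop
  have hslm : Set.MapsTo (fun q : ℝ × Space n => ((q.1, q.2, ψ₀) : Var n)) (I ×ˢ D)
      (I ×ˢ D ×ˢ A) := fun q hq => ⟨hq.1, hq.2, hψ₀⟩
  have hΨ₁s : ContDiffOn ℝ ∞ Ψ₁ (I ×ˢ D) := (psiL n).contDiff.comp_contDiffOn
    ((hfs.comp hslice.contDiffOn hslm).clm_apply contDiffOn_const)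
  have hΨ : ∀ p ∈ I ×ˢ D ×ˢ A,
      psiL n (φ p) = Ψ₁ (base p) * hat (deriv T p.1) p.2.2 + Ψ₀ (base p) := fun p hp => by
    have hdh : ∀ p' : Var n, HasFDerivAt (fun p' : Var n => Ψ₁ (base p) * hatL (deriv T p.1) p'.2.2)
        (Ψ₁ (base p) • ((hatL (deriv T p.1)).comp (psiL n))) p' := fun p' =>
      ((hatL (deriv T p.1)).hasFDerivAt.comp p' (psiL n).hasFDerivAt).const_mul _
    have hp1 : ∀ p' ∈ ({p.1} : Set ℝ) ×ˢ ({p.2.1} : Set (Space n)) ×ˢ A, p' ∈ I ×ˢ D ×ˢ A :=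
      fun p' hp' => ⟨hp'.1 ▸ hp.1, hp'.2.1 ▸ hp.2.1, hp'.2.2⟩
    have h1 := eq_of_fderiv_psi (I := {p.1}) (D := {p.2.1}) hA hA'
      (f := fun p' => psiL n (φ p') - Ψ₁ (base p) * hatL (deriv T p.1) p'.2.2)
      (fun p' hp' => (((psiL n).hasFDerivAt.comp p' (hdφ p' (hp1 p' hp'))).sub
        (hdh p')).differentiableAt)
      (fun p' hp' z => by
        have h2 := (((psiL n).hasFDerivAt.comp p' (hdφ p' (hp1 p' hp'))).sub (hdh p')).fderiv
        have h3 := congrArg (fun l => l (0, 0, z)) h2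
        refine h3.trans (sub_eq_zero.2 ?_)
        refine (hΨ₁ p' (hp1 p' hp') z).trans ?_
        have h4 : p'.1 = p.1 := hp'.1
        have h5 : base p' = base p := Prod.ext hp'.1 hp'.2.1
        rw [h4, h5, ← hatL_apply]
        rfl) rfl rfl hp.2.2 hψ₀
    rw [hatL_apply, hatL_apply] at h1
    rw [← sub_eq_iff_eq_add']
    exact h1
  have hΨ₁0 : ∀ q ∈ I ×ˢ D, Ψ₁ q ≠ 0 := fun q hq h0 =>
    one_ne_zero ((hj (q.1, q.2, ψ₀) ⟨hq.1, hq.2, hψ₀⟩).psi_injective (z := 1) h0)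
  have hTs' : ContDiffOn ℝ ∞ (deriv T) I := hTs.deriv_of_isOpen hI (by simp)
  have hhat : ContDiffOn ℝ ∞ (fun q : ℝ × Space n => hat (deriv T q.1) ψ₀) (I ×ˢ D) := by
    intro q hq
    have hcont : ContinuousAt (deriv T) q.1 := (hTs'.contDiffAt (hI.mem_nhds hq.1)).continuousAt
    have hev : ∀ᶠ s in 𝓝 q.1, hat (deriv T s) ψ₀ = hat (deriv T q.1) ψ₀ := by
      rcases lt_or_gt_of_ne (hτ q.1 hq.1) with h0 | h0
      · filter_upwards [hcont.eventually (eventually_lt_nhds h0)] with s hs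
        rw [hat, hat, if_neg hs.le.not_gt, if_neg h0.le.not_gt]
      · filter_upwards [hcont.eventually (eventually_gt_nhds h0)] with s hs
        rw [hat, hat, if_pos hs, if_pos h0]
    refine ContDiffAt.contDiffWithinAt ?_
    refine (contDiffAt_const (c := hat (deriv T q.1) ψ₀)).congr_of_eventuallyEq ?_
    exact continuousAt_fst.eventually hev
  have hΨ₀s : ContDiffOn ℝ ∞ Ψ₀ (I ×ˢ D) :=
    ((psiL n).contDiff.comp_contDiffOn (hφ.smooth.comp hslice.contDiffOn hslm)).sub
      (hΨ₁s.mul hhat)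
  refine ⟨T, B, X, Ψ₁, Ψ₀, hTs, hBs, hXs, hΨ₁s, hΨ₀s, hτ, fun t ht y y' => ?_, hΨ₁0,
    fun p hp => var_ext (Prod.ext (hT p hp) (hX p hp)) (hΨ p hp), fun t ht x hx v => ?_, hΨ₁, hT',
    hB, hX'⟩
  · have hp : ((t, x₀, ψ₀) : Var n) ∈ I ×ˢ D ×ˢ A := ⟨ht, hx₀, hψ₀⟩
    have h1 := (hj _ hp).conformal y y'
    rwa [hT' _ hp, hB _ hp, hB _ hp] at h1
  · have hp : ((t, x, ψ₀) : Var n) ∈ I ×ˢ D ×ˢ A := ⟨ht, hx, hψ₀⟩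
    have h1 : HasFDerivAt Ψ₁ ((psiL n).comp (((fderiv ℝ (fderiv ℝ φ) (t, x, ψ₀)).flip (0, 0, 1)).comp
        (liftL 0))) (t, x) := by
      have hl : HasFDerivAt (fun q : ℝ × Space n => ((q.1, q.2, ψ₀) : Var n)) (liftL 0) (t, x) :=
        hasFDerivAt_fst.prodMk (hasFDerivAt_snd.prodMk (hasFDerivAt_const ψ₀ (t, x)))
      have hc : HasFDerivAt (fun q : ℝ × Space n => fderiv ℝ φ (q.1, q.2, ψ₀) (0, 0, 1))
          (((fderiv ℝ (fderiv ℝ φ) (t, x, ψ₀)).flip (0, 0, 1)).comp (liftL 0)) (t, x) :=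
        HasFDerivAt.comp (g := fun q => fderiv ℝ φ q (0, 0, 1)) (t, x)
          (hd1 (0, 0, 1) (t, x, ψ₀) hp) hl
      exact (psiL n).hasFDerivAt.comp (t, x) hc
    have h2 := (hsp _ hp).2.1 v 1
    rw [inner_drift, hT' _ hp, hB _ hp, hX' _ hp, hΨ₁ _ hp] at h2
    have h3 : hat (deriv T t) 1 = 1 := by simpa using hat_ofReal (deriv T t) 1
    simp only [base] at h2
    rw [h3, mul_one] at h2
    have hτC : ((deriv T t : ℝ) : ℂ) ≠ 0 := by exact_mod_cast hτ t ht
    have hτA : ((|deriv T t| : ℝ) : ℂ) ≠ 0 := by exact_mod_cast abs_ne_zero.2 (hτ t ht)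
    rw [h1.fderiv]
    show psiL n (fderiv ℝ (fderiv ℝ φ) (t, x, ψ₀) (0, v, 0) (0, 0, 1)) = _
    push_cast at h2
    field_simp at h2 ⊢
    linear_combination h2

theorem fderiv_fderiv_clm_comp {E F G : Type*} [NormedAddCommGroup E] [NormedSpace ℝ E]
    [NormedAddCommGroup F] [NormedSpace ℝ F] [NormedAddCommGroup G] [NormedSpace ℝ G]
    {f : E → F} {x : E} (hf : ContDiffAt ℝ ∞ f x) (A : F →L[ℝ] G) (v w : E) :
    fderiv ℝ (fderiv ℝ fun y => A (f y)) x v w = A (fderiv ℝ (fderiv ℝ f) x v w) := by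
  rw [fderiv_fderiv_comp (g := A) A.contDiff.contDiffAt hf, A.fderiv,
    funext fun y => A.fderiv (x := y), fderiv_fun_const]
  simp

theorem hat_eventually_eq {τ : ℝ → ℝ} {t : ℝ} (hc : ContinuousAt τ t) (h0 : τ t ≠ 0) :
    ∀ᶠ s in 𝓝 t, hat (τ s) = hat (τ t) := by
  rcases lt_or_gt_of_ne h0 with h0 | h0
  · filter_upwards [hc.eventually (eventually_lt_nhds h0)] with s hs
    funext z
    rw [hat, hat, if_neg hs.le.not_gt, if_neg h0.le.not_gt]
  · filter_upwards [hc.eventually (eventually_gt_nhds h0)] with s hs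
    funext z
    rw [hat, hat, if_pos hs, if_pos h0]

section

variable {I : Set ℝ} {D : Set (Space n)} {A : Set ℂ} {φ : Var n → Var n} {T : ℝ → ℝ}
  {B : ℝ → Space n →L[ℝ] Space n} {X : ℝ → Space n} {Ψ₁ Ψ₀ : ℝ × Space n → ℂ}

theorem FibredForm.continuousAt_deriv (hF : FibredForm I D A φ T B X Ψ₁ Ψ₀) (hI : IsOpen I)
    {t : ℝ} (ht : t ∈ I) : ContinuousAt (deriv T) t :=
  ((hF.smooth_T.deriv_of_isOpen (m := ∞) hI (by simp)).contDiffAt (hI.mem_nhds ht)).continuousAt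

/-- The derivatives of the transformed dependent variable along `(t, x)` are affine in `ψ̂`. -/
theorem FibredForm.slice (hF : FibredForm I D A φ T B X Ψ₁ Ψ₀) (hI : IsOpen I) (hD : IsOpen D)
    (hA : IsOpen A) (hφ : ContDiffOn ℝ ∞ φ (I ×ˢ D ×ˢ A)) {p : Var n} (hp : p ∈ I ×ˢ D ×ˢ A) :
    (∀ v, psiL n (fderiv ℝ φ p (liftL 0 v))
      = fderiv ℝ Ψ₁ (base p) v * hat (deriv T p.1) p.2.2 + fderiv ℝ Ψ₀ (base p) v) ∧
    (∀ v w, psiL n (fderiv ℝ (fderiv ℝ φ) p (liftL 0 v) (liftL 0 w))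
      = fderiv ℝ (fderiv ℝ Ψ₁) (base p) v w * hat (deriv T p.1) p.2.2
        + fderiv ℝ (fderiv ℝ Ψ₀) (base p) v w) := by
  have hφp : ContDiffAt ℝ ∞ φ p := hφ.contDiffAt ((hI.prod (hD.prod hA)).mem_nhds hp)
  have hq : base p ∈ I ×ˢ D := ⟨hp.1, hp.2.1⟩
  have h1 : ContDiffAt ℝ ∞ Ψ₁ (base p) := hF.smooth_Ψ₁.contDiffAt ((hI.prod hD).mem_nhds hq)
  have h0 : ContDiffAt ℝ ∞ Ψ₀ (base p) := hF.smooth_Ψ₀.contDiffAt ((hI.prod hD).mem_nhds hq)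
  have hι : ∀ q, HasFDerivAt (fun q : ℝ × Space n => ((q.1, q.2, p.2.2) : Var n)) (liftL 0) q :=
    fun q => hasFDerivAt_fst.prodMk (hasFDerivAt_snd.prodMk (hasFDerivAt_const p.2.2 q))
  have hιs : ContDiffAt ℝ ∞ (fun q : ℝ × Space n => ((q.1, q.2, p.2.2) : Var n)) (base p) := by
    fun_prop
  set c := hat (deriv T p.1) p.2.2 with hc
  have heq : (fun q : ℝ × Space n => psiL n (φ (q.1, q.2, p.2.2))) =ᶠ[𝓝 (base p)]
      fun q => c • Ψ₁ q + Ψ₀ q := by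
    filter_upwards [(hI.prod hD).mem_nhds hq, continuousAt_fst.eventually
      (hat_eventually_eq (hF.continuousAt_deriv hI hp.1) (hF.deriv_ne p.1 hp.1))] with q hq1 hq2
    have h := congrArg (psiL n) (hF.eq (q.1, q.2, p.2.2) ⟨hq1.1, hq1.2, hp.2.2⟩)
    rw [h]
    show Ψ₁ q * hat (deriv T q.1) p.2.2 + Ψ₀ q = _
    rw [show hat (deriv T q.1) = hat (deriv T p.1) from hq2, ← hc, smul_eq_mul, mul_comm]
  have hd : ∀ q, ContDiffAt ℝ 2 Ψ₁ q → ContDiffAt ℝ 2 Ψ₀ q →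
      HasFDerivAt (fun q => c • Ψ₁ q + Ψ₀ q) (c • fderiv ℝ Ψ₁ q + fderiv ℝ Ψ₀ q) q :=
    fun q hq1 hq0 => ((hq1.differentiableAt (by simp)).hasFDerivAt.const_smul c).add
      (hq0.differentiableAt (by simp)).hasFDerivAt
  constructor
  · intro v
    have hL : HasFDerivAt (fun q : ℝ × Space n => psiL n (φ (q.1, q.2, p.2.2)))
        ((psiL n).comp ((fderiv ℝ φ p).comp (liftL 0))) (base p) :=
      (psiL n).hasFDerivAt.comp (base p) (HasFDerivAt.comp (g := φ) (base p)
        (hφp.differentiableAt (by simp)).hasFDerivAt (hι (base p)))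
    have h := heq.fderiv_eq (𝕜 := ℝ)
    rw [hL.fderiv, (hd _ (h1.of_le two_le_infty) (h0.of_le two_le_infty)).fderiv] at h
    have h' := congrArg (fun l => l v) h
    refine h'.trans ?_
    simp only [add_apply, smul_apply, smul_eq_mul, mul_comm c]
  · intro v w
    have hL : fderiv ℝ (fderiv ℝ fun q : ℝ × Space n => psiL n (φ (q.1, q.2, p.2.2))) (base p) v w
        = psiL n (fderiv ℝ (fderiv ℝ φ) p (liftL 0 v) (liftL 0 w)) := by
      rw [fderiv_fderiv_clm_comp (f := fun q : ℝ × Space n => φ (q.1, q.2, p.2.2))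
        (ContDiffAt.comp (g := φ) (base p) hφp hιs),
        fderiv_fderiv_comp (g := φ) (x := base p) hφp hιs, (hι (base p)).fderiv,
        funext fun q => (hι q).fderiv, fderiv_fun_const]
      simp [base]
    have h := (heq.fderiv (𝕜 := ℝ)).fderiv_eq (𝕜 := ℝ)
    have h2 : fderiv ℝ (fun q => c • Ψ₁ q + Ψ₀ q) =ᶠ[𝓝 (base p)]
        fun q => c • fderiv ℝ Ψ₁ q + fderiv ℝ Ψ₀ q := by
      filter_upwards [contDiffAt_eventually h1, contDiffAt_eventually h0] with q hq1 hq0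
      exact (hd q hq1 hq0).fderiv
    have h3 := ((differentiableAt_fderiv h1).hasFDerivAt.const_smul c).add
      (differentiableAt_fderiv h0).hasFDerivAt
    rw [h2.fderiv_eq] at h
    have h4 := h.trans h3.fderiv
    rw [← hL, h4]
    simp only [add_apply, smul_apply, smul_eq_mul, mul_comm c]

/-- Over a fixed point (t, x) the gradient-free part of `errTerm` is an identity in ψ alone. Divided
by Ψ₁, it becomes the functional relation excluded by `NLS.shift_eq_zero` unless the shift Ψ₀/Ψ₁
vanishes. -/
theorem FibredForm.shift_eq_zero (hn : 1 ≤ n) (hF : FibredForm I D A φ T B X Ψ₁ Ψ₀)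
    (hI : IsOpen I) (hD : IsOpen D) (hA : IsOpen A) (hne : A.Nonempty) (hA0 : (0 : ℂ) ∉ A)
    (hφ : IsPointTransf (I ×ˢ D ×ˢ A) φ) {S S' : Var n → ℂ}
    (h : MapsEquation (I ×ˢ D ×ˢ A) φ S S') {f f' : ℝ → ℂ} {V V' : ℝ × Space n → ℂ}
    (hS : ∀ p ∈ I ×ˢ D ×ˢ A, S p = f ‖p.2.2‖ + V (base p))
    (hS' : ∀ p ∈ I ×ˢ D ×ˢ A, S' (φ p) = f' ‖(φ p).2.2‖ + V' (base (φ p)))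
    (hf : ∀ z ∈ A, DifferentiableAt ℝ f ‖z‖) (hf0 : ∀ z ∈ A, deriv f ‖z‖ ≠ 0)
    {q : ℝ × Space n} (hq : q ∈ I ×ˢ D) : Ψ₀ q = 0 := by
  have hW : IsOpen (I ×ˢ D ×ˢ A) := hI.prod (hD.prod hA)
  have hj : ∀ p ∈ I ×ˢ D ×ˢ A, _ := fun p hp => IsFibredJet.of_maps hn hW hφ h hp
  have herr := (mapsEquation_iff_errTerm hn hW hφ.smooth hj).1 h
  set τ := deriv T q.1 with hτ
  have hτ0 : τ ≠ 0 := hF.deriv_ne q.1 hq.1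
  have hτC : (τ : ℂ) ≠ 0 := by exact_mod_cast hτ0
  have hτA : ((|τ| : ℝ) : ℂ) ≠ 0 := by exact_mod_cast abs_ne_zero.2 hτ0
  set m : Space n := |τ|⁻¹ • ∑ j, inner ℝ (B q.1 (stdB n j)) (deriv B q.1 q.2 + deriv X q.1) •
    stdB n j with hm
  have hΨ0 := hF.ne_zero q hq
  set k := Ψ₀ q / Ψ₁ q with hk
  set r₁ := Complex.I / τ * fderiv ℝ Ψ₁ q (1, -m)
    + ((|τ| : ℝ) : ℂ)⁻¹ * ∑ j, fderiv ℝ (fderiv ℝ Ψ₁) q (0, stdB n j) (0, stdB n j) with hr₁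
  set r₀ := Complex.I / τ * fderiv ℝ Ψ₀ q (1, -m)
    + ((|τ| : ℝ) : ℂ)⁻¹ * ∑ j, fderiv ℝ (fderiv ℝ Ψ₀) q (0, stdB n j) (0, stdB n j) with hr₀
  set q' : ℝ × Space n := (T q.1, B q.1 q.2 + X q.1) with hq'
  have hE : ∀ ψ ∈ A, r₁ * hat τ ψ + r₀
      + (f' ‖Ψ₁ q * hat τ ψ + Ψ₀ q‖ + V' q') * (Ψ₁ q * hat τ ψ + Ψ₀ q)
      - ((|τ| : ℝ) : ℂ)⁻¹ * (Ψ₁ q * hat τ ((f ‖ψ‖ + V q) * ψ)) = 0 := by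
    intro ψ hψ
    have hp : ((q.1, q.2, ψ) : Var n) ∈ I ×ˢ D ×ˢ A := ⟨hq.1, hq.2, hψ⟩
    have hE0 := (errTerm_split hn (hj _ hp).ne_zero
      (fderiv_fderiv_symm (hφ.smooth.contDiffAt (hW.mem_nhds hp))) (herr _ hp)).2.2
    obtain ⟨hs1, hs2⟩ := hF.slice hI hD hA hφ.smooth hp
    have hdr : drift (fderiv ℝ φ (q.1, q.2, ψ)) = m := by
      simp only [drift, hF.time_eq _ hp, hF.space_eq _ hp, hF.space_time_eq _ hp, hm, hτ]
    have hb : base ((q.1, q.2, ψ) : Var n) = q := rfl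
    have hl1 : ((1 : ℝ), -m, (0 : ℂ)) = liftL 0 (1, -m) := rfl
    have hl2 : ∀ j, ((0 : ℝ), stdB n j, (0 : ℂ)) = liftL 0 (0, stdB n j) := fun j => rfl
    rw [hdr, hF.time_eq _ hp, hF.psi_deriv _ hp, hl1, hs1, hS _ hp, hS' _ hp, hF.eq _ hp] at hE0
    simp only [hl2, hs2, hb, psiL_apply] at hE0
    rw [Finset.sum_add_distrib, ← Finset.sum_mul] at hE0
    rw [hr₁, hr₀]
    have hb' : base ((T q.1, B q.1 q.2 + X q.1, Ψ₁ q * hat (deriv T q.1) ψ + Ψ₀ q) : Var n)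
      = q' := rfl
    rw [hb', ← hτ] at hE0
    linear_combination hE0
  have hk0 : k = 0 := by
    -- The unknown is z = ψ̂, hence the preimage of A. The factor |Ψ₁| is hidden in the argument of
    -- F, and both potentials with the derivatives of Ψ₁ and Ψ₀ in the constants b and c.
    refine NLS.shift_eq_zero (A := (hat τ) ⁻¹' A) (F := fun r => f' (‖Ψ₁ q‖ * r) + V' q')
      (g := fun r => ((|τ| : ℝ) : ℂ)⁻¹ * hatL τ (f r))
      (b := ((|τ| : ℝ) : ℂ)⁻¹ * hat τ (V q) - r₁ / Ψ₁ q) (c := -r₀ / Ψ₁ q) ?_ ?_ ?_ ?_ ?_ ?_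
    · have : hat τ = hatL τ := funext fun z => (hatL_apply τ z).symm
      rw [this]
      exact hA.preimage (hatL τ).continuous
    · obtain ⟨z, hz⟩ := hne
      exact ⟨hat τ z, by rw [Set.mem_preimage, hat_hat]; exact hz⟩
    · intro h0
      rw [Set.mem_preimage, hat_eq_zero.2 rfl] at h0
      exact hA0 h0
    · intro z hz
      have := hf _ hz
      rw [norm_hat] at this
      exact ((hatL τ).differentiableAt.comp _ this).const_mul _
    · intro z hz
      have h1 := hf _ hz
      have h2 := hf0 _ hz
      rw [norm_hat] at h1 h2
      have h3 := (((hatL τ).hasFDerivAt.comp_hasDerivAt _ h1.hasDerivAt).const_mul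
        (((|τ| : ℝ) : ℂ)⁻¹)).deriv
      refine fun h4 => ?_
      have h5 := h3.symm.trans h4
      rw [hatL_apply, mul_eq_zero] at h5
      exact h2 (hat_eq_zero.1 (h5.resolve_left (inv_ne_zero hτA)))
    · intro z hz
      have h1 := hE _ hz
      rw [hat_hat, norm_hat, hat_mul, hat_hat, hat_add] at h1
      have h2 : Ψ₁ q * z + Ψ₀ q = Ψ₁ q * (z + k) := by rw [hk]; field_simp
      rw [h2, norm_mul] at h1
      rw [hatL_apply]
      field_simp at h1 ⊢
      linear_combination h1
  rw [hk, div_eq_zero_iff] at hk0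
  exact hk0.resolve_right hΨ0

end

theorem hasDerivAt_of_contDiffOn {F : Type*} [NormedAddCommGroup F] [NormedSpace ℝ F]
    {I : Set ℝ} (hI : IsOpen I) {f : ℝ → F} (hf : ContDiffOn ℝ ∞ f I) {t : ℝ} (ht : t ∈ I) :
    HasDerivAt f (deriv f t) t :=
  ((hf.contDiffAt (hI.mem_nhds ht)).differentiableAt (by simp)).hasDerivAt

theorem contDiffOn_deriv {F : Type*} [NormedAddCommGroup F] [NormedSpace ℝ F]
    {I : Set ℝ} (hI : IsOpen I) {f : ℝ → F} (hf : ContDiffOn ℝ ∞ f I) :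
    ContDiffOn ℝ ∞ (deriv f) I :=
  hf.deriv_of_isOpen hI (by simp)

theorem hasDerivAt_abs_deriv {I : Set ℝ} (hI : IsOpen I) {T : ℝ → ℝ} (hT : ContDiffOn ℝ ∞ T I)
    {t : ℝ} (ht : t ∈ I) (h0 : deriv T t ≠ 0) :
    HasDerivAt (fun s => |deriv T s|) (Real.sign (deriv T t) * deriv (deriv T) t) t := by
  have h1 := hasDerivAt_of_contDiffOn hI (contDiffOn_deriv hI hT) ht
  have h2 := (hasDerivAt_abs h0).comp t h1
  refine h2.congr_deriv ?_
  rcases lt_or_gt_of_ne h0 with h | h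
  · rw [Real.sign_of_neg h, sign_neg h]; simp
  · rw [Real.sign_of_pos h, sign_pos h]; simp

theorem contDiffOn_abs_deriv {I : Set ℝ} (hI : IsOpen I) {T : ℝ → ℝ} (hT : ContDiffOn ℝ ∞ T I)
    (h0 : ∀ t ∈ I, deriv T t ≠ 0) : ContDiffOn ℝ ∞ (fun s => |deriv T s|) I := by
  intro t ht
  have h1 := contDiffOn_deriv hI hT t ht
  exact (contDiffAt_abs (h0 t ht)).comp_contDiffWithinAt t h1

theorem hasDerivAt_line {E F : Type*} [NormedAddCommGroup E] [NormedSpace ℝ E]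
    [NormedAddCommGroup F] [NormedSpace ℝ F] {f : E → F} {x : E} (hf : DifferentiableAt ℝ f x)
    (w : E) : HasDerivAt (fun s : ℝ => f (x + s • w)) (fderiv ℝ f x w) 0 := by
  have hline : HasDerivAt (fun s : ℝ => x + s • w) w 0 := by
    simpa using ((hasDerivAt_id (0 : ℝ)).smul_const w).const_add x
  have h0 : HasFDerivAt f (fderiv ℝ f x) (x + (0 : ℝ) • w) := by simpa using hf.hasFDerivAt
  exact h0.comp_hasDerivAt 0 hline

/-- A smooth function without zeros on an interval has a smooth logarithm. -/
theorem exists_smooth_log {I : Set ℝ} (hI : IsOpen I) (hI' : IsConnected I) {C : ℝ → ℂ}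
    (hC : ContDiffOn ℝ ∞ C I) (h0 : ∀ t ∈ I, C t ≠ 0) :
    ∃ Z Sig : ℝ → ℝ, ContDiffOn ℝ ∞ Z I ∧ ContDiffOn ℝ ∞ Sig I ∧
      ∀ t ∈ I, C t = Complex.exp (Complex.I * (Sig t : ℂ) + (Z t : ℂ)) := by
  obtain ⟨t₀, ht₀⟩ := hI'.nonempty
  have hg : ContDiffOn ℝ ∞ (fun t => deriv C t * (C t)⁻¹) I :=
    (contDiffOn_deriv hI hC).mul (hC.inv h0)
  have hL : ∀ t ∈ I, HasDerivAt (fun t => ∫ s in t₀..t, deriv C s * (C s)⁻¹)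
      (deriv C t * (C t)⁻¹) t := by
    intro t ht
    have hsub : Set.uIcc t₀ t ⊆ I := hI'.isPreconnected.ordConnected.uIcc_subset ht₀ ht
    refine intervalIntegral.integral_hasDerivAt_right
      ((hg.continuousOn.mono hsub).intervalIntegrable) ?_
      (hg.contDiffAt (hI.mem_nhds ht)).continuousAt
    exact hg.continuousOn.stronglyMeasurableAtFilter hI t ht
  have hLs : ContDiffOn ℝ ∞ (fun t => ∫ s in t₀..t, deriv C s * (C s)⁻¹) I := by
    rw [contDiffOn_infty_iff_deriv_of_isOpen hI]
    exact ⟨fun t ht => (hL t ht).differentiableAt.differentiableWithinAt,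
      hg.congr fun t ht => (hL t ht).deriv⟩
  -- A logarithm by integration of C'/C, independent of branches; the principal logarithm is used
  -- only for the initial value.
  set L : ℝ → ℂ := fun t => (∫ s in t₀..t, deriv C s * (C s)⁻¹) + Complex.log (C t₀) with hLdef
  have hLs' : ContDiffOn ℝ ∞ L I := hLs.add contDiffOn_const
  have hd : ∀ t ∈ I, HasDerivAt (fun t => C t * Complex.exp (-L t)) 0 t := fun t ht => by
    have h1 := (hL t ht).add_const (Complex.log (C t₀))
    have h2 := (hasDerivAt_of_contDiffOn hI hC ht).mul h1.neg.cexp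
    refine h2.congr_deriv ?_
    have := h0 t ht
    field_simp
    simp
  have hconst : ∀ t ∈ I, C t * Complex.exp (-L t) = 1 := fun t ht => by
    have h1 := hI.is_const_of_deriv_eq_zero (f := fun t => C t * Complex.exp (-L t))
      hI'.isPreconnected
      (fun t ht => (hd t ht).differentiableAt.differentiableWithinAt)
      (fun t ht => (hd t ht).deriv) ht ht₀
    rw [h1]
    simp only [hLdef, intervalIntegral.integral_same, zero_add]
    rw [Complex.exp_neg, Complex.exp_log (h0 t₀ ht₀), mul_inv_cancel₀ (h0 t₀ ht₀)]
  refine ⟨fun t => (L t).re, fun t => (L t).im, Complex.reCLM.contDiff.comp_contDiffOn hLs',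
    Complex.imCLM.contDiff.comp_contDiffOn hLs', fun t ht => ?_⟩
  have h1 : Complex.I * ((L t).im : ℂ) + ((L t).re : ℂ) = L t := by
    rw [mul_comm, add_comm]; exact Complex.re_add_im _
  rw [h1]
  have h2 := hconst t ht
  rw [Complex.exp_neg, mul_inv_eq_one₀ (Complex.exp_ne_zero _)] at h2
  exact h2

/-! ### Constancy of the orthogonal matrix. -/

section

variable {I : Set ℝ} {D : Set (Space n)} {A : Set ℂ} {φ : Var n → Var n} {T : ℝ → ℝ}
  {B : ℝ → Space n →L[ℝ] Space n} {X : ℝ → Space n} {Ψ₁ Ψ₀ : ℝ × Space n → ℂ}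

/-- This is the integrability condition for the equation ∂_v log Ψ₁ = c⟨Bv, B_t x + X_t⟩: the second
derivatives of Ψ₁ commute, and the product terms in them are already symmetric. -/
theorem FibredForm.inner_deriv_symm (hF : FibredForm I D A φ T B X Ψ₁ Ψ₀) (hI : IsOpen I)
    (hD : IsOpen D) (hne : D.Nonempty) {t : ℝ} (ht : t ∈ I) (v w : Space n) :
    inner ℝ (B t v) (deriv B t w) = inner ℝ (B t w) (deriv B t v) := by
  obtain ⟨x, hx⟩ := hne
  have hq : ((t, x) : ℝ × Space n) ∈ I ×ˢ D := ⟨ht, hx⟩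
  have hs := hF.smooth_Ψ₁.contDiffAt ((hI.prod hD).mem_nhds hq)
  set c : ℂ := Complex.I / (2 * deriv T t) with hc
  have hc0 : c ≠ 0 := by
    have : ((deriv T t : ℝ) : ℂ) ≠ 0 := by exact_mod_cast hF.deriv_ne t ht
    rw [hc]
    exact div_ne_zero Complex.I_ne_zero (mul_ne_zero two_ne_zero this)
  have hsnd : ∀ v w : Space n, fderiv ℝ (fderiv ℝ Ψ₁) (t, x) (0, w) (0, v)
      = c * (inner ℝ (B t v) (deriv B t w) : ℝ) * Ψ₁ (t, x)
        + c * (inner ℝ (B t v) (deriv B t x + deriv X t) : ℝ)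
          * (c * (inner ℝ (B t w) (deriv B t x + deriv X t) : ℝ) * Ψ₁ (t, x)) := by
    intro v w
    have h0 : ∀ s : ℝ, ((t, x) : ℝ × Space n) + s • (0, w) = (t, x + s • w) := fun s => by simp
    have h1 : HasDerivAt (fun s : ℝ => fderiv ℝ Ψ₁ (t, x + s • w) (0, v))
        (fderiv ℝ (fderiv ℝ Ψ₁) (t, x) (0, w) (0, v)) 0 := by
      have hd := (ContinuousLinearMap.apply ℝ ℂ ((0 : ℝ), v)).hasFDerivAt.comp_hasDerivAt 0
        (hasDerivAt_line (differentiableAt_fderiv hs) (0, w))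
      simp only [h0] at hd
      exact hd
    have h2 : HasDerivAt (fun s : ℝ => Ψ₁ (t, x + s • w)) (fderiv ℝ Ψ₁ (t, x) (0, w)) 0 := by
      have hd := hasDerivAt_line (hs.differentiableAt (by simp)) (0, w)
      simp only [h0] at hd
      exact hd
    have h3 : HasDerivAt (fun s : ℝ => inner ℝ (B t v) (deriv B t (x + s • w) + deriv X t))
        (inner ℝ (B t v) (deriv B t w)) 0 := by
      have : (fun s : ℝ => inner ℝ (B t v) (deriv B t (x + s • w) + deriv X t))
          = fun s : ℝ => inner ℝ (B t v) (deriv B t x + deriv X t)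
            + s * inner ℝ (B t v) (deriv B t w) := by
        funext s
        rw [map_add, map_smul, inner_add_right, inner_add_right, inner_add_right,
          inner_smul_right]
        ring
      rw [this]
      simpa using ((hasDerivAt_id (0 : ℝ)).mul_const (inner ℝ (B t v) (deriv B t w))).const_add
        (inner ℝ (B t v) (deriv B t x + deriv X t))
    have h4 := (h3.ofReal_comp.const_mul c).mul h2
    have h5 : (fun s : ℝ => fderiv ℝ Ψ₁ (t, x + s • w) (0, v)) =ᶠ[𝓝 0]
        fun s : ℝ => c * (inner ℝ (B t v) (deriv B t (x + s • w) + deriv X t) : ℝ)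
          * Ψ₁ (t, x + s • w) := by
      have hmem : ∀ᶠ s : ℝ in 𝓝 0, x + s • w ∈ D := by
        have hcont : ContinuousAt (fun s : ℝ => x + s • w) 0 := by fun_prop
        exact hcont.preimage_mem_nhds (hD.mem_nhds (by simpa using hx))
      filter_upwards [hmem] with s hs
      exact hF.fderiv_Ψ₁ t ht _ hs v
    have h6 := h5.deriv_eq
    rw [h1.deriv] at h6
    have h7 := h6.trans h4.deriv
    rw [hF.fderiv_Ψ₁ t ht x hx w] at h7
    simpa using h7
  have h1 := hsnd v w
  have h2 := hsnd w v
  rw [fderiv_fderiv_symm hs] at h1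
  rw [h2] at h1
  have h3 : c * Ψ₁ (t, x) * (((inner ℝ (B t v) (deriv B t w) : ℝ) : ℂ)
      - (inner ℝ (B t w) (deriv B t v) : ℝ)) = 0 := by linear_combination -h1
  have h4 := (mul_eq_zero.1 h3).resolve_left (mul_ne_zero hc0 (hF.ne_zero _ hq))
  exact_mod_cast sub_eq_zero.1 h4

/-- The matrix of the transformation of the space variables is proportional to a constant
orthogonal one. -/
theorem FibredForm.exists_isometry (hF : FibredForm I D A φ T B X Ψ₁ Ψ₀) (hI : IsOpen I)
    (hI' : IsConnected I) (hD : IsOpen D) (hne : D.Nonempty) :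
    ∃ O : Space n ≃ₗᵢ[ℝ] Space n, ∀ t ∈ I, ∀ y, B t y = Real.sqrt |deriv T t| • O y := by
  obtain ⟨t₀, ht₀⟩ := hI'.nonempty
  have hpos : ∀ t ∈ I, 0 < |deriv T t| := fun t ht => abs_pos.2 (hF.deriv_ne t ht)
  have hsurj : ∀ t ∈ I, ∀ w, ∃ y, B t y = w := fun t ht w => by
    have hinj : Function.Injective (B t).toLinearMap := by
      rw [← LinearMap.ker_eq_bot, LinearMap.ker_eq_bot']
      intro y hy
      have h1 := hF.conformal t ht y y
      change inner ℝ ((B t).toLinearMap y) ((B t).toLinearMap y) = _ at h1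
      rw [hy, inner_zero_left, real_inner_self_eq_norm_sq] at h1
      simpa [hF.deriv_ne t ht] using h1.symm
    exact LinearMap.injective_iff_surjective.1 hinj w
  have hconst : ∀ y, ∀ t ∈ I,
      HasDerivAt (fun s => (Real.sqrt |deriv T s|)⁻¹ • B s y) 0 t := fun y t ht => by
    have hBd := hasDerivAt_of_contDiffOn hI hF.smooth_B ht
    have hBy : ∀ y, HasDerivAt (fun s => B s y) (deriv B t y) t := fun y => by
      simpa using hBd.clm_apply (hasDerivAt_const t y)
    have hρ := hasDerivAt_abs_deriv hI hF.smooth_T ht (hF.deriv_ne t ht)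
    set ρ' := Real.sign (deriv T t) * deriv (deriv T) t
    have hsq : Real.sqrt |deriv T t| ≠ 0 := (Real.sqrt_pos.2 (hpos t ht)).ne'
    have hκ := (hρ.sqrt (hpos t ht).ne').inv hsq
    refine (hκ.smul (hBy y)).congr_deriv ?_
    refine ext_inner_left ℝ fun w => ?_
    obtain ⟨v, rfl⟩ := hsurj t ht w
    have h1 := (hBy v).inner ℝ (hBy y)
    have h2 : (fun s => inner ℝ (B s v) (B s y)) =ᶠ[𝓝 t] fun s => |deriv T s| * inner ℝ v y := by
      filter_upwards [hI.mem_nhds ht] with s hs using hF.conformal s hs v y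
    have h3 := h2.deriv_eq
    rw [h1.deriv, (hρ.mul_const _).deriv, real_inner_comm (B t y),
      ← hF.inner_deriv_symm hI hD hne ht v y] at h3
    rw [inner_add_right, inner_smul_right, inner_smul_right, inner_zero_right, hF.conformal t ht]
    -- Differentiating BᵀB = |T_t| Id determines the symmetric part of BᵀB_t, and by
    -- `inner_deriv_symm` there is no other part. So B_t is a multiple of B, the multiple being the
    -- logarithmic derivative of |T_t|^{1/2}.
    have h4 : inner ℝ (B t v) (deriv B t y) = ρ' * inner ℝ v y / 2 := by linarith
    simp only [Pi.inv_apply]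
    rw [h4]
    have h5 : |deriv T t| = Real.sqrt |deriv T t| ^ 2 := (Real.sq_sqrt (hpos t ht).le).symm
    generalize Real.sqrt |deriv T t| = κ at *
    rw [h5]
    field_simp
    ring
  have hO : ∀ y, ∀ t ∈ I, (Real.sqrt |deriv T t|)⁻¹ • B t y
      = (Real.sqrt |deriv T t₀|)⁻¹ • B t₀ y := fun y t ht =>
    hI.is_const_of_deriv_eq_zero (f := fun s => (Real.sqrt |deriv T s|)⁻¹ • B s y)
      hI'.isPreconnected
      (fun t ht => (hconst y t ht).differentiableAt.differentiableWithinAt)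
      (fun t ht => (hconst y t ht).deriv) ht ht₀
  let O : Space n →ₗᵢ[ℝ] Space n := ⟨(Real.sqrt |deriv T t₀|)⁻¹ • (B t₀).toLinearMap, fun y => by
    have h1 := hF.conformal t₀ ht₀ y y
    rw [real_inner_self_eq_norm_sq, real_inner_self_eq_norm_sq] at h1
    show ‖(Real.sqrt |deriv T t₀|)⁻¹ • B t₀ y‖ = ‖y‖
    have := hpos t₀ ht₀
    rw [norm_smul, ← sq_eq_sq₀ (by positivity) (by positivity), mul_pow, h1,
      norm_inv, Real.norm_of_nonneg (Real.sqrt_nonneg _), inv_pow, Real.sq_sqrt this.le]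
    field_simp⟩
  refine ⟨O.toLinearIsometryEquiv rfl, fun t ht y => ?_⟩
  show B t y = Real.sqrt |deriv T t| • ((Real.sqrt |deriv T t₀|)⁻¹ • B t₀ y)
  rw [← hO y t ht, smul_smul, mul_inv_cancel₀ (Real.sqrt_pos.2 (hpos t ht)).ne', one_smul]

end

/-! ### The phase and the necessary form of a transformation. -/

/-- The coefficient of `|x|²` in the phase. -/
def phaseQuad (T : ℝ → ℝ) (t : ℝ) : ℝ := 1 / 8 * (deriv (deriv T) t / |deriv T t|)

/-- The coefficient of `O x` in the phase. -/
def phaseLin (T : ℝ → ℝ) (X : ℝ → Space n) (t : ℝ) : Space n :=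
  (Real.sqrt |deriv T t| / (2 * deriv T t)) • deriv X t

/-- The part of the phase that depends on `x`. -/
def phase (T : ℝ → ℝ) (O : Space n ≃ₗᵢ[ℝ] Space n) (X : ℝ → Space n) (q : ℝ × Space n) : ℝ :=
  phaseQuad T q.1 * ‖q.2‖ ^ 2 + inner ℝ (phaseLin T X q.1) (O q.2)

/-- The gradient of the phase in `x`. -/
def phaseGrad (T : ℝ → ℝ) (O : Space n ≃ₗᵢ[ℝ] Space n) (X : ℝ → Space n) (q : ℝ × Space n) :
    Space n :=
  (2 * phaseQuad T q.1) • q.2 + O.symm (phaseLin T X q.1)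

theorem sign_div_sqrt_abs (τ : ℝ) : Real.sign τ / Real.sqrt |τ| = Real.sqrt |τ| / τ := by
  rcases lt_trichotomy τ 0 with h | rfl | h
  · have h1 : 0 < Real.sqrt |τ| := Real.sqrt_pos.2 (abs_pos.2 h.ne)
    have h2 : Real.sqrt |τ| * Real.sqrt |τ| = -τ := by
      rw [Real.mul_self_sqrt (abs_nonneg _), abs_of_neg h]
    rw [Real.sign_of_neg h, div_eq_div_iff h1.ne' h.ne, h2]; ring
  · simp
  · have h1 : 0 < Real.sqrt |τ| := Real.sqrt_pos.2 (abs_pos.2 h.ne')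
    have h2 : Real.sqrt |τ| * Real.sqrt |τ| = τ := by
      rw [Real.mul_self_sqrt (abs_nonneg _), abs_of_pos h]
    rw [Real.sign_of_pos h, div_eq_div_iff h1.ne' h.ne', h2]; ring

theorem varTransf_eq (T : ℝ → ℝ) (O : Space n ≃ₗᵢ[ℝ] Space n) (X : ℝ → Space n)
    (Sig Z : ℝ → ℝ) (p : Var n) : varTransf T O X Sig Z p = (T p.1,
      Real.sqrt |deriv T p.1| • O p.2.1 + X p.1,
      Complex.exp (Complex.I * ((phase T O X (base p) + Sig p.1 : ℝ) : ℂ) + (Z p.1 : ℂ))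
        * hat (deriv T p.1) p.2.2) := by
  have h : 1 / 2 * (Real.sign (deriv T p.1) / Real.sqrt |deriv T p.1|)
      * inner ℝ (deriv X p.1) (O p.2.1) = inner ℝ (phaseLin T X p.1) (O p.2.1) := by
    rw [phaseLin, real_inner_smul_left, sign_div_sqrt_abs]; ring
  simp only [varTransf, phase, base, phaseQuad, h]

theorem inner_phaseGrad (T : ℝ → ℝ) (O : Space n ≃ₗᵢ[ℝ] Space n) (X : ℝ → Space n)
    (t : ℝ) (x v : Space n) : inner ℝ (phaseGrad T O X (t, x)) v
      = 2 * phaseQuad T t * inner ℝ x v + inner ℝ (phaseLin T X t) (O v) := by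
  have h : inner ℝ (O.symm (phaseLin T X t)) v = inner ℝ (phaseLin T X t) (O v) := by
    rw [← O.inner_map_map, O.apply_symm_apply]
  rw [phaseGrad, inner_add_left, real_inner_smul_left, h]

/-- The phase is exactly quadratic in x, so all its spatial derivatives can be read off from its
values on a line. -/
theorem phase_line (T : ℝ → ℝ) (O : Space n ≃ₗᵢ[ℝ] Space n) (X : ℝ → Space n)
    (t : ℝ) (x v : Space n) (s : ℝ) : phase T O X (t, x + s • v)
      = phase T O X (t, x) + s * inner ℝ (phaseGrad T O X (t, x)) v
        + s ^ 2 * (phaseQuad T t * ‖v‖ ^ 2) := by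
  have h : ‖x + s • v‖ ^ 2 = ‖x‖ ^ 2 + 2 * (s * inner ℝ x v) + s ^ 2 * ‖v‖ ^ 2 := by
    rw [norm_add_sq_real, real_inner_smul_right, norm_smul, mul_pow, Real.norm_eq_abs, sq_abs]
  rw [inner_phaseGrad]
  simp only [phase]
  rw [h, map_add, map_smul, inner_add_right, real_inner_smul_right]
  ring

theorem hasDerivAt_quadratic (a b c : ℝ) : HasDerivAt (fun s : ℝ => a + s * b + s ^ 2 * c) b 0 := by
  have h := (((hasDerivAt_id' (0 : ℝ)).mul_const b).const_add a).add
    (((hasDerivAt_id' (0 : ℝ)).pow 2).mul_const c)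
  exact h.congr_deriv (by simp)

/-- Admissible values of the functional parameters of `varTransf`. -/
structure IsParam (I : Set ℝ) (T : ℝ → ℝ) (X : ℝ → Space n) (Sig Z : ℝ → ℝ) : Prop where
  smooth_T : ContDiffOn ℝ ∞ T I
  smooth_X : ContDiffOn ℝ ∞ X I
  smooth_Sig : ContDiffOn ℝ ∞ Sig I
  smooth_Z : ContDiffOn ℝ ∞ Z I
  deriv_ne : ∀ t ∈ I, deriv T t ≠ 0

section

variable {I : Set ℝ} {T : ℝ → ℝ} {X : ℝ → Space n}

theorem contDiffOn_sqrt_abs_deriv (hI : IsOpen I) (hT : ContDiffOn ℝ ∞ T I)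
    (h0 : ∀ t ∈ I, deriv T t ≠ 0) : ContDiffOn ℝ ∞ (fun t => Real.sqrt |deriv T t|) I :=
  (contDiffOn_abs_deriv hI hT h0).sqrt fun t ht => (abs_pos.2 (h0 t ht)).ne'

theorem contDiffOn_phaseQuad (hI : IsOpen I) (hT : ContDiffOn ℝ ∞ T I)
    (h0 : ∀ t ∈ I, deriv T t ≠ 0) : ContDiffOn ℝ ∞ (phaseQuad T) I :=
  contDiffOn_const.mul ((contDiffOn_deriv hI (contDiffOn_deriv hI hT)).div
    (contDiffOn_abs_deriv hI hT h0) fun t ht => (abs_pos.2 (h0 t ht)).ne')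

theorem contDiffOn_phaseLin (hI : IsOpen I) (hT : ContDiffOn ℝ ∞ T I)
    (hX : ContDiffOn ℝ ∞ X I) (h0 : ∀ t ∈ I, deriv T t ≠ 0) :
    ContDiffOn ℝ ∞ (phaseLin T X) I :=
  ((contDiffOn_sqrt_abs_deriv hI hT h0).div (contDiffOn_const.mul (contDiffOn_deriv hI hT))
    fun t ht => mul_ne_zero two_ne_zero (h0 t ht)).smul (contDiffOn_deriv hI hX)

theorem ContDiffOn.comp_fst {E F G : Type*} [NormedAddCommGroup E] [NormedSpace ℝ E]
    [NormedAddCommGroup F] [NormedSpace ℝ F] [NormedAddCommGroup G] [NormedSpace ℝ G]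
    {f : E → F} {s : Set E} (hf : ContDiffOn ℝ ∞ f s) (u : Set G) :
    ContDiffOn ℝ ∞ (fun q : E × G => f q.1) (s ×ˢ u) :=
  hf.comp contDiffOn_fst fun _ hq => hq.1

theorem contDiffOn_phase (O : Space n ≃ₗᵢ[ℝ] Space n) (hI : IsOpen I) (hT : ContDiffOn ℝ ∞ T I)
    (hX : ContDiffOn ℝ ∞ X I) (h0 : ∀ t ∈ I, deriv T t ≠ 0) (D : Set (Space n)) :
    ContDiffOn ℝ ∞ (phase T O X) (I ×ˢ D) :=
  ((ContDiffOn.comp_fst (contDiffOn_phaseQuad hI hT h0) D).mul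
    ((contDiff_norm_sq ℝ).comp contDiff_snd).contDiffOn).add
    (ContDiffOn.inner ℝ (ContDiffOn.comp_fst (contDiffOn_phaseLin hI hT hX h0) D)
      (O.contDiff.comp contDiff_snd).contDiffOn)

theorem contDiffOn_phaseGrad (O : Space n ≃ₗᵢ[ℝ] Space n) (hI : IsOpen I)
    (hT : ContDiffOn ℝ ∞ T I) (hX : ContDiffOn ℝ ∞ X I) (h0 : ∀ t ∈ I, deriv T t ≠ 0)
    (D : Set (Space n)) : ContDiffOn ℝ ∞ (phaseGrad T O X) (I ×ˢ D) :=
  ((contDiffOn_const.mul (ContDiffOn.comp_fst (contDiffOn_phaseQuad hI hT h0) D)).smul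
    contDiffOn_snd).add
    (O.symm.contDiff.comp_contDiffOn (ContDiffOn.comp_fst (contDiffOn_phaseLin hI hT hX h0) D))

theorem hasDerivAt_sqrt_abs_deriv (hI : IsOpen I) (hT : ContDiffOn ℝ ∞ T I) {t : ℝ} (ht : t ∈ I)
    (h0 : deriv T t ≠ 0) : HasDerivAt (fun s => Real.sqrt |deriv T s|)
      (4 * phaseQuad T t * Real.sqrt |deriv T t| * (|deriv T t| / deriv T t)) t := by
  have hpos : 0 < |deriv T t| := abs_pos.2 h0
  refine ((hasDerivAt_abs_deriv hI hT ht h0).sqrt hpos.ne').congr_deriv ?_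
  have h1 := sign_div_sqrt_abs (deriv T t)
  rw [mul_comm (Real.sign _), mul_div_assoc, mul_comm 2, ← div_div, h1, phaseQuad]
  field_simp
  ring

end

/-- With B = |T_t|^{1/2} O, the vector field prescribed for the gradient of log Ψ₁ is i times the
gradient of the phase. Hence Ψ₁ exp(−i·phase) depends on t alone, and its smooth logarithm provides
Z and Σ. -/
theorem FibredForm.exists_varTransf {I : Set ℝ} {D : Set (Space n)} {A : Set ℂ}
    {φ : Var n → Var n} {T : ℝ → ℝ} {B : ℝ → Space n →L[ℝ] Space n} {X : ℝ → Space n}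
    {Ψ₁ Ψ₀ : ℝ × Space n → ℂ} (hF : FibredForm I D A φ T B X Ψ₁ Ψ₀) (hI : IsOpen I)
    (hI' : IsConnected I) (hD : IsOpen D) (hD' : IsConnected D)
    (h0 : ∀ q ∈ I ×ˢ D, Ψ₀ q = 0) :
    ∃ O Sig Z, IsParam I T X Sig Z ∧ ∀ p ∈ I ×ˢ D ×ˢ A, φ p = varTransf T O X Sig Z p := by
  obtain ⟨O, hO⟩ := hF.exists_isometry hI hI' hD hD'.nonempty
  obtain ⟨x₀, hx₀⟩ := hD'.nonempty
  have hph := contDiffOn_phase O hI hF.smooth_T hF.smooth_X hF.deriv_ne D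
  have hexp : ContDiffOn ℝ ∞ (fun q => Complex.exp (-(Complex.I * (phase T O X q : ℂ)))) (I ×ˢ D) :=
    (contDiffOn_const.mul (Complex.ofRealCLM.contDiff.comp_contDiffOn hph)).neg.cexp
  have hG : ContDiffOn ℝ ∞ (fun q => Ψ₁ q * Complex.exp (-(Complex.I * (phase T O X q : ℂ))))
      (I ×ˢ D) := hF.smooth_Ψ₁.mul hexp
  have hC : ContDiffOn ℝ ∞
      (fun t => Ψ₁ (t, x₀) * Complex.exp (-(Complex.I * (phase T O X (t, x₀) : ℂ)))) I :=
    hG.comp (f := fun t : ℝ => (t, x₀)) (contDiff_prodMk_left x₀).contDiffOn fun t ht => ⟨ht, hx₀⟩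
  obtain ⟨Z, Sig, hZ, hSig, hlog⟩ := exists_smooth_log hI hI' hC fun t ht =>
    mul_ne_zero (hF.ne_zero _ ⟨ht, hx₀⟩) (Complex.exp_ne_zero _)
  have hBd : ∀ t ∈ I, ∀ x, deriv B t x
      = (4 * phaseQuad T t * Real.sqrt |deriv T t| * (|deriv T t| / deriv T t)) • O x := by
    intro t ht x
    have h1 : HasDerivAt (fun s => B s x) (deriv B t x) t := by
      simpa using (hasDerivAt_of_contDiffOn hI hF.smooth_B ht).clm_apply (hasDerivAt_const t x)
    have h2 := (hasDerivAt_sqrt_abs_deriv hI hF.smooth_T ht (hF.deriv_ne t ht)).smul_const (O x)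
    refine h1.unique (h2.congr_of_eventuallyEq ?_)
    filter_upwards [hI.mem_nhds ht] with s hs using hO s hs x
  have hgrad : ∀ t ∈ I, ∀ x ∈ D, ∀ v, fderiv ℝ Ψ₁ (t, x) (0, v)
      = Complex.I * (inner ℝ (phaseGrad T O X (t, x)) v : ℝ) * Ψ₁ (t, x) := by
    intro t ht x hx v
    rw [hF.fderiv_Ψ₁ t ht x hx v, hBd t ht, hO t ht, inner_phaseGrad]
    have hτ := hF.deriv_ne t ht
    have h1 : inner ℝ (Real.sqrt |deriv T t| • O v) ((4 * phaseQuad T t * Real.sqrt |deriv T t|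
        * (|deriv T t| / deriv T t)) • O x + deriv X t)
        = 2 * deriv T t * (2 * phaseQuad T t * inner ℝ x v + inner ℝ (phaseLin T X t) (O v)) := by
      have h2 : Real.sqrt |deriv T t| ^ 2 = |deriv T t| := Real.sq_sqrt (abs_nonneg _)
      rw [real_inner_smul_left, inner_add_right, real_inner_smul_right, O.inner_map_map, phaseLin,
        real_inner_smul_left, real_inner_comm v x, real_inner_comm (O v)]
      have h3 : |deriv T t| ^ 2 = deriv T t ^ 2 := sq_abs _
      field_simp
      linear_combination (4 * phaseQuad T t * inner ℝ v x) * h3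
        + (4 * phaseQuad T t * |deriv T t| * inner ℝ v x) * h2
    rw [h1]
    have hτ' : ((deriv T t : ℝ) : ℂ) ≠ 0 := by exact_mod_cast hτ
    push_cast
    field_simp
  have hconst : ∀ t ∈ I, ∀ x ∈ D,
      Ψ₁ (t, x) * Complex.exp (-(Complex.I * (phase T O X (t, x) : ℂ)))
        = Ψ₁ (t, x₀) * Complex.exp (-(Complex.I * (phase T O X (t, x₀) : ℂ))) := by
    intro t ht x hx
    have hdiff : ∀ y ∈ D, DifferentiableAt ℝ
        (fun y => Ψ₁ (t, y) * Complex.exp (-(Complex.I * (phase T O X (t, y) : ℂ)))) y :=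
      fun y hy => by
      have := (hG.contDiffAt (x := (t, y))
        ((hI.prod hD).mem_nhds ⟨ht, hy⟩)).differentiableAt (by simp)
      exact this.comp y (differentiableAt_const t |>.prodMk differentiableAt_id)
    refine hD.is_const_of_fderiv_eq_zero (𝕜 := ℝ)
      (f := fun y => Ψ₁ (t, y) * Complex.exp (-(Complex.I * (phase T O X (t, y) : ℂ))))
      hD'.isPreconnected (fun y hy => (hdiff y hy).differentiableWithinAt) (fun y hy => ?_) hx hx₀
    refine ContinuousLinearMap.ext fun v => ?_
    refine (hasDerivAt_line (hdiff y hy) v).unique ?_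
    have h1 : HasDerivAt (fun s : ℝ => Ψ₁ (t, y + s • v)) (fderiv ℝ Ψ₁ (t, y) (0, v)) 0 := by
      have hd := hasDerivAt_line ((hF.smooth_Ψ₁.contDiffAt (x := (t, y))
        ((hI.prod hD).mem_nhds ⟨ht, hy⟩)).differentiableAt (by simp)) (0, v)
      simpa only [Prod.smul_mk, Prod.mk_add_mk, smul_zero, add_zero] using hd
    have h2 : HasDerivAt (fun s : ℝ => phase T O X (t, y + s • v))
        (inner ℝ (phaseGrad T O X (t, y)) v) 0 := by
      simp only [phase_line]
      exact hasDerivAt_quadratic _ _ _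
    have h3 := h1.mul ((h2.ofReal_comp.const_mul Complex.I).neg.cexp)
    refine h3.congr_deriv ?_
    simp only [zero_smul, add_zero]
    rw [hgrad t ht y hy v]
    change _ = (0 : ℂ)
    ring
  refine ⟨O, Sig, Z, ⟨hF.smooth_T, hF.smooth_X, hSig, hZ, hF.deriv_ne⟩, fun p hp => ?_⟩
  rw [hF.eq p hp, varTransf_eq, hO p.1 hp.1, h0 (base p) ⟨hp.1, hp.2.1⟩, add_zero]
  have h1 : Ψ₁ (base p) = Complex.exp (Complex.I * ((phase T O X (base p) + Sig p.1 : ℝ) : ℂ)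
      + (Z p.1 : ℂ)) := by
    have h2 := (hconst p.1 hp.1 p.2.1 hp.2.1).trans (hlog p.1 hp.1)
    change Ψ₁ (base p) * Complex.exp (-(Complex.I * (phase T O X (base p) : ℂ))) = _ at h2
    rw [Complex.exp_neg, mul_inv_eq_iff_eq_mul₀ (Complex.exp_ne_zero _), ← Complex.exp_add] at h2
    rw [h2]
    push_cast
    ring_nf
  rw [h1]

/-- A point transformation relating two equations with modular nonlinearities is of the form
`varTransf`. -/
theorem exists_varTransf (hn : 1 ≤ n) {I : Set ℝ} {D : Set (Space n)} {A : Set ℂ}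
    (hI : IsOpen I) (hI' : IsConnected I) (hD : IsOpen D) (hD' : IsConnected D) (hA : IsOpen A)
    (hA' : IsConnected A) (hA0 : (0 : ℂ) ∉ A) {φ : Var n → Var n}
    (hφ : IsPointTransf (I ×ˢ D ×ˢ A) φ) {S S' : Var n → ℂ}
    (h : MapsEquation (I ×ˢ D ×ˢ A) φ S S') {f f' : ℝ → ℂ} {V V' : ℝ × Space n → ℂ}
    (hS : ∀ p ∈ I ×ˢ D ×ˢ A, S p = f ‖p.2.2‖ + V (base p))
    (hS' : ∀ p ∈ I ×ˢ D ×ˢ A, S' (φ p) = f' ‖(φ p).2.2‖ + V' (base (φ p)))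
    (hf : ∀ z ∈ A, DifferentiableAt ℝ f ‖z‖) (hf0 : ∀ z ∈ A, deriv f ‖z‖ ≠ 0) :
    ∃ T O X Sig Z, IsParam I T X Sig Z ∧ ∀ p ∈ I ×ˢ D ×ˢ A, φ p = varTransf T O X Sig Z p := by
  obtain ⟨T, B, X, Ψ₁, Ψ₀, hF⟩ := exists_fibredForm hn hI hD hD' hA hA' hφ h
  obtain ⟨O, Sig, Z, h1⟩ := hF.exists_varTransf hI hI' hD hD' fun q hq =>
    hF.shift_eq_zero hn hI hD hA hA'.nonempty hA0 hφ h hS hS' hf hf0 hq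
  exact ⟨T, O, X, Sig, Z, h1⟩

/-! ### The converse: derivatives of `varTransf` and its action on coefficients. -/

theorem MapsEquation.congr {W : Set (Var n)} (hW : IsOpen W) {φ φ' : Var n → Var n}
    {S S' : Var n → ℂ} (h : MapsEquation W φ S S') (he : ∀ p ∈ W, φ' p = φ p) :
    MapsEquation W φ' S S' := by
  intro q u u' hq hu hu' hrel
  have hc : ContinuousAt (graphPt u) q :=
    continuousAt_fst.prodMk (continuousAt_snd.prodMk hu.continuousAt)
  rw [he _ hq] at hu' ⊢
  refine h q u u' hq hu hu' ?_
  filter_upwards [hrel, hc.preimage_mem_nhds (hW.mem_nhds hq)] with r h1 h2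
  rw [← he _ h2]
  exact h1

theorem IsPointTransf.congr {E : Type*} [NormedAddCommGroup E] [NormedSpace ℝ E] {W : Set E}
    (hW : IsOpen W) {φ φ' : E → E} (h : IsPointTransf W φ) (he : ∀ p ∈ W, φ' p = φ p) :
    IsPointTransf W φ' where
  smooth := h.smooth.congr he
  inj := h.inj.congr fun p hp => (he p hp).symm
  nondeg p hp := by
    have h1 : φ' =ᶠ[𝓝 p] φ := Filter.eventuallyEq_of_mem (hW.mem_nhds hp) he
    rw [h1.fderiv_eq]
    exact h.nondeg p hp

theorem IsVarTransf.congr {W : Set (Var n)} (hW : IsOpen W) {φ φ' : Var n → Var n}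
    (h : IsVarTransf W φ) (he : ∀ p ∈ W, φ' p = φ p) : IsVarTransf W φ' where
  pointTransf := h.pointTransf.congr hW he
  ne_zero p hp := by rw [he p hp]; exact h.ne_zero p hp

theorem bijective_of_injective {E : Type*} [NormedAddCommGroup E] [NormedSpace ℝ E]
    [FiniteDimensional ℝ E] {L : E →L[ℝ] E} (h : ∀ v, L v = 0 → v = 0) :
    Function.Bijective L := by
  have hinj : Function.Injective L.toLinearMap := by
    rw [← LinearMap.ker_eq_bot, LinearMap.ker_eq_bot']
    exact h
  exact ⟨hinj, LinearMap.injective_iff_surjective.1 hinj⟩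

theorem injOn_of_deriv_ne_zero {I : Set ℝ} (hI' : IsConnected I) {T : ℝ → ℝ}
    (hT : ContDiffOn ℝ ∞ T I) (h0 : ∀ t ∈ I, deriv T t ≠ 0) : Set.InjOn T I := by
  have key : ∀ s ∈ I, ∀ t ∈ I, s < t → T s ≠ T t := by
    intro s hs t ht hst he
    have hsub : Set.Icc s t ⊆ I := hI'.isPreconnected.ordConnected.out hs ht
    obtain ⟨c, hc, hc'⟩ := exists_deriv_eq_zero hst (hT.continuousOn.mono hsub) he
    exact h0 c (hsub (Set.Ioo_subset_Icc_self hc)) hc'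
  intro s hs t ht he
  by_contra hne
  rcases lt_or_gt_of_ne hne with h | h
  · exact key s hs t ht h he
  · exact key t ht s hs h he.symm

theorem deriv_deriv_exp_quadratic (c₀ c₁ c₂ z w : ℂ) :
    deriv (deriv fun s : ℝ => Complex.exp (c₀ + s * c₁ + s ^ 2 * c₂) * (z + s * w)) 0
      = Complex.exp c₀ * ((c₁ ^ 2 + 2 * c₂) * z + 2 * c₁ * w) := by
  have hid : ∀ s : ℝ, HasDerivAt (fun s : ℝ => (s : ℂ)) 1 s := fun s =>
    Complex.ofRealCLM.hasDerivAt
  have he : ∀ s : ℝ, HasDerivAt (fun s : ℝ => Complex.exp (c₀ + s * c₁ + s ^ 2 * c₂))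
      (Complex.exp (c₀ + s * c₁ + s ^ 2 * c₂) * (c₁ + 2 * s * c₂)) s := fun s => by
    have h := ((((hid s).mul_const c₁).const_add c₀).add (((hid s).pow 2).mul_const c₂)).cexp
    exact h.congr_deriv (by simp)
  have h1 : (deriv fun s : ℝ => Complex.exp (c₀ + s * c₁ + s ^ 2 * c₂) * (z + s * w))
      = fun s : ℝ => Complex.exp (c₀ + s * c₁ + s ^ 2 * c₂)
        * ((c₁ + 2 * s * c₂) * (z + s * w) + w) := by
    funext s
    refine ((he s).mul (((hid s).mul_const w).const_add z)).deriv.trans ?_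
    ring
  rw [h1]
  have h2 : HasDerivAt (fun s : ℝ => (c₁ + 2 * s * c₂) * (z + s * w) + w) (2 * c₂ * z + c₁ * w)
      0 := by
    have h := ((((((hid 0).const_mul 2).mul_const c₂).const_add c₁).mul
      (((hid 0).mul_const w).const_add z))).add_const w
    exact h.congr_deriv (by simp)
  refine ((he 0).mul h2).deriv.trans ?_
  simp
  ring

/-- The exponential factor in `varTransf`. -/
def phaseFactor (T : ℝ → ℝ) (O : Space n ≃ₗᵢ[ℝ] Space n) (X : ℝ → Space n) (Sig Z : ℝ → ℝ)
    (q : ℝ × Space n) : ℂ :=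
  Complex.exp (Complex.I * ((phase T O X q + Sig q.1 : ℝ) : ℂ) + (Z q.1 : ℂ))

/-- The change of the potential under `varTransf`. -/
def potShift (T : ℝ → ℝ) (O : Space n ≃ₗᵢ[ℝ] Space n) (X : ℝ → Space n) (Sig Z : ℝ → ℝ)
    (q : ℝ × Space n) : ℂ :=
  (((fderiv ℝ (phase T O X) q (1, 0) + deriv Sig q.1) / deriv T q.1
    - ‖phaseGrad T O X q‖ ^ 2 / |deriv T q.1| : ℝ) : ℂ)
  - Complex.I * ((deriv Z q.1 / deriv T q.1 + 2 * n * phaseQuad T q.1 / |deriv T q.1| : ℝ) : ℂ)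

section

variable {I : Set ℝ} {T : ℝ → ℝ} {X : ℝ → Space n} {Sig Z : ℝ → ℝ}

/-- Conjugation switched by the sign of T_t is smooth because T_t is continuous without zeros, so
the switch is locally constant. -/
theorem contDiffOn_hat (hI : IsOpen I) (hT : ContDiffOn ℝ ∞ T I)
    (h0 : ∀ t ∈ I, deriv T t ≠ 0) {E : Type*} [NormedAddCommGroup E] [NormedSpace ℝ E]
    {τ : E → ℝ} {g : E → ℂ} {s : Set E} (hτ : ContDiffOn ℝ ∞ τ s)
    (hg : ContDiffOn ℝ ∞ g s) (hs : ∀ q ∈ s, τ q ∈ I) :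
    ContDiffOn ℝ ∞ (fun q => hat (deriv T (τ q)) (g q)) s := by
  intro q hq
  have h1 : ContDiffWithinAt ℝ ∞ (fun q' => hatL (deriv T (τ q)) (g q')) s q :=
    (hatL (deriv T (τ q))).contDiff.comp_contDiffWithinAt (hg q hq)
  have hc : ContinuousAt (deriv T) (τ q) :=
    ((contDiffOn_deriv hI hT).contDiffAt (hI.mem_nhds (hs q hq))).continuousAt
  have h2 := (hτ q hq).continuousWithinAt.eventually (hat_eventually_eq hc (h0 _ (hs q hq)))
  refine h1.congr_of_eventuallyEq ?_ (hatL_apply _ _).symm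
  filter_upwards [h2] with q' hq'
  rw [hq', hatL_apply]

theorem contDiffOn_phaseFactor (O : Space n ≃ₗᵢ[ℝ] Space n) (hI : IsOpen I)
    (hP : IsParam I T X Sig Z) (D : Set (Space n)) :
    ContDiffOn ℝ ∞ (phaseFactor T O X Sig Z) (I ×ˢ D) :=
  ((contDiffOn_const.mul (Complex.ofRealCLM.contDiff.comp_contDiffOn
    ((contDiffOn_phase O hI hP.smooth_T hP.smooth_X hP.deriv_ne D).add
      (ContDiffOn.comp_fst hP.smooth_Sig D)))).add
    (Complex.ofRealCLM.contDiff.comp_contDiffOn (ContDiffOn.comp_fst hP.smooth_Z D))).cexp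

theorem contDiffOn_varTransf (O : Space n ≃ₗᵢ[ℝ] Space n) (hI : IsOpen I)
    (hP : IsParam I T X Sig Z) (D : Set (Space n)) (A : Set ℂ) :
    ContDiffOn ℝ ∞ (varTransf T O X Sig Z) (I ×ˢ D ×ˢ A) := by
  have h1 : ContDiffOn ℝ ∞ (fun p : Var n => T p.1) (I ×ˢ D ×ˢ A) :=
    ContDiffOn.comp_fst hP.smooth_T _
  have h2 : ContDiffOn ℝ ∞ (fun p : Var n => Real.sqrt |deriv T p.1| • O p.2.1 + X p.1)
      (I ×ˢ D ×ˢ A) :=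
    ((ContDiffOn.comp_fst (contDiffOn_sqrt_abs_deriv hI hP.smooth_T hP.deriv_ne) _).smul
      (O.contDiff.comp (contDiff_fst.comp contDiff_snd)).contDiffOn).add
      (ContDiffOn.comp_fst hP.smooth_X _)
  have h3 : ContDiffOn ℝ ∞ (fun p : Var n => phaseFactor T O X Sig Z (base p)
      * hat (deriv T p.1) p.2.2) (I ×ˢ D ×ˢ A) :=
    ((contDiffOn_phaseFactor O hI hP D).comp (baseL n).contDiff.contDiffOn
      fun p hp => ⟨hp.1, hp.2.1⟩).mul (contDiffOn_hat hI hP.smooth_T hP.deriv_ne contDiffOn_fst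
        (contDiff_snd.comp contDiff_snd).contDiffOn fun p hp => hp.1)
  exact (h1.prodMk (h2.prodMk h3)).congr fun p _ => varTransf_eq T O X Sig Z p

theorem fderiv_phase (O : Space n ≃ₗᵢ[ℝ] Space n) (hI : IsOpen I) (hP : IsParam I T X Sig Z)
    {t : ℝ} (ht : t ∈ I) (x y : Space n) :
    fderiv ℝ (phase T O X) (t, x) (0, y) = inner ℝ (phaseGrad T O X (t, x)) y := by
  have hs := (contDiffOn_phase O hI hP.smooth_T hP.smooth_X hP.deriv_ne
    (Set.univ : Set (Space n))).contDiffAt (x := (t, x))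
    ((hI.prod isOpen_univ).mem_nhds ⟨ht, trivial⟩)
  have h1 := hasDerivAt_line (hs.differentiableAt (by simp)) (0, y)
  simp only [Prod.smul_mk, Prod.mk_add_mk, smul_zero, add_zero, phase_line] at h1
  exact h1.unique (hasDerivAt_quadratic _ _ _)

theorem hasDerivAt_scalar_line {F : Type*} [NormedAddCommGroup F] [NormedSpace ℝ F] {g : ℝ → F}
    {g' : F} {t : ℝ} (h : HasDerivAt g g' t) (a : ℝ) :
    HasDerivAt (fun s : ℝ => g (t + s * a)) (a • g') 0 := by
  have h1 : HasDerivAt (fun s : ℝ => t + s * a) a 0 := by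
    simpa using ((hasDerivAt_id' (0 : ℝ)).mul_const a).const_add t
  have h2 : HasDerivAt g g' (t + 0 * a) := by simpa using h
  exact h2.scomp 0 h1

theorem fderiv_varTransf (O : Space n ≃ₗᵢ[ℝ] Space n) (hI : IsOpen I) (hP : IsParam I T X Sig Z)
    {t : ℝ} (ht : t ∈ I) (x : Space n) (z : ℂ) (a : ℝ) (y : Space n) (w : ℂ) :
    fderiv ℝ (varTransf T O X Sig Z) (t, x, z) (a, y, w)
      = (a * deriv T t,
        Real.sqrt |deriv T t| • O y + (a * (4 * phaseQuad T t * Real.sqrt |deriv T t|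
          * (|deriv T t| / deriv T t))) • O x + a • deriv X t,
        phaseFactor T O X Sig Z (t, x)
          * ((Complex.I * ((a * fderiv ℝ (phase T O X) (t, x) (1, 0)
              + inner ℝ (phaseGrad T O X (t, x)) y + a * deriv Sig t : ℝ) : ℂ)
              + ((a * deriv Z t : ℝ) : ℂ)) * hat (deriv T t) z + hat (deriv T t) w)) := by
  have hs := (contDiffOn_varTransf O hI hP Set.univ Set.univ).contDiffAt (x := (t, x, z))
    ((hI.prod (isOpen_univ.prod isOpen_univ)).mem_nhds ⟨ht, trivial, trivial⟩)
  refine (hasDerivAt_line (hs.differentiableAt (by simp)) (a, y, w)).unique ?_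
  simp only [Prod.smul_mk, Prod.mk_add_mk, varTransf_eq, base, smul_eq_mul]
  have hO : HasDerivAt (fun s : ℝ => O (x + s • y)) (O y) 0 := by
    have h1 : HasDerivAt (fun s : ℝ => O x + s • O y) (O y) 0 := by
      simpa using ((hasDerivAt_id' (0 : ℝ)).smul_const (O y)).const_add (O x)
    simpa only [map_add, map_smul] using h1
  have h1 := hasDerivAt_scalar_line (hasDerivAt_of_contDiffOn hI hP.smooth_T ht) a
  have h2 := hasDerivAt_scalar_line (hasDerivAt_sqrt_abs_deriv hI hP.smooth_T ht
    (hP.deriv_ne t ht)) a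
  have h3 := hasDerivAt_scalar_line (hasDerivAt_of_contDiffOn hI hP.smooth_X ht) a
  have h4 := hasDerivAt_scalar_line (hasDerivAt_of_contDiffOn hI hP.smooth_Sig ht) a
  have h5 := hasDerivAt_scalar_line (hasDerivAt_of_contDiffOn hI hP.smooth_Z ht) a
  have h6 : HasDerivAt (fun s : ℝ => phase T O X (t + s * a, x + s • y))
      (a * fderiv ℝ (phase T O X) (t, x) (1, 0) + inner ℝ (phaseGrad T O X (t, x)) y) 0 := by
    have hs := (contDiffOn_phase O hI hP.smooth_T hP.smooth_X hP.deriv_ne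
      (Set.univ : Set (Space n))).contDiffAt (x := (t, x))
      ((hI.prod isOpen_univ).mem_nhds ⟨ht, trivial⟩)
    have h1 := hasDerivAt_line (hs.differentiableAt (by simp)) (a, y)
    simp only [Prod.smul_mk, Prod.mk_add_mk, smul_eq_mul] at h1
    refine h1.congr_deriv ?_
    have h2 : ((a, y) : ℝ × Space n) = a • (1, 0) + (0, y) := by simp
    rw [h2, map_add, map_smul, fderiv_phase O hI hP ht, smul_eq_mul]
  have h7 : HasDerivAt (fun s : ℝ => hat (deriv T (t + s * a)) (z + s • w)) (hat (deriv T t) w)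
      0 := by
    have h1 : HasDerivAt (fun s : ℝ => hatL (deriv T t) (z + s • w)) (hatL (deriv T t) w) 0 := by
      have h1 : HasDerivAt (fun s : ℝ => z + s • w) w 0 := by
        simpa using ((hasDerivAt_id' (0 : ℝ)).smul_const w).const_add z
      exact (hatL (deriv T t)).hasFDerivAt.comp_hasDerivAt 0 h1
    have hc : ContinuousAt (deriv T) t :=
      ((contDiffOn_deriv hI hP.smooth_T).contDiffAt (hI.mem_nhds ht)).continuousAt
    have hl : Filter.Tendsto (fun s : ℝ => t + s * a) (𝓝 0) (𝓝 t) := by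
      have : ContinuousAt (fun s : ℝ => t + s * a) 0 := by fun_prop
      simpa [ContinuousAt] using this
    rw [hatL_apply] at h1
    refine h1.congr_of_eventuallyEq ?_
    filter_upwards [hl.eventually (hat_eventually_eq hc (hP.deriv_ne t ht))] with s hs
    rw [hs, hatL_apply]
  have h8 := (((h6.add h4).ofReal_comp.const_mul Complex.I).add h5.ofReal_comp).cexp.mul h7
  refine (h1.prodMk (((h2.smul hO).add h3).prodMk h8)).congr_deriv ?_
  simp only [phaseFactor, smul_eq_mul, zero_mul, zero_smul, add_zero, Pi.add_apply]
  refine Prod.ext rfl (Prod.ext ?_ ?_)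
  · simp only
  · simp only
    push_cast
    ring

theorem fderiv_fderiv_varTransf (O : Space n ≃ₗᵢ[ℝ] Space n) (hI : IsOpen I)
    (hP : IsParam I T X Sig Z) {t : ℝ} (ht : t ∈ I) (x : Space n) (z : ℂ) (y : Space n) (w : ℂ) :
    fderiv ℝ (fderiv ℝ (varTransf T O X Sig Z)) (t, x, z) (0, y, w) (0, y, w)
      = (0, 0, phaseFactor T O X Sig Z (t, x)
          * (((Complex.I * (inner ℝ (phaseGrad T O X (t, x)) y : ℝ)) ^ 2
              + 2 * (Complex.I * ((phaseQuad T t * ‖y‖ ^ 2 : ℝ) : ℂ))) * hat (deriv T t) z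
            + 2 * (Complex.I * (inner ℝ (phaseGrad T O X (t, x)) y : ℝ)) * hat (deriv T t) w)) := by
  have hs := (contDiffOn_varTransf O hI hP Set.univ Set.univ).contDiffAt (x := (t, x, z))
    ((hI.prod (isOpen_univ.prod isOpen_univ)).mem_nhds ⟨ht, trivial, trivial⟩)
  have hv : ∀ s : ℝ, varTransf T O X Sig Z ((t, x, z) + s • (0, y, w)) = (T t,
      (Real.sqrt |deriv T t| • O x + X t) + s • (Real.sqrt |deriv T t| • O y),
      Complex.exp ((Complex.I * ((phase T O X (t, x) + Sig t : ℝ) : ℂ) + (Z t : ℂ))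
        + s * (Complex.I * (inner ℝ (phaseGrad T O X (t, x)) y : ℝ))
        + s ^ 2 * (Complex.I * ((phaseQuad T t * ‖y‖ ^ 2 : ℝ) : ℂ)))
        * (hat (deriv T t) z + s * hat (deriv T t) w)) := by
    intro s
    simp only [Prod.smul_mk, Prod.mk_add_mk, smul_zero, add_zero, varTransf_eq, base, phase_line]
    refine Prod.ext rfl (Prod.ext ?_ ?_)
    · simp only [map_add, map_smul, smul_add]
      rw [smul_comm]
      abel
    · simp only
      congr 1
      · congr 1
        push_cast
        ring
      · rw [hat_add, Complex.real_smul, hat_mul, hat_ofReal]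
  refine var_ext ?_ ?_
  · rw [← fderiv_fderiv_clm_comp hs, fderiv_fderiv_apply_self
      (f := fun y => baseL n (varTransf T O X Sig Z y)) ((baseL n).contDiff.contDiffAt.comp _ hs)]
    simp only [hv, baseL_apply, base]
    have h1 : (deriv fun s : ℝ => (T t, (Real.sqrt |deriv T t| • O x + X t)
        + s • (Real.sqrt |deriv T t| • O y)))
        = fun _ => ((0 : ℝ), Real.sqrt |deriv T t| • O y) := by
      funext s
      refine ((hasDerivAt_const s (T t)).prodMk ?_).deriv
      simpa using ((hasDerivAt_id' s).smul_const (Real.sqrt |deriv T t| • O y)).const_add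
        (Real.sqrt |deriv T t| • O x + X t)
    rw [h1, deriv_const]
    rfl
  · rw [← fderiv_fderiv_clm_comp hs, fderiv_fderiv_apply_self
      (f := fun y => psiL n (varTransf T O X Sig Z y)) ((psiL n).contDiff.contDiffAt.comp _ hs)]
    simp only [hv, psiL_apply, deriv_deriv_exp_quadratic, phaseFactor]

theorem phaseFactor_ne_zero (O : Space n ≃ₗᵢ[ℝ] Space n) (q : ℝ × Space n) :
    phaseFactor T O X Sig Z q ≠ 0 := Complex.exp_ne_zero _

theorem isVarTransf_varTransf (O : Space n ≃ₗᵢ[ℝ] Space n) (hI : IsOpen I) (hI' : IsConnected I)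
    (hP : IsParam I T X Sig Z) {D : Set (Space n)} {A : Set ℂ} (hA0 : (0 : ℂ) ∉ A) :
    IsVarTransf (I ×ˢ D ×ˢ A) (varTransf T O X Sig Z) := by
  have hκ : ∀ t ∈ I, Real.sqrt |deriv T t| ≠ 0 := fun t ht =>
    (Real.sqrt_pos.2 (abs_pos.2 (hP.deriv_ne t ht))).ne'
  refine ⟨⟨contDiffOn_varTransf O hI hP D A, ?_, ?_⟩, ?_⟩
  · rintro ⟨t, x, z⟩ hp ⟨t', x', z'⟩ hp' he
    rw [varTransf_eq, varTransf_eq] at he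
    obtain ⟨h1, h2⟩ := Prod.ext_iff.1 he
    obtain rfl := injOn_of_deriv_ne_zero hI' hP.smooth_T hP.deriv_ne hp.1 hp'.1 h1
    obtain ⟨h3, h4⟩ := Prod.ext_iff.1 h2
    simp only [add_left_inj] at h3
    obtain rfl := O.injective (smul_right_injective _ (hκ t hp.1) h3)
    simp only [base] at h4
    have h5 := mul_left_cancel₀ (Complex.exp_ne_zero _) h4
    rw [← hat_hat (deriv T t) z, h5, hat_hat]
  · rintro ⟨t, x, z⟩ hp
    refine bijective_of_injective ?_
    rintro ⟨a, y, w⟩ h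
    rw [fderiv_varTransf O hI hP hp.1] at h
    obtain ⟨h1, h2⟩ := Prod.ext_iff.1 h
    obtain rfl : a = 0 := (mul_eq_zero.1 h1).resolve_right (hP.deriv_ne t hp.1)
    obtain ⟨h3, h4⟩ := Prod.ext_iff.1 h2
    simp only [zero_mul, zero_smul, add_zero, Prod.fst_zero, Prod.snd_zero] at h3
    obtain rfl : y = 0 := by
      have := (smul_eq_zero.1 h3).resolve_left (hκ t hp.1)
      exact O.injective (this.trans (map_zero O).symm)
    simp only [zero_mul, inner_zero_right, add_zero, Complex.ofReal_zero, mul_zero, zero_add,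
      Prod.snd_zero, mul_eq_zero, phaseFactor_ne_zero, false_or] at h4
    rw [hat_eq_zero.1 h4]
    rfl
  · rintro ⟨t, x, z⟩ hp h
    rw [varTransf_eq] at h
    refine hA0 ?_
    have h1 := (mul_eq_zero.1 h).resolve_left (Complex.exp_ne_zero _)
    rw [← hat_eq_zero.1 h1]
    exact hp.2.2

/-- The drift X_x⁻¹X_t is a multiple of the gradient of the phase. This coincidence is what removes
the terms linear in the gradient of u from `errTerm`. -/
theorem isFibredJet_varTransf (O : Space n ≃ₗᵢ[ℝ] Space n) (hI : IsOpen I) (hI' : IsConnected I)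
    (hP : IsParam I T X Sig Z) {p : Var n} (hp : p.1 ∈ I) (hz : p.2.2 ≠ 0) :
    IsFibredJet (fderiv ℝ (varTransf T O X Sig Z) p) (fderiv ℝ (fderiv ℝ (varTransf T O X Sig Z)) p)
      (deriv T p.1) ((2 * (|deriv T p.1| / deriv T p.1)) • phaseGrad T O X (base p)) := by
  obtain ⟨t, x, z⟩ := p
  have hτ := hP.deriv_ne t hp
  have hκ : Real.sqrt |deriv T t| ^ 2 = |deriv T t| := Real.sq_sqrt (abs_nonneg _)
  have hab : |deriv T t| ^ 2 = deriv T t ^ 2 := sq_abs _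
  refine ⟨(isVarTransf_varTransf (D := Set.univ) (A := {0}ᶜ) O hI hI' hP
    (by simp)).pointTransf.nondeg _ ⟨hp, trivial, hz⟩, hτ, ?_, ?_, ?_, ?_, ?_, ?_⟩
  · intro w
    rw [fderiv_varTransf O hI hP hp, baseL_apply, base]
    simp
  · intro y
    rw [fderiv_varTransf O hI hP hp]
    simp
  · rw [fderiv_varTransf O hI hP hp, baseL_apply]
    simp only [base, one_mul, one_smul]
    refine Prod.ext rfl ?_
    simp only [phaseGrad, map_neg, map_smul, map_add, LinearIsometryEquiv.apply_symm_apply,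
      phaseLin, smul_add, smul_neg, smul_smul]
    have h1 : Real.sqrt |deriv T t| * (2 * (|deriv T t| / deriv T t) * (2 * phaseQuad T t))
        = 4 * phaseQuad T t * Real.sqrt |deriv T t| * (|deriv T t| / deriv T t) := by ring
    have h2 : Real.sqrt |deriv T t| * (2 * (|deriv T t| / deriv T t)
        * (Real.sqrt |deriv T t| / (2 * deriv T t))) = 1 := by
      field_simp
      rw [hκ, hab.symm]
      ring
    rw [h1, h2, one_smul]
    abel
  · intro y y'
    rw [fderiv_varTransf O hI hP hp, fderiv_varTransf O hI hP hp]
    simp only [zero_mul, zero_smul, add_zero]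
    rw [real_inner_smul_left, real_inner_smul_right, O.inner_map_map, ← mul_assoc, ← sq, hκ]
  · intro y w
    rw [fderiv_fderiv_varTransf O hI hP hp]
    rfl
  · intro w
    rw [fderiv_varTransf O hI hP hp, fderiv_varTransf O hI hP hp, psiL_apply, psiL_apply]
    simp only [zero_mul, inner_zero_right, add_zero, Complex.ofReal_zero, mul_zero, zero_add,
      hat_mul, hat_I hτ]
    ring

/-- For these transformations `errTerm` is free of ξ and equals the defect of the relation between S
and S' times the nonzero value ψ̃, so its vanishing is that relation. -/
theorem mapsEquation_varTransf_iff (hn : 1 ≤ n) (O : Space n ≃ₗᵢ[ℝ] Space n) (hI : IsOpen I)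
    (hI' : IsConnected I) (hP : IsParam I T X Sig Z) {D : Set (Space n)} {A : Set ℂ}
    (hD : IsOpen D) (hA : IsOpen A) (hA0 : (0 : ℂ) ∉ A) {S S' : Var n → ℂ} :
    MapsEquation (I ×ˢ D ×ˢ A) (varTransf T O X Sig Z) S S' ↔ ∀ p ∈ I ×ˢ D ×ˢ A,
      S' (varTransf T O X Sig Z p) = hat (deriv T p.1) (S p) / ((|deriv T p.1| : ℝ) : ℂ)
        + potShift T O X Sig Z (base p) := by
  have hne : ∀ p ∈ I ×ˢ D ×ˢ A, p.2.2 ≠ 0 := fun p hp h => hA0 (h ▸ hp.2.2)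
  rw [mapsEquation_iff_errTerm hn (hI.prod (hD.prod hA)) (contDiffOn_varTransf O hI hP D A)
    (τ := fun p => deriv T p.1)
    (m := fun p => (2 * (|deriv T p.1| / deriv T p.1)) • phaseGrad T O X (base p))
    (fun p hp => isFibredJet_varTransf O hI hI' hP hp.1 (hne p hp))]
  refine forall₂_congr fun p hp => ?_
  have key : ∀ ξ, errTerm (fderiv ℝ (varTransf T O X Sig Z) p)
      (fderiv ℝ (fderiv ℝ (varTransf T O X Sig Z)) p) (deriv T p.1)
      ((2 * (|deriv T p.1| / deriv T p.1)) • phaseGrad T O X (base p))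
      (S p * psiL n p) (S' (varTransf T O X Sig Z p) * psiL n (varTransf T O X Sig Z p)) ξ
      = (S' (varTransf T O X Sig Z p) - (hat (deriv T p.1) (S p) / ((|deriv T p.1| : ℝ) : ℂ)
        + potShift T O X Sig Z (base p)))
        * (phaseFactor T O X Sig Z (base p) * hat (deriv T p.1) p.2.2) := by
    intro ξ
    have hpsi : psiL n (varTransf T O X Sig Z p)
        = phaseFactor T O X Sig Z (base p) * hat (deriv T p.1) p.2.2 := by
      rw [varTransf_eq]; rfl
    rw [hpsi]
    generalize S' (varTransf T O X Sig Z p) = σ'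
    obtain ⟨t, x, z⟩ := p
    have hτ := hP.deriv_ne t hp.1
    simp only [errTerm, fderiv_varTransf O hI hP hp.1, fderiv_fderiv_varTransf O hI hP hp.1,
      psiL_apply, base, (stdB n).norm_eq_one]
    set g := phaseGrad T O X (t, x) with hg
    set E := phaseFactor T O X Sig Z (t, x)
    have hsum1 : ∑ j, ((inner ℝ g (stdB n j) : ℝ) : ℂ) ^ 2 = ((‖g‖ ^ 2 : ℝ) : ℂ) := by
      rw [← (stdB n).sum_sq_inner_left g]
      push_cast
      rfl
    have hsum2 : ∑ j, ((inner ℝ g (stdB n j) : ℝ) : ℂ) * hat (deriv T t) (ξ (stdB n j))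
        = hat (deriv T t) (ξ g) := by
      conv_rhs => rw [← (stdB n).sum_repr' g]
      rw [map_sum, ← hatL_apply, map_sum]
      refine Finset.sum_congr rfl fun j _ => ?_
      rw [hatL_apply, map_smul, Complex.real_smul, hat_mul, hat_ofReal, real_inner_comm]
    have hsum : ∑ j, E * (((Complex.I * (inner ℝ g (stdB n j) : ℝ)) ^ 2
          + 2 * (Complex.I * ((phaseQuad T t * 1 ^ 2 : ℝ) : ℂ))) * hat (deriv T t) z
          + 2 * (Complex.I * (inner ℝ g (stdB n j) : ℝ)) * hat (deriv T t) (ξ (stdB n j)))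
        = E * ((-((‖g‖ ^ 2 : ℝ) : ℂ) + 2 * n * Complex.I * (phaseQuad T t : ℂ))
          * hat (deriv T t) z + 2 * Complex.I * hat (deriv T t) (ξ g)) := by
      rw [← hsum1, ← hsum2, ← Finset.mul_sum, Finset.sum_add_distrib, ← Finset.sum_mul,
        Finset.sum_add_distrib]
      simp only [mul_pow, Complex.I_sq, Finset.mul_sum, Finset.sum_const, Finset.card_univ,
        Fintype.card_fin, nsmul_eq_mul, ← mul_assoc]
      push_cast
      simp only [neg_mul, one_mul, Finset.sum_neg_distrib]
      ring
    rw [hsum]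
    have hxi : hat (deriv T t) (ξ ((2 * (|deriv T t| / deriv T t)) • g))
        = ((2 * (|deriv T t| / deriv T t) : ℝ) : ℂ) * hat (deriv T t) (ξ g) := by
      rw [map_smul, Complex.real_smul, hat_mul, hat_ofReal]
    have hin : inner ℝ g (-((2 * (|deriv T t| / deriv T t)) • g))
        = -(2 * (|deriv T t| / deriv T t)) * ‖g‖ ^ 2 := by
      rw [inner_neg_right, real_inner_smul_right, real_inner_self_eq_norm_sq]; ring
    rw [hxi, hin, hat_mul]
    simp only [potShift, ← hg, zero_mul, inner_zero_right, add_zero, Complex.ofReal_zero, mul_zero,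
      zero_add, one_mul]
    have h1 : ((deriv T t : ℝ) : ℂ) ≠ 0 := by exact_mod_cast hτ
    have h2 : ((|deriv T t| : ℝ) : ℂ) ≠ 0 := by exact_mod_cast abs_ne_zero.2 hτ
    have hab : ((|deriv T t| : ℝ) : ℂ) ^ 2 = ((deriv T t : ℝ) : ℂ) ^ 2 := by
      exact_mod_cast sq_abs (deriv T t)
    push_cast
    generalize ((|deriv T t| : ℝ) : ℂ) = r at *
    generalize ((deriv T t : ℝ) : ℂ) = τ at *
    rw [show r / τ = τ / r by rw [div_eq_div_iff h1 h2, ← sq, ← sq, hab]]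
    field_simp
    rw [hat_eq_zero.2 rfl]
    linear_combination (E * hat (deriv T t) z * ((fderiv ℝ (phase T O X) (t, x) (1, 0) : ℂ) * r
      - τ * 2 * (‖g‖ : ℂ) ^ 2 + r * ((deriv Sig t : ℝ) : ℂ))) * Complex.I_sq
  have hnz : phaseFactor T O X Sig Z (base p) * hat (deriv T p.1) p.2.2 ≠ 0 :=
    mul_ne_zero (Complex.exp_ne_zero _) fun h => hne p hp (hat_eq_zero.1 h)
  constructor
  · intro h
    have h1 := h 0
    rw [key] at h1
    exact sub_eq_zero.1 ((mul_eq_zero.1 h1).resolve_right hnz)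
  · intro h ξ
    rw [key, h, sub_self, zero_mul]

end

/-! ### Ranges of ρ and rescaling of nonlinearities. -/

theorem isOpen_rhoRange {W : Set (Var n)} (hW : IsOpen W) (h0 : ∀ p ∈ W, p.2.2 ≠ 0) :
    IsOpen (rhoRange W) := by
  rw [isOpen_iff_mem_nhds]
  rintro _ ⟨p, hp, rfl⟩
  have hz : (‖p.2.2‖ : ℝ) ≠ 0 := norm_ne_zero_iff.2 (h0 p hp)
  have hc : ContinuousAt (fun r : ℝ => ((p.1, p.2.1, (r / ‖p.2.2‖) • p.2.2) : Var n)) ‖p.2.2‖ := by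
    fun_prop
  have hmem : (fun r : ℝ => ((p.1, p.2.1, (r / ‖p.2.2‖) • p.2.2) : Var n)) ⁻¹' W ∈ 𝓝 ‖p.2.2‖ := by
    refine hc.preimage_mem_nhds (hW.mem_nhds ?_)
    simpa [div_self hz] using hp
  filter_upwards [hmem, eventually_gt_nhds (norm_pos_iff.2 (h0 p hp))] with r hr hr0
  refine ⟨_, hr, ?_⟩
  simp only [norm_smul, norm_div, Real.norm_eq_abs, abs_of_pos hr0, abs_norm]
  exact div_mul_cancel₀ _ hz

theorem IsEqDomain.isOpen_rhoRange {W : Set (Var n)} (hW : IsEqDomain W) : IsOpen (rhoRange W) :=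
  NLS.isOpen_rhoRange hW.1 hW.2.2

theorem IsEqDomain.isConnected_rhoRange {W : Set (Var n)} (hW : IsEqDomain W) :
    IsConnected (rhoRange W) :=
  hW.2.1.image _ (continuous_norm.comp (continuous_snd.comp continuous_snd)).continuousOn

theorem IsEqDomain.pos {W : Set (Var n)} (hW : IsEqDomain W) {ρ : ℝ} (hρ : ρ ∈ rhoRange W) :
    0 < ρ := by
  obtain ⟨p, hp, rfl⟩ := hρ
  exact norm_pos_iff.2 (hW.2.2 p hp)

theorem isEqDomain_prod {I : Set ℝ} {D : Set (Space n)} {A : Set ℂ} (hI : IsOpen I)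
    (hI' : IsConnected I) (hD : IsOpen D) (hD' : IsConnected D) (hA : IsOpen A)
    (hA' : IsConnected A) (hA0 : (0 : ℂ) ∉ A) : IsEqDomain (I ×ˢ D ×ˢ A) :=
  ⟨hI.prod (hD.prod hA), hI'.prod (hD'.prod hA'), fun _ hp h => hA0 (h ▸ hp.2.2)⟩

theorem IsVarTransf.isEqDomain {W : Set (Var n)} (hW : IsEqDomain W) {φ : Var n → Var n}
    (h : IsVarTransf W φ) : IsEqDomain (φ '' W) :=
  ⟨h.pointTransf.isOpen_image hW.1 hW.1 subset_rfl,
    hW.2.1.image _ h.pointTransf.smooth.continuousOn, by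
      rintro _ ⟨p, hp, rfl⟩
      exact h.ne_zero p hp⟩

/-- The ratio ρ f_ρρ/f_ρ is insensitive to the additive constant, to the factor a and to the scale
k; only conjugation acts on it. -/
theorem rescale {R R' : Set ℝ} (hR : IsOpen R) (hR' : IsOpen R') {f f' : ℝ → ℂ} {a c : ℂ}
    {k τ : ℝ} (ha : a ≠ 0) (hk : k ≠ 0) (hmaps : ∀ σ ∈ R', k * σ ∈ R)
    (h : ∀ σ ∈ R', f' σ = a * hat τ (f (k * σ)) + c) (hf : ContDiffOn ℝ ∞ f R) :
    ContDiffOn ℝ ∞ f' R' ∧ ∀ σ ∈ R', deriv f' σ = k * a * hat τ (deriv f (k * σ)) ∧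
      ratio f' σ = hat τ (ratio f (k * σ)) := by
  have hd : ∀ (g : ℝ → ℂ) (g' : ℝ → ℂ) (a c : ℂ), ContDiffOn ℝ ∞ g R →
      (∀ σ ∈ R', g' σ = a * hat τ (g (k * σ)) + c) →
      ∀ σ ∈ R', deriv g' σ = k * a * hat τ (deriv g (k * σ)) := by
    intro g g' a c hg hrel σ hσ
    have h1 := hasDerivAt_of_contDiffOn hR hg (hmaps σ hσ)
    have h2 : HasDerivAt (fun s => k * s) k σ := by simpa using (hasDerivAt_id' σ).const_mul k
    have h3 := h1.scomp σ h2
    have h4 := ((hatL τ).hasFDerivAt.comp_hasDerivAt σ h3).const_mul a |>.add_const c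
    have h5 : g' =ᶠ[𝓝 σ] fun s => a * hatL τ (g (k * s)) + c := by
      filter_upwards [hR'.mem_nhds hσ] with s hs
      rw [hrel s hs, hatL_apply]
    rw [h5.deriv_eq]
    refine h4.deriv.trans ?_
    rw [hatL_apply, Complex.real_smul, hat_mul, hat_ofReal]
    ring
  have hs : ContDiffOn ℝ ∞ f' R' := by
    have h1 : ContDiffOn ℝ ∞ (fun s => f (k * s)) R' :=
      hf.comp (contDiff_const.mul contDiff_id).contDiffOn hmaps
    have h2 : ContDiffOn ℝ ∞ (fun s => a * hatL τ (f (k * s)) + c) R' :=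
      (contDiffOn_const.mul ((hatL τ).contDiff.comp_contDiffOn h1)).add contDiffOn_const
    exact h2.congr fun s hs => by rw [h s hs, hatL_apply]
  refine ⟨hs, fun σ hσ => ?_⟩
  have h1 := hd f f' a c hf h
  have h2 := hd (deriv f) (deriv f') (k * a) 0 (contDiffOn_deriv hR hf)
    (fun s hs => by rw [h1 s hs, add_zero]) σ hσ
  refine ⟨h1 σ hσ, ?_⟩
  have hk' : (k : ℂ) ≠ 0 := by exact_mod_cast hk
  have h3 : hat τ (ratio f (k * σ)) = ((k * σ : ℝ) : ℂ) * hat τ (deriv (deriv f) (k * σ))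
      / hat τ (deriv f (k * σ)) := by
    rw [ratio, ← hatL_apply]
    unfold hatL hat
    split_ifs <;> simp
  rw [h3, ratio, h1 σ hσ, h2]
  by_cases h4 : hat τ (deriv f (k * σ)) = 0
  · simp [h4]
  · push_cast
    field_simp

/-! ### Transformation of (t, x) and of potentials. -/

/-- The transformation of `(t, x)`. -/
def baseMap (T : ℝ → ℝ) (O : Space n ≃ₗᵢ[ℝ] Space n) (X : ℝ → Space n) (q : ℝ × Space n) :
    ℝ × Space n :=
  (T q.1, Real.sqrt |deriv T q.1| • O q.2 + X q.1)

theorem base_varTransf (T : ℝ → ℝ) (O : Space n ≃ₗᵢ[ℝ] Space n) (X : ℝ → Space n)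
    (Sig Z : ℝ → ℝ) (p : Var n) : base (varTransf T O X Sig Z p) = baseMap T O X (base p) := by
  rw [varTransf_eq]; rfl

theorem norm_varTransf (T : ℝ → ℝ) (O : Space n ≃ₗᵢ[ℝ] Space n) (X : ℝ → Space n)
    (Sig Z : ℝ → ℝ) (p : Var n) :
    ‖(varTransf T O X Sig Z p).2.2‖ = Real.exp (Z p.1) * ‖p.2.2‖ := by
  rw [varTransf_eq]
  simp only [norm_mul, norm_hat, Complex.norm_exp]
  congr 2
  simp

section

variable {I : Set ℝ} {T : ℝ → ℝ} {X : ℝ → Space n} {Sig Z : ℝ → ℝ}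

theorem hat_deriv_eq (hI : IsOpen I) (hI' : IsConnected I) (hT : ContDiffOn ℝ ∞ T I)
    (h0 : ∀ t ∈ I, deriv T t ≠ 0) {t t' : ℝ} (ht : t ∈ I) (ht' : t' ∈ I) :
    hat (deriv T t) = hat (deriv T t') := by
  have hc := (contDiffOn_deriv hI hT).continuousOn
  have key : ∀ t ∈ I, ∀ t' ∈ I, 0 < deriv T t → 0 < deriv T t' := by
    intro t ht t' ht' h
    by_contra h'
    obtain ⟨s, hs, hs0⟩ := hI'.isPreconnected.intermediate_value ht' ht hc
      ⟨not_lt.1 h', h.le⟩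
    exact h0 s hs hs0
  funext z
  unfold hat
  by_cases h : 0 < deriv T t
  · rw [if_pos h, if_pos (key t ht t' ht' h)]
  · rw [if_neg h, if_neg fun h' => h (key t' ht' t ht h')]

theorem isPointTransf_baseMap (O : Space n ≃ₗᵢ[ℝ] Space n) (hI : IsOpen I) (hI' : IsConnected I)
    (hP : IsParam I T X Sig Z) {D : Set (Space n)} (hD : IsOpen D) :
    IsPointTransf (I ×ˢ D) (baseMap T O X) := by
  have hv := isVarTransf_varTransf (D := D) (A := {0}ᶜ) O hI hI' hP (by simp)
  have hcl : ContDiff ℝ ∞ (fun q : ℝ × Space n => ((q.1, q.2, 1) : Var n)) := by fun_prop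
  have hs : ContDiffOn ℝ ∞ (baseMap T O X) (I ×ˢ D) :=
    (baseL n).contDiff.comp_contDiffOn (hv.pointTransf.smooth.comp hcl.contDiffOn
      fun q hq => ⟨hq.1, hq.2, by simp⟩)
  have hκ : ∀ t ∈ I, Real.sqrt |deriv T t| ≠ 0 := fun t ht =>
    (Real.sqrt_pos.2 (abs_pos.2 (hP.deriv_ne t ht))).ne'
  refine ⟨hs, ?_, ?_⟩
  · rintro ⟨t, x⟩ hp ⟨t', x'⟩ hp' he
    obtain ⟨h1, h2⟩ := Prod.ext_iff.1 he
    obtain rfl := injOn_of_deriv_ne_zero hI' hP.smooth_T hP.deriv_ne hp.1 hp'.1 h1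
    simp only [baseMap, add_left_inj] at h2
    rw [O.injective (smul_right_injective _ (hκ t hp.1) h2)]
  · rintro ⟨t, x⟩ hp
    refine bijective_of_injective ?_
    rintro ⟨a, y⟩ h
    have h1 : fderiv ℝ (baseMap T O X) (t, x) (a, y)
        = baseL n (fderiv ℝ (varTransf T O X Sig Z) (t, x, 1) (a, y, 0)) := by
      have hd := ((hs.contDiffAt (x := (t, x)) ((hI.prod hD).mem_nhds hp)).differentiableAt
        (by simp))
      have hv' := (((contDiffOn_varTransf O hI hP Set.univ Set.univ).contDiffAt (x := (t, x, 1))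
        ((hI.prod (isOpen_univ.prod isOpen_univ)).mem_nhds
          ⟨hp.1, trivial, trivial⟩)).differentiableAt (by simp))
      refine (hasDerivAt_line hd (a, y)).unique ?_
      have h2 := (baseL n).hasFDerivAt.comp_hasDerivAt 0 (hasDerivAt_line hv' (a, y, 0))
      refine h2.congr_of_eventuallyEq (Filter.Eventually.of_forall fun s => ?_)
      simp only [Function.comp_apply, baseL_apply, base_varTransf]
      rfl
    rw [h1, fderiv_varTransf O hI hP hp.1] at h
    obtain ⟨h1, h2⟩ := Prod.ext_iff.1 h
    obtain rfl : a = 0 := (mul_eq_zero.1 h1).resolve_right (hP.deriv_ne t hp.1)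
    simp only [baseL_apply, base, zero_mul, zero_smul, add_zero, Prod.snd_zero] at h2
    have h3 := (smul_eq_zero.1 h2).resolve_left (hκ t hp.1)
    rw [O.injective (h3.trans (map_zero O).symm)]
    rfl

theorem base_image_prod {I : Set ℝ} {D : Set (Space n)} {A : Set ℂ} (hA : A.Nonempty) :
    base '' (I ×ˢ D ×ˢ A) = I ×ˢ D := by
  ext ⟨t, x⟩
  constructor
  · rintro ⟨p, hp, h⟩
    rw [← h]
    exact ⟨hp.1, hp.2.1⟩
  · intro h
    obtain ⟨z, hz⟩ := hA
    exact ⟨(t, x, z), ⟨h.1, h.2, hz⟩, rfl⟩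

theorem base_image_varTransf {D : Set (Space n)} {A : Set ℂ} (hA : A.Nonempty)
    {O : Space n ≃ₗᵢ[ℝ] Space n} {φ : Var n → Var n}
    (hφ : ∀ p ∈ I ×ˢ D ×ˢ A, φ p = varTransf T O X Sig Z p) :
    base '' (φ '' (I ×ˢ D ×ˢ A)) = baseMap T O X '' (I ×ˢ D) := by
  rw [← base_image_prod (I := I) (D := D) hA, Set.image_image, Set.image_image]
  exact Set.image_congr fun p hp => by rw [hφ p hp, base_varTransf]

/-- The new potential is the transformed one composed with the inverse of `baseMap`, which is smooth
by the inverse function theorem. The function Q stands for `potShift` with the corrections of the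
particular class. -/
theorem exists_potential_push (hI : IsOpen I) (hI' : IsConnected I)
    (hP : IsParam I T X Sig Z) {D : Set (Space n)} (hD : IsOpen D) {A : Set ℂ}
    (hA : A.Nonempty) {O : Space n ≃ₗᵢ[ℝ] Space n} {φ : Var n → Var n}
    (hφ : ∀ p ∈ I ×ˢ D ×ˢ A, φ p = varTransf T O X Sig Z p) {V Q : ℝ × Space n → ℂ}
    (hV : IsPotential (I ×ˢ D ×ˢ A) V) (hQ : ContDiffOn ℝ ∞ Q (I ×ˢ D)) :
    ∃ V', IsPotential (φ '' (I ×ˢ D ×ˢ A)) V' ∧ ∀ q ∈ I ×ˢ D, V' (baseMap T O X q)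
      = hat (deriv T q.1) (V q) / ((|deriv T q.1| : ℝ) : ℂ) + Q q := by
  obtain ⟨g, hg, hg'⟩ := (isPointTransf_baseMap O hI hI' hP hD).exists_inverse (hI.prod hD)
  rw [IsPotential, base_image_prod hA] at hV
  have hs : ContDiffOn ℝ ∞ (fun q : ℝ × Space n => hat (deriv T q.1) (V q) /
      ((|deriv T q.1| : ℝ) : ℂ) + Q q) (I ×ˢ D) := by
    simp only [div_eq_mul_inv]
    refine ContDiffOn.add (ContDiffOn.mul (contDiffOn_hat hI hP.smooth_T hP.deriv_ne
      contDiffOn_fst hV fun q hq => hq.1) (ContDiffOn.inv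
        (Complex.ofRealCLM.contDiff.comp_contDiffOn
        (ContDiffOn.comp_fst (contDiffOn_abs_deriv hI hP.smooth_T hP.deriv_ne) D)) ?_)) hQ
    intro q hq
    exact Complex.ofReal_ne_zero.2 (abs_ne_zero.2 (hP.deriv_ne _ hq.1))
  refine ⟨fun q => hat (deriv T (g q).1) (V (g q)) / ((|deriv T (g q).1| : ℝ) : ℂ) + Q (g q),
    ?_, fun q hq => ?_⟩
  · rw [IsPotential, base_image_varTransf hA hφ]
    refine hs.comp hg ?_
    rintro _ ⟨q, hq, rfl⟩
    rw [hg' q hq]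
    exact hq
  · simp only [hg' q hq]

theorem exists_potential_pull (hI : IsOpen I) (hI' : IsConnected I)
    (hP : IsParam I T X Sig Z) {D : Set (Space n)} (hD : IsOpen D) {A : Set ℂ}
    (hA : A.Nonempty) {O : Space n ≃ₗᵢ[ℝ] Space n} {φ : Var n → Var n}
    (hφ : ∀ p ∈ I ×ˢ D ×ˢ A, φ p = varTransf T O X Sig Z p) {V' Q : ℝ × Space n → ℂ}
    (hV : IsPotential (φ '' (I ×ˢ D ×ˢ A)) V') (hQ : ContDiffOn ℝ ∞ Q (I ×ˢ D)) :
    ∃ V, IsPotential (I ×ˢ D ×ˢ A) V ∧ ∀ q ∈ I ×ˢ D, V' (baseMap T O X q)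
      = hat (deriv T q.1) (V q) / ((|deriv T q.1| : ℝ) : ℂ) + Q q := by
  rw [IsPotential, base_image_varTransf hA hφ] at hV
  have h1 := hV.comp (isPointTransf_baseMap O hI hI' hP hD).smooth (Set.mapsTo_image _ _)
  refine ⟨fun q => hat (deriv T q.1) (((|deriv T q.1| : ℝ) : ℂ) * (V' (baseMap T O X q) - Q q)),
    ?_, fun q hq => ?_⟩
  · rw [IsPotential, base_image_prod hA]
    exact contDiffOn_hat hI hP.smooth_T hP.deriv_ne contDiffOn_fst
      ((Complex.ofRealCLM.contDiff.comp_contDiffOn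
        (ContDiffOn.comp_fst (contDiffOn_abs_deriv hI hP.smooth_T hP.deriv_ne) D)).mul
        (h1.sub hQ)) fun q hq => hq.1
  · have h2 : ((|deriv T q.1| : ℝ) : ℂ) ≠ 0 :=
      Complex.ofReal_ne_zero.2 (abs_ne_zero.2 (hP.deriv_ne _ hq.1))
    simp only [hat_hat]
    field_simp
    ring

theorem contDiffOn_potShift (O : Space n ≃ₗᵢ[ℝ] Space n) (hI : IsOpen I)
    (hP : IsParam I T X Sig Z) {D : Set (Space n)} (hD : IsOpen D) :
    ContDiffOn ℝ ∞ (potShift T O X Sig Z) (I ×ˢ D) := by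
  have hT := ContDiffOn.comp_fst (contDiffOn_deriv hI hP.smooth_T) D
  have hT0 : ∀ q ∈ I ×ˢ D, deriv T q.1 ≠ 0 := fun q hq => hP.deriv_ne q.1 hq.1
  have hA := ContDiffOn.comp_fst (contDiffOn_abs_deriv hI hP.smooth_T hP.deriv_ne) D
  have hA0 : ∀ q ∈ I ×ˢ D, |deriv T q.1| ≠ 0 := fun q hq => abs_ne_zero.2 (hT0 q hq)
  have hph : ContDiffOn ℝ ∞ (fun q => fderiv ℝ (phase T O X) q (1, 0)) (I ×ˢ D) :=
    ((contDiffOn_phase O hI hP.smooth_T hP.smooth_X hP.deriv_ne D).fderiv_of_isOpen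
      (hI.prod hD) (by simp)).clm_apply contDiffOn_const
  have h1 : ContDiffOn ℝ ∞ (fun q : ℝ × Space n => (fderiv ℝ (phase T O X) q (1, 0)
      + deriv Sig q.1) / deriv T q.1 - ‖phaseGrad T O X q‖ ^ 2 / |deriv T q.1|) (I ×ˢ D) :=
    ((hph.add (ContDiffOn.comp_fst (contDiffOn_deriv hI hP.smooth_Sig) D)).div hT hT0).sub
      (((contDiffOn_phaseGrad O hI hP.smooth_T hP.smooth_X hP.deriv_ne D).norm_sq ℝ).div hA hA0)
  have h2 : ContDiffOn ℝ ∞ (fun q : ℝ × Space n => deriv Z q.1 / deriv T q.1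
      + 2 * n * phaseQuad T q.1 / |deriv T q.1|) (I ×ˢ D) :=
    ((ContDiffOn.comp_fst (contDiffOn_deriv hI hP.smooth_Z) D).div hT hT0).add
      ((contDiffOn_const.mul (ContDiffOn.comp_fst
        (contDiffOn_phaseQuad hI hP.smooth_T hP.deriv_ne) D)).div hA hA0)
  exact (Complex.ofRealCLM.contDiff.comp_contDiffOn h1).sub
    (contDiffOn_const.mul (Complex.ofRealCLM.contDiff.comp_contDiffOn h2))

/-- The change of the potential if `T_tt = 0` and `Z` is constant. -/
theorem potShift_eq (O : Space n ≃ₗᵢ[ℝ] Space n) (hI : IsOpen I) {Z : ℝ}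
    (hP : IsParam I T X Sig fun _ => Z) (h2 : ∀ t ∈ I, deriv (deriv T) t = 0)
    {q : ℝ × Space n} (hq : q.1 ∈ I) : potShift T O X Sig (fun _ => Z) q
      = ((inner ℝ (deriv (deriv X) q.1) (O q.2) / (2 * |deriv T q.1| ^ (3 / 2 : ℝ))
          + deriv Sig q.1 / deriv T q.1 - ‖deriv X q.1‖ ^ 2 / (4 * deriv T q.1 ^ 2) : ℝ) : ℂ) := by
  obtain ⟨t, x⟩ := q
  have hτ := hP.deriv_ne t hq
  have hpos : 0 < |deriv T t| := abs_pos.2 hτ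
  have hq0 : ∀ s ∈ I, phaseQuad T s = 0 := fun s hs => by rw [phaseQuad, h2 s hs]; simp
  have hlin : HasDerivAt (fun s => phase T O X (s, x))
      (Real.sqrt |deriv T t| / (2 * deriv T t) * inner ℝ (deriv (deriv X) t) (O x)) t := by
    have h1 := hasDerivAt_of_contDiffOn hI (contDiffOn_deriv hI hP.smooth_X) hq
    have h3 := (hasDerivAt_sqrt_abs_deriv hI hP.smooth_T hq hτ).div
      ((hasDerivAt_of_contDiffOn hI (contDiffOn_deriv hI hP.smooth_T) hq).const_mul 2)
      (mul_ne_zero two_ne_zero hτ)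
    have h4 := (h3.smul h1).inner ℝ (hasDerivAt_const t (O x))
    refine (h4.congr_of_eventuallyEq ?_).congr_deriv ?_
    · filter_upwards [hI.mem_nhds hq] with s hs
      simp only [phase, hq0 s hs, zero_mul, zero_add, phaseLin]
      rfl
    · rw [hq0 t hq, h2 t hq]
      simp [real_inner_smul_left]
  have hs := (contDiffOn_phase O hI hP.smooth_T hP.smooth_X hP.deriv_ne
    (Set.univ : Set (Space n))).contDiffAt (x := (t, x))
    ((hI.prod isOpen_univ).mem_nhds ⟨hq, trivial⟩)
  have hfd : fderiv ℝ (phase T O X) (t, x) (1, 0)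
      = Real.sqrt |deriv T t| / (2 * deriv T t) * inner ℝ (deriv (deriv X) t) (O x) := by
    have h1 := hasDerivAt_line (hs.differentiableAt (by simp)) (1, 0)
    simp only [Prod.smul_mk, Prod.mk_add_mk, smul_zero, add_zero, smul_eq_mul] at h1
    refine h1.unique ?_
    simpa using hasDerivAt_scalar_line hlin 1
  have hgrad : ‖phaseGrad T O X (t, x)‖ ^ 2 = |deriv T t| * ‖deriv X t‖ ^ 2
      / (4 * deriv T t ^ 2) := by
    rw [phaseGrad, hq0 t hq]
    simp only [mul_zero, zero_smul, zero_add, LinearIsometryEquiv.norm_map, phaseLin, norm_smul]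
    rw [mul_pow, Real.norm_eq_abs, sq_abs, div_pow, Real.sq_sqrt hpos.le]
    ring
  have hpow : |deriv T t| ^ (3 / 2 : ℝ) = |deriv T t| * Real.sqrt |deriv T t| := by
    rw [Real.sqrt_eq_rpow, ← Real.rpow_one_add' hpos.le (by norm_num)]
    norm_num
  have hκ : 0 < Real.sqrt |deriv T t| := Real.sqrt_pos.2 hpos
  have hκ2 : Real.sqrt |deriv T t| ^ 2 = |deriv T t| := Real.sq_sqrt hpos.le
  have hab : |deriv T t| ^ 2 = deriv T t ^ 2 := sq_abs _
  have hreal : (fderiv ℝ (phase T O X) (t, x) (1, 0) + deriv Sig t) / deriv T t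
      - ‖phaseGrad T O X (t, x)‖ ^ 2 / |deriv T t|
      = inner ℝ (deriv (deriv X) t) (O x) / (2 * |deriv T t| ^ (3 / 2 : ℝ))
        + deriv Sig t / deriv T t - ‖deriv X t‖ ^ 2 / (4 * deriv T t ^ 2) := by
    rw [hfd, hgrad, hpow]
    have h3 : Real.sqrt |deriv T t| / (2 * deriv T t) / deriv T t
        = 1 / (2 * (|deriv T t| * Real.sqrt |deriv T t|)) := by
      rw [div_div, div_eq_div_iff (by positivity) (by positivity)]
      linear_combination 2 * |deriv T t| * hκ2 + 2 * hab
    have h4 : |deriv T t| * ‖deriv X t‖ ^ 2 / (4 * deriv T t ^ 2) / |deriv T t|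
        = ‖deriv X t‖ ^ 2 / (4 * deriv T t ^ 2) := by field_simp
    rw [h4, add_div, mul_div_right_comm, h3]
    ring
  simp only [potShift, hq0 t hq, hreal, deriv_const]
  simp

end

/-! ### Point transformations of the joint space with the arbitrary elements. -/

/-- A map that is affine and invertible in the fibres extends a point transformation to the joint
space. -/
theorem isPointTransf_joint {k : ℕ} {W : Set (Var n)} (hW : IsOpen W) {φ : Var n → Var n}
    {Λ : Var n → (Fin k → ℂ) → (Fin k → ℂ)} (hφ : IsPointTransf W φ)
    (hs : ContDiffOn ℝ ∞ (fun q : Var n × (Fin k → ℂ) => Λ q.1 q.2) (W ×ˢ Set.univ))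
    (hL : ∀ p ∈ W, ∃ L : (Fin k → ℂ) →ₗ[ℝ] (Fin k → ℂ), Function.Injective L ∧
      ∀ v, Λ p v = L v + Λ p 0) :
    IsPointTransf (W ×ˢ (Set.univ : Set (Fin k → ℂ)))
      (fun q : Var n × (Fin k → ℂ) => (φ q.1, Λ q.1 q.2)) := by
  have hsm : ContDiffOn ℝ ∞ (fun q : Var n × (Fin k → ℂ) => (φ q.1, Λ q.1 q.2))
      (W ×ˢ Set.univ) := (ContDiffOn.comp_fst hφ.smooth _).prodMk hs
  refine ⟨hsm, ?_, ?_⟩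
  · rintro ⟨p, v⟩ hp ⟨p', v'⟩ hp' he
    obtain ⟨h1, h2⟩ := Prod.ext_iff.1 he
    obtain rfl := hφ.inj hp.1 hp'.1 h1
    obtain ⟨L, hLi, hL⟩ := hL p hp.1
    simp only [hL v, hL v', add_left_inj] at h2
    rw [hLi h2]
  · rintro ⟨p, v⟩ hp
    refine bijective_of_injective ?_
    rintro ⟨Y, w⟩ h
    have hd := (hsm.contDiffAt ((hW.prod isOpen_univ).mem_nhds hp)).differentiableAt (by simp)
    have h1 := hasDerivAt_line hd (Y, w)
    rw [h] at h1
    have hdφ := (hφ.smooth.contDiffAt (hW.mem_nhds hp.1)).differentiableAt (by simp)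
    have h2 := (ContinuousLinearMap.fst ℝ (Var n) (Fin k → ℂ)).hasFDerivAt.comp_hasDerivAt 0 h1
    have h3 : fderiv ℝ φ p Y = 0 := (hasDerivAt_line hdφ Y).unique h2
    obtain rfl : Y = 0 := (hφ.nondeg p hp.1).1 (h3.trans (map_zero _).symm)
    have h4 := (ContinuousLinearMap.snd ℝ (Var n) (Fin k → ℂ)).hasFDerivAt.comp_hasDerivAt 0 h1
    obtain ⟨L, hLi, hL⟩ := hL p hp.1
    -- The differential is block triangular: its base block has given Y = 0, and along (0, w) the
    -- fibre component moves linearly with velocity L w.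
    have h5 : HasDerivAt (fun s : ℝ => Λ p v + s • L w) (L w) 0 := by
      simpa using ((hasDerivAt_id' (0 : ℝ)).smul_const (L w)).const_add (Λ p v)
    have h6 : HasDerivAt (fun s : ℝ => Λ p v + s • L w) 0 0 := by
      refine h4.congr_of_eventuallyEq (Filter.Eventually.of_forall fun s => ?_)
      simp only [Function.comp_apply, Prod.smul_mk, Prod.mk_add_mk, smul_zero, add_zero,
        ContinuousLinearMap.coe_snd']
      rw [hL (v + s • w), hL v, map_add, map_smul]
      abel
    rw [hLi ((h5.unique h6).trans (map_zero L).symm)]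
    rfl

/-- Serves both kinds of action on arbitrary elements: e = 0 for `elemTransf`, and a nonzero e for
the logarithm, where δ contributes to the new potential. -/
theorem joint_of_triangular {I : Set ℝ} (hI : IsOpen I) {T : ℝ → ℝ} (hT : ContDiffOn ℝ ∞ T I)
    (h0 : ∀ t ∈ I, deriv T t ≠ 0) {W : Set (Var n)} (hW : IsOpen W) (hWI : ∀ p ∈ W, p.1 ∈ I)
    {φ : Var n → Var n} {Λ : Var n → (Fin 2 → ℂ) → (Fin 2 → ℂ)} (hφ : IsPointTransf W φ)
    {a b d e f : Var n → ℂ} (ha : ContDiffOn ℝ ∞ a W) (hb : ContDiffOn ℝ ∞ b W)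
    (hd : ContDiffOn ℝ ∞ d W) (he : ContDiffOn ℝ ∞ e W) (hf : ContDiffOn ℝ ∞ f W)
    (ha0 : ∀ p ∈ W, a p ≠ 0) (hb0 : ∀ p ∈ W, b p ≠ 0)
    (hΛ : ∀ p ∈ W, ∀ v, Λ p v = ![a p * hat (deriv T p.1) (v 0) + d p,
      b p * hat (deriv T p.1) (v 1) + e p * hat (deriv T p.1) (v 0) + f p]) :
    IsPointTransf (W ×ˢ (Set.univ : Set (Fin 2 → ℂ)))
      (fun q : Var n × (Fin 2 → ℂ) => (φ q.1, Λ q.1 q.2)) ∧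
    ∀ p ∈ W, Function.Surjective (Λ p) := by
  have hL : ∀ p ∈ W, ∃ L : (Fin 2 → ℂ) →ₗ[ℝ] (Fin 2 → ℂ), Function.Injective L ∧
      ∀ v, Λ p v = L v + Λ p 0 := by
    intro p hp
    let L : (Fin 2 → ℂ) →ₗ[ℝ] (Fin 2 → ℂ) :=
      { toFun := fun v => ![a p * hatL (deriv T p.1) (v 0),
          b p * hatL (deriv T p.1) (v 1) + e p * hatL (deriv T p.1) (v 0)]
        map_add' := fun v w => by
          ext i
          fin_cases i
          · simp; ring
          · simp; ring
        map_smul' := fun s v => by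
          ext i
          fin_cases i
          · change a p * hatL (deriv T p.1) (s • v 0) = s • (a p * hatL (deriv T p.1) (v 0))
            rw [map_smul, mul_smul_comm]
          · change b p * hatL (deriv T p.1) (s • v 1) + e p * hatL (deriv T p.1) (s • v 0)
              = s • (b p * hatL (deriv T p.1) (v 1) + e p * hatL (deriv T p.1) (v 0))
            rw [map_smul, map_smul, mul_smul_comm, mul_smul_comm, smul_add] }
    have hLv : ∀ v, L v = ![a p * hat (deriv T p.1) (v 0),
          b p * hat (deriv T p.1) (v 1) + e p * hat (deriv T p.1) (v 0)] := fun v => by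
      rw [← hatL_apply, ← hatL_apply]; rfl
    refine ⟨L, ?_, fun v => ?_⟩
    · rw [← LinearMap.ker_eq_bot, LinearMap.ker_eq_bot']
      intro v hv
      rw [hLv] at hv
      have h1 : a p * hat (deriv T p.1) (v 0) = 0 := congrFun hv 0
      have h2 : b p * hat (deriv T p.1) (v 1) + e p * hat (deriv T p.1) (v 0) = 0 := congrFun hv 1
      have h3 := (mul_eq_zero.1 h1).resolve_left (ha0 p hp)
      rw [h3, mul_zero, add_zero] at h2
      have h4 := (mul_eq_zero.1 h2).resolve_left (hb0 p hp)
      ext i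
      fin_cases i
      · exact hat_eq_zero.1 h3
      · exact hat_eq_zero.1 h4
    · rw [hLv, hΛ p hp, hΛ p hp]
      have hz : hat (deriv T p.1) 0 = 0 := hat_eq_zero.2 rfl
      ext i
      fin_cases i <;> simp [hz]
  refine ⟨isPointTransf_joint hW hφ ?_ hL, fun p hp w => ?_⟩
  · have hh : ∀ i, ContDiffOn ℝ ∞ (fun q : Var n × (Fin 2 → ℂ) => hat (deriv T q.1.1) (q.2 i))
        (W ×ˢ Set.univ) := fun i =>
      contDiffOn_hat hI hT h0 (contDiff_fst.comp contDiff_fst).contDiffOn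
        ((contDiff_apply ℝ ℂ i).comp contDiff_snd).contDiffOn fun q hq => hWI _ hq.1
    rw [contDiffOn_pi]
    intro i
    fin_cases i
    · exact (((ContDiffOn.comp_fst ha _).mul (hh 0)).add (ContDiffOn.comp_fst hd _)).congr
        fun q hq => by rw [hΛ q.1 hq.1]; rfl
    · exact ((((ContDiffOn.comp_fst hb _).mul (hh 1)).add ((ContDiffOn.comp_fst he _).mul
        (hh 0))).add (ContDiffOn.comp_fst hf _)).congr fun q hq => by rw [hΛ q.1 hq.1]; rfl
  · obtain ⟨L, hLi, hL⟩ := hL p hp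
    obtain ⟨v, hv⟩ := LinearMap.injective_iff_surjective.1 hLi (w - Λ p 0)
    exact ⟨v, by rw [hL, hv, sub_add_cancel]⟩

/-! ### The relation between nonlinearities and its rigidity. -/

/-- A point transformation of the form `varTransf` that relates the equations with the arbitrary
elements `(f, V)` and `(f', V')`. -/
structure ModularMap (I : Set ℝ) (D : Set (Space n)) (A : Set ℂ) (φ : Var n → Var n) (T : ℝ → ℝ)
    (O : Space n ≃ₗᵢ[ℝ] Space n) (X : ℝ → Space n) (Sig Z : ℝ → ℝ) (f f' : ℝ → ℂ)
    (V V' : ℝ × Space n → ℂ) : Prop where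
  param : IsParam I T X Sig Z
  transf : IsVarTransf (I ×ˢ D ×ˢ A) φ
  eq : ∀ p ∈ I ×ˢ D ×ˢ A, φ p = varTransf T O X Sig Z p
  smooth : ContDiffOn ℝ ∞ f (rhoRange (I ×ˢ D ×ˢ A))
  smooth' : ContDiffOn ℝ ∞ f' (rhoRange (φ '' (I ×ˢ D ×ˢ A)))
  ne' : ∀ ρ ∈ rhoRange (φ '' (I ×ˢ D ×ˢ A)), deriv f' ρ ≠ 0
  rel : ∀ q ∈ I ×ˢ D, ∀ ρ ∈ rhoRange (I ×ˢ D ×ˢ A),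
    f' (Real.exp (Z q.1) * ρ) + V' (baseMap T O X q)
      = hat (deriv T q.1) (f ρ) / ((|deriv T q.1| : ℝ) : ℂ)
        + hat (deriv T q.1) (V q) / ((|deriv T q.1| : ℝ) : ℂ) + potShift T O X Sig Z q

theorem mem_rhoRange_prod {I : Set ℝ} {D : Set (Space n)} {A : Set ℂ} (hI : I.Nonempty)
    (hD : D.Nonempty) {ρ : ℝ} : ρ ∈ rhoRange (I ×ˢ D ×ˢ A) ↔ ∃ z ∈ A, ‖z‖ = ρ := by
  constructor
  · rintro ⟨p, hp, rfl⟩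
    exact ⟨p.2.2, hp.2.2, rfl⟩
  · rintro ⟨z, hz, rfl⟩
    obtain ⟨t, ht⟩ := hI
    obtain ⟨x, hx⟩ := hD
    exact ⟨(t, x, z), ⟨ht, hx, hz⟩, rfl⟩

section

variable {I : Set ℝ} {D : Set (Space n)} {A : Set ℂ} {φ : Var n → Var n} {T : ℝ → ℝ}
  {O : Space n ≃ₗᵢ[ℝ] Space n} {X : ℝ → Space n} {Sig Z : ℝ → ℝ} {f f' : ℝ → ℂ}
  {V V' : ℝ × Space n → ℂ}

theorem mem_rhoRange_image (hφ : ∀ p ∈ I ×ˢ D ×ˢ A, φ p = varTransf T O X Sig Z p) {σ : ℝ} :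
    σ ∈ rhoRange (φ '' (I ×ˢ D ×ˢ A)) ↔
      ∃ t ∈ I, ∃ ρ ∈ rhoRange (I ×ˢ D ×ˢ A), σ = Real.exp (Z t) * ρ := by
  constructor
  · rintro ⟨_, ⟨p, hp, rfl⟩, rfl⟩
    exact ⟨p.1, hp.1, _, ⟨p, hp, rfl⟩, by simp only; rw [hφ p hp, norm_varTransf]⟩
  · rintro ⟨t, ht, _, ⟨p, hp, rfl⟩, rfl⟩
    have hp' : (t, p.2.1, p.2.2) ∈ I ×ˢ D ×ˢ A := ⟨ht, hp.2⟩
    exact ⟨_, ⟨_, hp', rfl⟩, by simp only; rw [hφ _ hp', norm_varTransf]⟩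

theorem mapsEquation_iff_rel (hn : 1 ≤ n) (hI : IsOpen I) (hI' : IsConnected I) (hD : IsOpen D)
    (hA : IsOpen A) (hA0 : (0 : ℂ) ∉ A) (hP : IsParam I T X Sig Z)
    (hφ : ∀ p ∈ I ×ˢ D ×ˢ A, φ p = varTransf T O X Sig Z p) {S S' : Var n → ℂ} :
    MapsEquation (I ×ˢ D ×ˢ A) φ S S' ↔ ∀ p ∈ I ×ˢ D ×ˢ A,
      S' (φ p) = hat (deriv T p.1) (S p) / ((|deriv T p.1| : ℝ) : ℂ)
        + potShift T O X Sig Z (base p) := by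
  have hW := hI.prod (hD.prod hA)
  have h1 : MapsEquation (I ×ˢ D ×ˢ A) φ S S'
      ↔ MapsEquation (I ×ˢ D ×ˢ A) (varTransf T O X Sig Z) S S' :=
    ⟨fun h => h.congr hW fun p hp => (hφ p hp).symm, fun h => h.congr hW hφ⟩
  rw [h1, mapsEquation_varTransf_iff hn O hI hI' hP hD hA hA0]
  exact forall₂_congr fun p hp => by rw [hφ p hp]

theorem modularMap_of_maps (hn : 1 ≤ n) (hI : IsOpen I) (hI' : IsConnected I) (hD : IsOpen D)
    (hD' : IsConnected D) (hA : IsOpen A) (hA0 : (0 : ℂ) ∉ A)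
    (hP : IsParam I T X Sig Z) (hφ : IsVarTransf (I ×ˢ D ×ˢ A) φ)
    (hφe : ∀ p ∈ I ×ˢ D ×ˢ A, φ p = varTransf T O X Sig Z p) {S S' : Var n → ℂ}
    (h : MapsEquation (I ×ˢ D ×ˢ A) φ S S')
    (hS : ∀ p ∈ I ×ˢ D ×ˢ A, S p = f ‖p.2.2‖ + V (base p))
    (hS' : ∀ p ∈ I ×ˢ D ×ˢ A, S' (φ p) = f' ‖(φ p).2.2‖ + V' (base (φ p)))
    (hf : IsNonlinearity (I ×ˢ D ×ˢ A) f) (hf' : IsNonlinearity (φ '' (I ×ˢ D ×ˢ A)) f') :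
    ModularMap I D A φ T O X Sig Z f f' V V' := by
  refine ⟨hP, hφ, hφe, hf.1, hf'.1, hf'.2, ?_⟩
  rintro ⟨t, x⟩ hq ρ hρ
  obtain ⟨z, hz, rfl⟩ := (mem_rhoRange_prod hI'.nonempty hD'.nonempty).1 hρ
  have hp : ((t, x, z) : Var n) ∈ I ×ˢ D ×ˢ A := ⟨hq.1, hq.2, hz⟩
  have h1 := (mapsEquation_iff_rel hn hI hI' hD hA hA0 hP hφe).1 h _ hp
  rw [hS _ hp, hS' _ hp, hφe _ hp, norm_varTransf, base_varTransf, hat_add, add_div] at h1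
  exact h1

theorem exists_modularMap (hn : 1 ≤ n) (hI : IsOpen I) (hI' : IsConnected I) (hD : IsOpen D)
    (hD' : IsConnected D) (hA : IsOpen A) (hA' : IsConnected A) (hA0 : (0 : ℂ) ∉ A)
    (hφ : IsVarTransf (I ×ˢ D ×ˢ A) φ) {S S' : Var n → ℂ}
    (h : MapsEquation (I ×ˢ D ×ˢ A) φ S S')
    (hS : ∀ p ∈ I ×ˢ D ×ˢ A, S p = f ‖p.2.2‖ + V (base p))
    (hS' : ∀ p ∈ I ×ˢ D ×ˢ A, S' (φ p) = f' ‖(φ p).2.2‖ + V' (base (φ p)))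
    (hf : IsNonlinearity (I ×ˢ D ×ˢ A) f) (hf' : IsNonlinearity (φ '' (I ×ˢ D ×ˢ A)) f') :
    ∃ T O X Sig Z, ModularMap I D A φ T O X Sig Z f f' V V' := by
  have hW := isEqDomain_prod hI hI' hD hD' hA hA' hA0
  have hmem : ∀ z ∈ A, ‖z‖ ∈ rhoRange (I ×ˢ D ×ˢ A) := fun z hz =>
    (mem_rhoRange_prod hI'.nonempty hD'.nonempty).2 ⟨z, hz, rfl⟩
  obtain ⟨T, O, X, Sig, Z, hP, hφe⟩ := exists_varTransf hn hI hI' hD hD' hA hA' hA0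
    hφ.pointTransf h hS hS' (fun z hz => (hf.1.contDiffAt
      (hW.isOpen_rhoRange.mem_nhds (hmem z hz))).differentiableAt (by simp))
    (fun z hz => hf.2 _ (hmem z hz))
  exact ⟨T, O, X, Sig, Z,
    modularMap_of_maps hn hI hI' hD hD' hA hA0 hP hφ hφe h hS hS' hf hf'⟩

/-- At a fixed point (t, x) all other terms of the relation are constants, so f is a rescaling of f'
with the factor |T_t| and the scale e^Z. The relation is solved for f because for each fixed t the
scaled range of ρ lies in that of the target. -/
theorem ModularMap.ratio_rel (h : ModularMap I D A φ T O X Sig Z f f' V V')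
    (hW : IsEqDomain (I ×ˢ D ×ˢ A)) {t : ℝ} (ht : t ∈ I) {ρ : ℝ}
    (hρ : ρ ∈ rhoRange (I ×ˢ D ×ˢ A)) :
    deriv f ρ = Real.exp (Z t) * (|deriv T t| : ℝ) * hat (deriv T t) (deriv f' (Real.exp (Z t) * ρ))
      ∧ ratio f ρ = hat (deriv T t) (ratio f' (Real.exp (Z t) * ρ)) := by
  obtain ⟨p, hp⟩ := hW.2.1.nonempty
  have hτ : ((|deriv T t| : ℝ) : ℂ) ≠ 0 :=
    Complex.ofReal_ne_zero.2 (abs_ne_zero.2 (h.param.deriv_ne t ht))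
  have h1 := rescale (h.transf.isEqDomain hW).isOpen_rhoRange hW.isOpen_rhoRange
    (f := f') (f' := f) (a := ((|deriv T t| : ℝ) : ℂ)) (k := Real.exp (Z t)) (τ := deriv T t)
    (c := -hat (deriv T t) (((|deriv T t| : ℝ) : ℂ) * (hat (deriv T t) (V (t, p.2.1))
      / ((|deriv T t| : ℝ) : ℂ) + potShift T O X Sig Z (t, p.2.1)
        - V' (baseMap T O X (t, p.2.1)))))
    hτ (Real.exp_ne_zero _)
    (fun σ hσ => (mem_rhoRange_image h.eq).2 ⟨t, ht, σ, hσ, rfl⟩)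
    (fun σ hσ => by
      have h2 := h.rel (t, p.2.1) ⟨ht, hp.2.1⟩ σ hσ
      have h3 : f' (Real.exp (Z t) * σ) = hat (deriv T t) (f σ) / ((|deriv T t| : ℝ) : ℂ)
        + (hat (deriv T t) (V (t, p.2.1)) / ((|deriv T t| : ℝ) : ℂ)
          + potShift T O X Sig Z (t, p.2.1) - V' (baseMap T O X (t, p.2.1))) := by
        linear_combination h2
      generalize hat (deriv T t) (V (t, p.2.1)) / ((|deriv T t| : ℝ) : ℂ)
          + potShift T O X Sig Z (t, p.2.1) - V' (baseMap T O X (t, p.2.1)) = c at h3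
      have h4 : hat (deriv T t) (f σ)
          = ((|deriv T t| : ℝ) : ℂ) * (f' (Real.exp (Z t) * σ) - c) := by
        rw [h3]; field_simp; ring
      have h5 := congrArg (hat (deriv T t)) h4
      rw [hat_hat, hat_mul, hat_sub, hat_ofReal] at h5
      rw [h5, hat_mul, hat_ofReal]
      ring) h.smooth'
  exact h1.2 ρ hρ

/-- The derivative in `t` of the relation between the nonlinearities. -/
theorem ModularMap.deriv_rel (h : ModularMap I D A φ T O X Sig Z f f' V V') (hI : IsOpen I)
    (hI' : IsConnected I) (hW : IsEqDomain (I ×ˢ D ×ˢ A)) {t : ℝ} (ht : t ∈ I) {ρ : ℝ}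
    (hρ : ρ ∈ rhoRange (I ×ˢ D ×ˢ A)) :
    ((deriv (deriv T) t / deriv T t : ℝ) : ℂ)
      + deriv Z t * (1 + ratio f' (Real.exp (Z t) * ρ)) = 0 := by
  have hR' := (h.transf.isEqDomain hW).isOpen_rhoRange
  have hmem := (mem_rhoRange_image h.eq).2 ⟨t, ht, ρ, hρ, rfl⟩
  have hτ := h.param.deriv_ne t ht
  -- Since f_ρ does not depend on t, neither does e^Z |T_t| f'_ρ(e^Z ρ). The sign and the
  -- conjugation are locally constant, so |T_t| may be replaced by T_t. Differentiating this
  -- constant gives the claim.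
  have hc : (fun s => ((Real.exp (Z s) * deriv T s * ρ : ℝ) : ℂ)
      * deriv f' (Real.exp (Z s) * ρ)) =ᶠ[𝓝 t]
      fun _ => ((Real.exp (Z t) * deriv T t * ρ : ℝ) : ℂ) * deriv f' (Real.exp (Z t) * ρ) := by
    have hcd : ContinuousAt (deriv T) t :=
      ((contDiffOn_deriv hI h.param.smooth_T).contDiffAt (hI.mem_nhds ht)).continuousAt
    have hsg : ∀ᶠ s in 𝓝 t, Real.sign (deriv T s) = Real.sign (deriv T t) := by
      rcases lt_or_gt_of_ne hτ with h0 | h0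
      · filter_upwards [hcd.eventually (eventually_lt_nhds h0)] with s hs
        rw [Real.sign_of_neg hs, Real.sign_of_neg h0]
      · filter_upwards [hcd.eventually (eventually_gt_nhds h0)] with s hs
        rw [Real.sign_of_pos hs, Real.sign_of_pos h0]
    filter_upwards [hI.mem_nhds ht, hsg] with s hs hsg
    have h1 := (h.ratio_rel hW hs hρ).1
    rw [(h.ratio_rel hW ht hρ).1, hat_deriv_eq hI hI' h.param.smooth_T h.param.deriv_ne ht hs] at h1
    have h2 := congrArg (hat (deriv T s)) h1
    simp only [hat_mul, hat_ofReal, hat_hat] at h2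
    have h3 : ∀ τ : ℝ, ((τ : ℝ) : ℂ) = Real.sign τ * ((|τ| : ℝ) : ℂ) := fun τ => by
      have : τ = Real.sign τ * |τ| := by
        rcases lt_trichotomy τ 0 with h | rfl | h
        · rw [Real.sign_of_neg h, abs_of_neg h]; ring
        · simp
        · rw [Real.sign_of_pos h, abs_of_pos h]; ring
      exact_mod_cast this
    simp only [Complex.ofReal_mul]
    rw [h3 (deriv T s), h3 (deriv T t), hsg]
    linear_combination (-(Real.sign (deriv T t) : ℂ) * ρ) * h2
  have hZd := hasDerivAt_of_contDiffOn hI h.param.smooth_Z ht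
  have hTd := hasDerivAt_of_contDiffOn hI (contDiffOn_deriv hI h.param.smooth_T) ht
  have hF := hasDerivAt_of_contDiffOn hR' (contDiffOn_deriv hR' h.smooth') hmem
  have h1 := (((hZd.exp.mul hTd).mul_const ρ).ofReal_comp).mul (hF.scomp t (hZd.exp.mul_const ρ))
  have h2 := hc.deriv_eq
  rw [deriv_const] at h2
  have h3 := h1.deriv.symm.trans h2
  have hne := h.ne' _ hmem
  have hτ' : ((deriv T t : ℝ) : ℂ) ≠ 0 := Complex.ofReal_ne_zero.2 hτ
  have hρ0 : (ρ : ℂ) ≠ 0 := Complex.ofReal_ne_zero.2 (hW.pos hρ).ne'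
  have he : ((Real.exp (Z t) : ℝ) : ℂ) ≠ 0 := Complex.ofReal_ne_zero.2 (Real.exp_ne_zero _)
  rw [ratio]
  simp only [Complex.real_smul, Function.comp_apply, Pi.mul_apply] at h3
  push_cast at h3 he ⊢
  field_simp
  have h4 : Complex.exp (Z t) * (ρ : ℂ) ≠ 0 := mul_ne_zero he hρ0
  refine mul_left_cancel₀ h4 ?_
  linear_combination h3

/-- If Z_t ≠ 0 at a single t, then `deriv_rel` solved for the ratio gives a real number independent
of ρ. Conjugation fixes it, so the ratio of f would be a real constant. -/
theorem ModularMap.rigid (h : ModularMap I D A φ T O X Sig Z f f' V V') (hI : IsOpen I)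
    (hI' : IsConnected I) (hW : IsEqDomain (I ×ˢ D ×ˢ A))
    (hf : ¬ ∃ r : ℝ, ∀ ρ ∈ rhoRange (I ×ˢ D ×ˢ A), ratio f ρ = r) :
    ∀ t ∈ I, deriv Z t = 0 ∧ deriv (deriv T) t = 0 := by
  intro t ht
  have hZ : deriv Z t = 0 := by
    by_contra hZ
    refine hf ⟨-1 - deriv (deriv T) t / deriv T t / deriv Z t, fun ρ hρ => ?_⟩
    have h1 := h.deriv_rel hI hI' hW ht hρ
    have hZ' : ((deriv Z t : ℝ) : ℂ) ≠ 0 := Complex.ofReal_ne_zero.2 hZ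
    have h2 : ratio f' (Real.exp (Z t) * ρ)
        = ((-1 - deriv (deriv T) t / deriv T t / deriv Z t : ℝ) : ℂ) := by
      have h3 : ((-1 - deriv (deriv T) t / deriv T t / deriv Z t : ℝ) : ℂ)
          = -1 - ((deriv (deriv T) t / deriv T t : ℝ) : ℂ) / deriv Z t := by push_cast; ring
      rw [h3]
      generalize ((deriv (deriv T) t / deriv T t : ℝ) : ℂ) = c at *
      field_simp
      linear_combination h1
    rw [(h.ratio_rel hW ht hρ).2, h2, hat_ofReal]
  refine ⟨hZ, ?_⟩
  obtain ⟨ρ, hρ⟩ := hW.isConnected_rhoRange.nonempty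
  have h1 := h.deriv_rel hI hI' hW ht hρ
  rw [hZ] at h1
  have h2 : deriv (deriv T) t / deriv T t = 0 := by simpa using h1
  exact (div_eq_zero_iff.1 h2).resolve_right (h.param.deriv_ne t ht)

/-- If `T_tt = 0` and `Z` is constant, then the arbitrary elements are transformed by
`elemTransf`. -/
theorem ModularMap.exists_const {Z : ℝ}
    (h : ModularMap I D A φ T O X Sig (fun _ => Z) f f' V V') (hI : IsOpen I)
    (hI' : IsConnected I) (hW : IsEqDomain (I ×ˢ D ×ˢ A))
    (h2 : ∀ t ∈ I, deriv (deriv T) t = 0) :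
    ∃ c, ∀ p ∈ I ×ˢ D ×ˢ A, ![f' ‖(φ p).2.2‖, V' (base (φ p))]
      = elemTransf T O X Sig c p ![f ‖p.2.2‖, V (base p)] := by
  obtain ⟨p₀, hp₀⟩ := hW.2.1.nonempty
  have hT : ∀ t ∈ I, deriv T t = deriv T p₀.1 := fun t ht =>
    hI.is_const_of_deriv_eq_zero hI'.isPreconnected
      (fun s hs => (hasDerivAt_of_contDiffOn hI (contDiffOn_deriv hI h.param.smooth_T)
        hs).differentiableAt.differentiableWithinAt) h2 ht hp₀.1
  have hrel : ∀ p ∈ I ×ˢ D ×ˢ A, ∀ p' ∈ I ×ˢ D ×ˢ A, _ := fun p hp p' hp' =>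
    h.rel (base p) ⟨hp.1, hp.2.1⟩ ‖p'.2.2‖ ⟨p', hp', rfl⟩
  -- The relations for ρ and for the reference value of ρ over the same (t, x) are subtracted: the
  -- potentials drop out, and the change of f is one constant everywhere.
  refine ⟨f' (Real.exp Z * ‖p₀.2.2‖) - hat (deriv T p₀.1) (f ‖p₀.2.2‖)
    / ((|deriv T p₀.1| : ℝ) : ℂ), fun p hp => ?_⟩
  rw [h.eq p hp, norm_varTransf, base_varTransf]
  have h3 := hrel p hp p hp
  have h4 := hrel p hp p₀ hp₀
  rw [potShift_eq O hI h.param h2 (q := base p) hp.1] at h3 h4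
  simp only [base, hT p.1 hp.1] at h3 h4
  simp only [elemTransf, base, hT p.1 hp.1, Matrix.cons_val_zero, Matrix.cons_val_one]
  ext i
  fin_cases i
  · simp only [Fin.zero_eta, Matrix.cons_val_zero]
    linear_combination h3 - h4
  · simp only [Fin.mk_one, Matrix.cons_val_one, Matrix.cons_val_zero]
    linear_combination h4

end

/-! ### Equivalence transformations of classes given by conditions on the ratio. -/

section

variable {I : Set ℝ} {D : Set (Space n)} {A : Set ℂ} {φ : Var n → Var n} {T : ℝ → ℝ}
  {O : Space n ≃ₗᵢ[ℝ] Space n} {X : ℝ → Space n} {Sig : ℝ → ℝ}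

theorem elemTransf_injective {c : ℂ} {p : Var n} (h : deriv T p.1 ≠ 0) :
    Function.Injective (elemTransf T O X Sig c p) := by
  intro v w hvw
  have hτ : ((|deriv T p.1| : ℝ) : ℂ) ≠ 0 := Complex.ofReal_ne_zero.2 (abs_ne_zero.2 h)
  have h0 : hat (deriv T p.1) (v 0) / ((|deriv T p.1| : ℝ) : ℂ) + c
      = hat (deriv T p.1) (w 0) / ((|deriv T p.1| : ℝ) : ℂ) + c := congrFun hvw 0
  have h1 := congrFun hvw 1
  simp only [elemTransf, Matrix.cons_val_one, Matrix.cons_val_zero, sub_left_inj,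
    add_left_inj] at h0 h1
  have h2 := congrArg (hat (deriv T p.1)) ((div_left_inj' hτ).1 h0)
  have h3 := congrArg (hat (deriv T p.1)) ((div_left_inj' hτ).1 h1)
  rw [hat_hat, hat_hat] at h2 h3
  ext i
  fin_cases i
  · exact h2
  · exact h3

theorem elemTransf_sum (hI : IsOpen I) {Z : ℝ} (hP : IsParam I T X Sig fun _ => Z)
    (h2 : ∀ t ∈ I, deriv (deriv T) t = 0) {p : Var n} (hp : p.1 ∈ I) (c : ℂ) (v : Fin 2 → ℂ) :
    elemTransf T O X Sig c p v 0 + elemTransf T O X Sig c p v 1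
      = hat (deriv T p.1) (v 0 + v 1) / ((|deriv T p.1| : ℝ) : ℂ)
        + potShift T O X Sig (fun _ => Z) (base p) := by
  rw [potShift_eq O hI hP h2 (q := base p) hp]
  simp only [elemTransf, base, Matrix.cons_val_zero, Matrix.cons_val_one, hat_add]
  ring

theorem deriv_eq_of_deriv_deriv (hI : IsOpen I) (hI' : IsConnected I) (hT : ContDiffOn ℝ ∞ T I)
    (h2 : ∀ t ∈ I, deriv (deriv T) t = 0) {t t' : ℝ} (ht : t ∈ I) (ht' : t' ∈ I) :
    deriv T t = deriv T t' :=
  hI.is_const_of_deriv_eq_zero hI'.isPreconnected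
    (fun _ hs => (hasDerivAt_of_contDiffOn hI (contDiffOn_deriv hI hT)
      hs).differentiableAt.differentiableWithinAt) h2 ht ht'

/-- The transformations from the equivalence group of the class `𝒱` are equivalence transformations
of its subclasses that are singled out by conditions on `ρ f_ρρ / f_ρ`. -/
theorem isEquivTransf_modularClass (hn : 1 ≤ n) (hI : IsOpen I) (hI' : IsConnected I)
    (hD : IsOpen D) (hD' : IsConnected D) (hA : IsOpen A) (hA' : IsConnected A)
    (hA0 : (0 : ℂ) ∉ A) {Z : ℝ} (hP : IsParam I T X Sig fun _ => Z)
    (h2 : ∀ t ∈ I, deriv (deriv T) t = 0)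
    (hφ : ∀ p ∈ I ×ˢ D ×ˢ A, φ p = varTransf T O X Sig (fun _ => Z) p) {c : ℂ}
    {Λ : Var n → (Fin 2 → ℂ) → (Fin 2 → ℂ)}
    (hΛ : ∀ p ∈ I ×ˢ D ×ˢ A, ∀ v, Λ p v = elemTransf T O X Sig c p v)
    {P : Set (Var n) → (ℝ → ℂ) → Prop}
    (hPP : ∀ (f f' : ℝ → ℂ) (τ : ℝ), (∀ ρ ∈ rhoRange (I ×ˢ D ×ˢ A),
      ratio f' (Real.exp Z * ρ) = hat τ (ratio f ρ)) →
      (P (I ×ˢ D ×ˢ A) f ↔ P (φ '' (I ×ˢ D ×ˢ A)) f')) :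
    (modularClass n P).IsEquivTransf (I ×ˢ D ×ˢ A) φ Λ := by
  have hW := isEqDomain_prod hI hI' hD hD' hA hA' hA0
  have htr : IsVarTransf (I ×ˢ D ×ˢ A) φ :=
    (isVarTransf_varTransf O hI hI' hP hA0).congr hW.1 hφ
  have hW' := htr.isEqDomain hW
  obtain ⟨p₀, hp₀⟩ := hW.2.1.nonempty
  set τ := deriv T p₀.1 with hτdef
  have hT : ∀ t ∈ I, deriv T t = τ := fun t ht =>
    deriv_eq_of_deriv_deriv hI hI' hP.smooth_T h2 ht hp₀.1
  have hτ0 : τ ≠ 0 := hP.deriv_ne _ hp₀.1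
  have hτ : ((|τ| : ℝ) : ℂ) ≠ 0 := Complex.ofReal_ne_zero.2 (abs_ne_zero.2 hτ0)
  have hpot := contDiffOn_potShift O hI hP hD
  have hrel : ∀ (f f' : ℝ → ℂ) (V V' : ℝ × Space n → ℂ),
      (∀ ρ ∈ rhoRange (I ×ˢ D ×ˢ A), f' (Real.exp Z * ρ) = hat τ (f ρ) / ((|τ| : ℝ) : ℂ) + c) →
      (∀ q ∈ I ×ˢ D, V' (baseMap T O X q) = hat (deriv T q.1) (V q) / ((|deriv T q.1| : ℝ) : ℂ)
        + (potShift T O X Sig (fun _ => Z) q - c)) →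
      ∀ p ∈ I ×ˢ D ×ˢ A, ![f' ‖(φ p).2.2‖, V' (base (φ p))]
        = elemTransf T O X Sig c p ![f ‖p.2.2‖, V (base p)] := by
    intro f f' V V' hf hV p hp
    rw [hφ p hp, norm_varTransf, base_varTransf, hf _ ⟨p, hp, rfl⟩, hV _ ⟨hp.1, hp.2.1⟩,
      potShift_eq O hI hP h2 (q := base p) hp.1]
    simp only [elemTransf, base, Matrix.cons_val_zero, Matrix.cons_val_one, hT p.1 hp.1,
      add_sub_assoc]
  have hmem : ∀ ρ ∈ rhoRange (I ×ˢ D ×ˢ A),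
      Real.exp Z * ρ ∈ rhoRange (φ '' (I ×ˢ D ×ˢ A)) := fun ρ hρ =>
    (mem_rhoRange_image hφ).2 ⟨p₀.1, hp₀.1, ρ, hρ, rfl⟩
  have hmem' : ∀ σ ∈ rhoRange (φ '' (I ×ˢ D ×ˢ A)),
      Real.exp (-Z) * σ ∈ rhoRange (I ×ˢ D ×ˢ A) := fun σ hσ => by
    obtain ⟨t, _, ρ, hρ, rfl⟩ := (mem_rhoRange_image hφ).1 hσ
    rwa [← mul_assoc, ← Real.exp_add, neg_add_cancel, Real.exp_zero, one_mul]
  have hjs := joint_of_triangular hI hP.smooth_T hP.deriv_ne hW.1 (fun p hp => hp.1)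
    (Λ := Λ) htr.pointTransf (a := fun _ => ((|τ| : ℝ) : ℂ)⁻¹) (b := fun _ => ((|τ| : ℝ) : ℂ)⁻¹)
    (d := fun _ => c) (e := fun _ => 0)
    (f := fun p => potShift T O X Sig (fun _ => Z) (base p) - c) contDiffOn_const contDiffOn_const
    contDiffOn_const contDiffOn_const
    ((hpot.comp (baseL n).contDiff.contDiffOn fun p hp => ⟨hp.1, hp.2.1⟩).sub contDiffOn_const)
    (fun _ _ => inv_ne_zero hτ) (fun _ _ => inv_ne_zero hτ) (fun p hp v => by
      rw [hΛ p hp, potShift_eq O hI hP h2 (q := base p) hp.1]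
      simp only [elemTransf, base, hT p.1 hp.1, div_eq_inv_mul, zero_mul, add_zero, add_sub_assoc])
  refine ⟨htr, hjs.1, hjs.2, ?_, ?_⟩
  · intro θ θ' hθ
    constructor
    · rintro ⟨f, V, hf, hPf, hV, hθf⟩
      obtain ⟨V', hV', hVrel⟩ := exists_potential_push hI hI' hP hD hA'.nonempty hφ hV
        (hpot.sub (contDiffOn_const (c := c)))
      have hre := rescale hW.isOpen_rhoRange hW'.isOpen_rhoRange (f := f)
        (f' := fun σ => ((|τ| : ℝ) : ℂ)⁻¹ * hat τ (f (Real.exp (-Z) * σ)) + c)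
        (inv_ne_zero hτ) (Real.exp_ne_zero (-Z)) hmem' (fun σ _ => rfl) hf.1
      have hcancel : ∀ ρ, Real.exp (-Z) * (Real.exp Z * ρ) = ρ := fun ρ => by
        rw [← mul_assoc, ← Real.exp_add, neg_add_cancel, Real.exp_zero, one_mul]
      refine ⟨_, V', ⟨hre.1, fun σ hσ => ?_⟩, (hPP f _ τ fun ρ hρ => ?_).1 hPf, hV', ?_⟩
      · rw [(hre.2 σ hσ).1]
        refine mul_ne_zero (mul_ne_zero (Complex.ofReal_ne_zero.2 (Real.exp_ne_zero _))
          (inv_ne_zero hτ)) fun h => hf.2 _ (hmem' σ hσ) (hat_eq_zero.1 h)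
      · rw [(hre.2 _ (hmem ρ hρ)).2, hcancel]
      · rintro _ ⟨p, hp, rfl⟩
        rw [hθ p hp, hΛ p hp, hθf p hp]
        refine (hrel f (fun σ => ((|τ| : ℝ) : ℂ)⁻¹ * hat τ (f (Real.exp (-Z) * σ)) + c) V V'
          (fun ρ _ => ?_) hVrel p hp).symm
        simp only [hcancel, div_eq_inv_mul]
    · rintro ⟨f', V', hf, hPf, hV', hθf⟩
      obtain ⟨V, hV, hVrel⟩ := exists_potential_pull hI hI' hP hD hA'.nonempty hφ hV'
        (hpot.sub (contDiffOn_const (c := c)))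
      have hre := rescale hW'.isOpen_rhoRange hW.isOpen_rhoRange (f := f')
        (f' := fun σ => ((|τ| : ℝ) : ℂ) * hat τ (f' (Real.exp Z * σ)) + -((|τ| : ℝ) : ℂ) * hat τ c)
        hτ (Real.exp_ne_zero Z) hmem (fun σ _ => rfl) hf.1
      refine ⟨_, V, ⟨hre.1, fun σ hσ => ?_⟩, (hPP _ f' τ fun ρ hρ => ?_).2 hPf, hV, ?_⟩
      · rw [(hre.2 σ hσ).1]
        refine mul_ne_zero (mul_ne_zero (Complex.ofReal_ne_zero.2 (Real.exp_ne_zero _)) hτ)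
          fun h => hf.2 _ (hmem σ hσ) (hat_eq_zero.1 h)
      · rw [(hre.2 _ hρ).2, hat_hat]
      -- The pulled-back pair is identified with θ through its image, as `elemTransf` is injective
      -- at each point.
      · intro p hp
        refine elemTransf_injective (T := T) (O := O) (X := X) (Sig := Sig) (c := c)
          (hP.deriv_ne _ hp.1) ?_
        rw [← hΛ p hp, ← hθ p hp, hθf _ ⟨p, hp, rfl⟩]
        refine hrel (fun σ => ((|τ| : ℝ) : ℂ) * hat τ (f' (Real.exp Z * σ))
          + -((|τ| : ℝ) : ℂ) * hat τ c) f' V V' (fun ρ _ => ?_) hVrel p hp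
        simp only [hat_add, hat_mul, hat_hat, hat_ofReal]
        have h3 : hat τ (-((|τ| : ℝ) : ℂ)) = -((|τ| : ℝ) : ℂ) := by
          rw [← Complex.ofReal_neg, hat_ofReal]
        rw [h3]
        field_simp
        ring
  · intro θ θ' hθ _
    rw [mapsEquation_iff_rel hn hI hI' hD hA hA0 hP hφ]
    intro p hp
    change θ' (φ p) 0 + θ' (φ p) 1 = hat (deriv T p.1) (θ p 0 + θ p 1) / _ + _
    rw [hθ p hp, hΛ p hp, elemTransf_sum hI hP h2 hp.1]

theorem IsParam.const {Z : ℝ → ℝ} (hP : IsParam I T X Sig Z) (z : ℝ) :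
    IsParam I T X Sig fun _ => z :=
  ⟨hP.smooth_T, hP.smooth_X, hP.smooth_Sig, contDiffOn_const, hP.deriv_ne⟩

theorem varTransf_congr_Z {Z Z' : ℝ → ℝ} {p : Var n} (h : Z p.1 = Z' p.1) :
    varTransf T O X Sig Z p = varTransf T O X Sig Z' p := by
  rw [varTransf_eq, varTransf_eq, h]

/-- Point transformations that map an equation with `ρ f_ρρ / f_ρ` not being a real constant
belong to the equivalence group. -/
theorem ModularMap.exists_rigid {Z : ℝ → ℝ} {f f' : ℝ → ℂ} {V V' : ℝ × Space n → ℂ}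
    (h : ModularMap I D A φ T O X Sig Z f f' V V') (hI : IsOpen I)
    (hI' : IsConnected I) (hW : IsEqDomain (I ×ˢ D ×ˢ A))
    (hf : ¬ ∃ r : ℝ, ∀ ρ ∈ rhoRange (I ×ˢ D ×ˢ A), ratio f ρ = r) :
    ∃ z : ℝ, ModularMap I D A φ T O X Sig (fun _ => z) f f' V V' ∧
      ∀ t ∈ I, deriv (deriv T) t = 0 := by
  have h1 := h.rigid hI hI' hW hf
  obtain ⟨p₀, hp₀⟩ := hW.2.1.nonempty
  have hZ : ∀ t ∈ I, Z t = Z p₀.1 := fun t ht =>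
    hI.is_const_of_deriv_eq_zero hI'.isPreconnected
      (fun s hs => (hasDerivAt_of_contDiffOn hI h.param.smooth_Z
        hs).differentiableAt.differentiableWithinAt) (fun s hs => (h1 s hs).1) ht hp₀.1
  refine ⟨Z p₀.1, ⟨h.param.const _, h.transf, fun p hp => ?_, h.smooth, h.smooth', h.ne',
    fun q hq ρ hρ => ?_⟩, fun t ht => (h1 t ht).2⟩
  · rw [h.eq p hp]
    exact varTransf_congr_Z (hZ p.1 hp.1)
  · have h2 := h.rel q hq ρ hρ
    rw [hZ q.1 hq.1] at h2
    rw [h2]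
    simp only [potShift, (h1 q.1 hq.1).1, deriv_const]

end

/-! ### Normalization of `classV'`, separation of the subclasses, the partition. -/

section

variable {I : Set ℝ} {D : Set (Space n)} {A : Set ℂ}

/-- The condition that `ρ f_ρρ / f_ρ` is not a real constant is preserved. -/
theorem ratio_not_real_iff {W W' : Set (Var n)} {f f' : ℝ → ℂ} {τ : ℝ} {Z : ℝ}
    (hW : ∀ σ, σ ∈ rhoRange W' ↔ ∃ ρ ∈ rhoRange W, σ = Real.exp Z * ρ)
    (h : ∀ ρ ∈ rhoRange W, ratio f' (Real.exp Z * ρ) = hat τ (ratio f ρ)) :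
    (¬ ∃ r : ℝ, ∀ ρ ∈ rhoRange W, ratio f ρ = r) ↔
      ¬ ∃ r : ℝ, ∀ ρ ∈ rhoRange W', ratio f' ρ = r := by
  refine not_congr (exists_congr fun r => ⟨fun hr σ hσ => ?_, fun hr ρ hρ => ?_⟩)
  · obtain ⟨ρ, hρ, rfl⟩ := (hW σ).1 hσ
    rw [h ρ hρ, hr ρ hρ, hat_ofReal]
  · have h1 := h ρ hρ
    rw [hr _ ((hW _).2 ⟨ρ, hρ, rfl⟩)] at h1
    rw [← hat_hat τ (ratio f ρ), ← h1, hat_ofReal]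

/-- By rigidity every admissible transformation has T_tt = 0 and constant Z, and the arbitrary
elements change by `elemTransf`, which preserves the condition on the ratio. -/
theorem classV'_isNormalized (hn : 1 ≤ n) (hI : IsOpen I) (hI' : IsConnected I)
    (hD : IsOpen D) (hD' : IsConnected D) (hA : IsOpen A) (hA' : IsConnected A)
    (hA0 : (0 : ℂ) ∉ A) : (classV' n).IsNormalized (I ×ˢ D ×ˢ A) := by
  intro θ φ θ' hadm
  have hW := isEqDomain_prod hI hI' hD hD' hA hA' hA0
  obtain ⟨f, V, hf, hPf, hV, hθ⟩ := hadm.source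
  obtain ⟨f', V', hf', hPf', hV', hθ'⟩ := hadm.target
  have hθ'' : ∀ p ∈ I ×ˢ D ×ˢ A, θ' (φ p) = ![f' ‖(φ p).2.2‖, V' (base (φ p))] := fun p hp =>
    hθ' _ ⟨p, hp, rfl⟩
  obtain ⟨T, O, X, Sig, Z, hM⟩ := exists_modularMap (f := f) (V := V) (f' := f') (V' := V')
    hn hI hI' hD hD' hA hA' hA0 hadm.transf hadm.maps
    (fun p hp => by change θ p 0 + θ p 1 = _; rw [hθ p hp]; rfl)
    (fun p hp => by change θ' (φ p) 0 + θ' (φ p) 1 = _; rw [hθ'' p hp]; rfl) hf hf'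
  obtain ⟨z, hM', h2⟩ := hM.exists_rigid hI hI' hW hPf
  obtain ⟨c, hc⟩ := hM'.exists_const hI hI' hW h2
  refine ⟨elemTransf T O X Sig c, isEquivTransf_modularClass hn hI hI' hD hD' hA hA' hA0
    hM'.param h2 hM'.eq (fun _ _ _ => rfl) fun g g' τ hg => ratio_not_real_iff (fun σ => ?_) hg,
    fun p hp => ?_⟩
  · rw [mem_rhoRange_image hM'.eq]
    obtain ⟨t, ht⟩ := hI'.nonempty
    exact ⟨fun ⟨_, _, h⟩ => h, fun h => ⟨t, ht, h⟩⟩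
  · rw [hθ'' p hp, hθ p hp]
    exact hc p hp

/-- Ratios correspond under scaling of ρ up to conjugation, and a real constant is fixed by
conjugation. Since e^Z may vary with t, transferring a constant to the whole target range requires
all t. -/
theorem not_isAdmissible_subclass (hn : 1 ≤ n) (hI : IsOpen I) (hI' : IsConnected I)
    (hD : IsOpen D) (hD' : IsConnected D) (hA : IsOpen A) (hA' : IsConnected A)
    (hA0 : (0 : ℂ) ∉ A) (i j : Option ℝ) (hij : i ≠ j) (θ : Var n → Fin 2 → ℂ)
    (φ : Var n → Var n) (θ' : Var n → Fin 2 → ℂ) :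
    ¬ (subclass n i).IsAdmissible (subclass n j) (I ×ˢ D ×ˢ A) θ φ θ' := by
  intro hadm
  have hW := isEqDomain_prod hI hI' hD hD' hA hA' hA0
  have hR := hW.isConnected_rhoRange.nonempty
  have key : ∀ P P' : Set (Var n) → (ℝ → ℂ) → Prop,
      (modularClass n P).IsAdmissible (modularClass n P') (I ×ˢ D ×ˢ A) θ φ θ' →
      ∃ (f f' : ℝ → ℂ) (T Z : ℝ → ℝ), P (I ×ˢ D ×ˢ A) f ∧ P' (φ '' (I ×ˢ D ×ˢ A)) f' ∧
        (∀ t ∈ I, ∀ ρ ∈ rhoRange (I ×ˢ D ×ˢ A),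
          ratio f ρ = hat (deriv T t) (ratio f' (Real.exp (Z t) * ρ))) ∧
        ∀ σ, σ ∈ rhoRange (φ '' (I ×ˢ D ×ˢ A)) ↔
          ∃ t ∈ I, ∃ ρ ∈ rhoRange (I ×ˢ D ×ˢ A), σ = Real.exp (Z t) * ρ := by
    intro P P' hadm
    obtain ⟨f, V, hf, hPf, hV, hθ⟩ := hadm.source
    obtain ⟨f', V', hf', hPf', hV', hθ'⟩ := hadm.target
    obtain ⟨T, O, X, Sig, Z, hM⟩ := exists_modularMap (f := f) (V := V) (f' := f') (V' := V')
      hn hI hI' hD hD' hA hA' hA0 hadm.transf hadm.maps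
      (fun p hp => by change θ p 0 + θ p 1 = _; rw [hθ p hp]; rfl)
      (fun p hp => by
        change θ' (φ p) 0 + θ' (φ p) 1 = _; rw [hθ' _ ⟨p, hp, rfl⟩]; rfl) hf hf'
    exact ⟨f, f', T, Z, hPf, hPf', fun t ht ρ hρ => (hM.ratio_rel hW ht hρ).2,
      fun σ => mem_rhoRange_image hM.eq⟩
  obtain ⟨t₀, ht₀⟩ := hI'.nonempty
  obtain ⟨ρ₀, hρ₀⟩ := hR
  have push : ∀ (f f' : ℝ → ℂ) (T Z : ℝ → ℝ) (r : ℝ), (∀ t ∈ I, ∀ ρ ∈ rhoRange (I ×ˢ D ×ˢ A),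
      ratio f ρ = hat (deriv T t) (ratio f' (Real.exp (Z t) * ρ))) →
      (∀ ρ ∈ rhoRange (I ×ˢ D ×ˢ A), ratio f ρ = r) →
      ∀ t ∈ I, ∀ ρ ∈ rhoRange (I ×ˢ D ×ˢ A), ratio f' (Real.exp (Z t) * ρ) = r := by
    intro f f' T Z r h hr t ht ρ hρ
    rw [← hat_hat (deriv T t) (ratio f' _), ← h t ht ρ hρ, hr ρ hρ, hat_ofReal]
  rcases i with _ | lam <;> rcases j with _ | mu
  · exact hij rfl
  · obtain ⟨f, f', T, Z, hf, hf', hrel, hmem⟩ := key _ _ hadm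
    refine hf ⟨mu - 1, fun ρ hρ => ?_⟩
    rw [hrel t₀ ht₀ ρ hρ, hf' _ ((hmem _).2 ⟨t₀, ht₀, ρ, hρ, rfl⟩), hat_ofReal]
  · obtain ⟨f, f', T, Z, hf, hf', hrel, hmem⟩ := key _ _ hadm
    refine hf' ⟨lam - 1, fun σ hσ => ?_⟩
    obtain ⟨t, ht, ρ, hρ, rfl⟩ := (hmem σ).1 hσ
    exact push f f' T Z _ hrel hf t ht ρ hρ
  · obtain ⟨f, f', T, Z, hf, hf', hrel, hmem⟩ := key _ _ hadm
    have h1 := push f f' T Z _ hrel hf t₀ ht₀ ρ₀ hρ₀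
    rw [hf' _ ((hmem _).2 ⟨t₀, ht₀, ρ₀, hρ₀, rfl⟩)] at h1
    have h2 : mu - 1 = lam - 1 := by exact_mod_cast h1
    exact hij (by rw [show lam = mu by linarith])

/-- `𝒱` is the disjoint union of its subclasses. -/
theorem classV_partition {W : Set (Var n)} (hW : IsEqDomain W) :
    (classV n).elems W = ⋃ i, (subclass n i).elems W ∧
      Pairwise fun i j => Disjoint ((subclass n i).elems W) ((subclass n j).elems W) := by
  constructor
  · ext θ
    rw [Set.mem_iUnion]
    constructor
    · rintro ⟨f, V, hf, -, hV, hθ⟩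
      by_cases h : ∃ r : ℝ, ∀ ρ ∈ rhoRange W, ratio f ρ = r
      · obtain ⟨r, hr⟩ := h
        exact ⟨some (r + 1), f, V, hf, fun ρ hρ => by rw [hr ρ hρ, add_sub_cancel_right], hV, hθ⟩
      · exact ⟨none, f, V, hf, h, hV, hθ⟩
    · rintro ⟨_ | lam, f, V, hf, -, hV, hθ⟩
      · exact ⟨f, V, hf, trivial, hV, hθ⟩
      · exact ⟨f, V, hf, trivial, hV, hθ⟩
  · intro i j hij
    rw [Set.disjoint_left]
    have key : ∀ (P P' : Set (Var n) → (ℝ → ℂ) → Prop) (θ : Var n → Fin 2 → ℂ),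
        θ ∈ (modularClass n P).elems W → θ ∈ (modularClass n P').elems W →
        ∃ f f' : ℝ → ℂ, P W f ∧ P' W f' ∧ ∀ ρ ∈ rhoRange W, ratio f ρ = ratio f' ρ := by
      rintro P P' θ ⟨f, V, hf, hPf, hV, hθ⟩ ⟨f', V', hf', hPf', hV', hθ'⟩
      refine ⟨f, f', hPf, hPf', fun ρ hρ => ?_⟩
      have h1 : ∀ σ ∈ rhoRange W, f σ = f' σ := by
        rintro _ ⟨p, hp, rfl⟩
        exact congrFun ((hθ p hp).symm.trans (hθ' p hp)) 0
      have h2 : f =ᶠ[𝓝 ρ] f' :=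
        Filter.eventuallyEq_of_mem (hW.isOpen_rhoRange.mem_nhds hρ) h1
      rw [ratio, ratio, h2.deriv_eq, h2.deriv.deriv_eq]
    obtain ⟨ρ₀, hρ₀⟩ := hW.isConnected_rhoRange.nonempty
    intro θ hi hj
    rcases i with _ | lam <;> rcases j with _ | mu
    · exact hij rfl
    · obtain ⟨f, f', hf, hf', h⟩ := key _ _ θ hi hj
      exact hf ⟨mu - 1, fun ρ hρ => (h ρ hρ).trans (hf' ρ hρ)⟩
    · obtain ⟨f, f', hf, hf', h⟩ := key _ _ θ hi hj
      exact hf' ⟨lam - 1, fun ρ hρ => (h ρ hρ).symm.trans (hf ρ hρ)⟩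
    · obtain ⟨f, f', hf, hf', h⟩ := key _ _ θ hi hj
      have h1 := (hf ρ₀ hρ₀).symm.trans ((h ρ₀ hρ₀).trans (hf' ρ₀ hρ₀))
      have h2 : lam - 1 = mu - 1 := by exact_mod_cast h1
      exact hij (by rw [show lam = mu by linarith])

end

/-! ### The equivalence group of `classV` and the failure of normalization. -/

section

variable {I : Set ℝ} {D : Set (Space n)} {A : Set ℂ} {φ : Var n → Var n}
  {Λ : Var n → (Fin 2 → ℂ) → (Fin 2 → ℂ)}

/-- The action of an equivalence transformation of `𝒱` on the equation with the arbitrary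
elements `(f, V)`. -/
theorem exists_transformed_elems {W : Set (Var n)} (h : (classV n).IsEquivTransf W φ Λ)
    {f : ℝ → ℂ} {V : ℝ × Space n → ℂ} (hf : IsNonlinearity W f) (hV : IsPotential W V) :
    ∃ (f' : ℝ → ℂ) (V' : ℝ × Space n → ℂ), IsNonlinearity (φ '' W) f' ∧
      (∀ p ∈ W, Λ p ![f ‖p.2.2‖, V (base p)] = ![f' ‖(φ p).2.2‖, V' (base (φ p))]) ∧
      ∃ S S' : Var n → ℂ, MapsEquation W φ S S' ∧ (∀ p ∈ W, S p = f ‖p.2.2‖ + V (base p)) ∧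
        ∀ p ∈ W, S' (φ p) = f' ‖(φ p).2.2‖ + V' (base (φ p)) := by
  let θ : Var n → Fin 2 → ℂ := fun p => ![f ‖p.2.2‖, V (base p)]
  let θ' : Var n → Fin 2 → ℂ := fun r => Λ (Function.invFunOn φ W r) (θ (Function.invFunOn φ W r))
  have hθ' : ∀ p ∈ W, θ' (φ p) = Λ p (θ p) := fun p hp => by
    have h1 : Function.invFunOn φ W (φ p) = p :=
      h.transf.pointTransf.inj.leftInvOn_invFunOn hp
    simp only [θ', h1]
  have hθ : θ ∈ (classV n).elems W := ⟨f, V, hf, trivial, hV, fun _ _ => rfl⟩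
  obtain ⟨f', V', hf', -, -, he⟩ := (h.elems_iff θ θ' hθ').1 hθ
  refine ⟨f', V', hf', fun p hp => ?_, (classV n).S θ, (classV n).S θ', h.maps θ θ' hθ' hθ,
    fun p _ => rfl, fun p hp => ?_⟩
  · rw [← he _ ⟨p, hp, rfl⟩, hθ' p hp]
  · change θ' (φ p) 0 + θ' (φ p) 1 = _
    rw [he _ ⟨p, hp, rfl⟩]
    rfl

theorem hasDerivAt_ofReal (s : ℝ) : HasDerivAt (fun s : ℝ => (s : ℂ)) 1 s :=
  Complex.ofRealCLM.hasDerivAt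

theorem isNonlinearity_affine {W : Set (Var n)} (a b r : ℂ) (ha : a ≠ 0) :
    IsNonlinearity W fun ρ => b + (ρ - r) * a := by
  refine ⟨(contDiff_const.add ((Complex.ofRealCLM.contDiff.sub contDiff_const).mul
    contDiff_const)).contDiffOn, fun ρ _ => ?_⟩
  have h : HasDerivAt (fun ρ : ℝ => b + ((ρ : ℂ) - r) * a) a ρ := by
    simpa using (((hasDerivAt_ofReal ρ).sub_const r).mul_const a).const_add b
  rw [h.deriv]
  exact ha

/-- A nonlinearity for which `ρ f_ρρ / f_ρ` is not a real constant. -/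
theorem exists_nonlinearity_not_real {W : Set (Var n)} (hW : IsEqDomain W) :
    ∃ f, IsNonlinearity W f ∧ ¬ ∃ r : ℝ, ∀ ρ ∈ rhoRange W, ratio f ρ = r := by
  -- For f = ρ + iρ² the ratio is 2iρ/(1 + 2iρ), which is nonreal for every ρ > 0, while f_ρ has
  -- real part 1 and never vanishes.
  have h1 : (deriv fun ρ : ℝ => (ρ : ℂ) + Complex.I * (ρ : ℂ) ^ 2)
      = fun ρ : ℝ => 1 + 2 * Complex.I * (ρ : ℂ) := by
    funext ρ
    refine ((hasDerivAt_ofReal ρ).add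
      (((hasDerivAt_ofReal ρ).pow 2).const_mul Complex.I)).deriv.trans ?_
    simp
    ring
  have h2 : ∀ ρ, deriv (deriv fun ρ : ℝ => (ρ : ℂ) + Complex.I * (ρ : ℂ) ^ 2) ρ
      = 2 * Complex.I := by
    intro ρ
    rw [h1]
    refine (((hasDerivAt_ofReal ρ).const_mul (2 * Complex.I)).const_add 1).deriv.trans ?_
    simp
  have h3 : ∀ ρ : ℝ, 1 + 2 * Complex.I * (ρ : ℂ) ≠ 0 := fun ρ h => by
    have := congrArg Complex.re h
    simp at this
  refine ⟨fun ρ => (ρ : ℂ) + Complex.I * (ρ : ℂ) ^ 2, ⟨?_, fun ρ _ => ?_⟩, ?_⟩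
  · exact (Complex.ofRealCLM.contDiff.add
      (contDiff_const.mul (Complex.ofRealCLM.contDiff.pow 2))).contDiffOn
  · rw [h1]
    exact h3 ρ
  · rintro ⟨r, hr⟩
    obtain ⟨ρ, hρ⟩ := hW.isConnected_rhoRange.nonempty
    have h4 := hr ρ hρ
    rw [ratio, h2, h1, div_eq_iff (h3 ρ)] at h4
    have h5 := congrArg Complex.re h4
    have h6 := congrArg Complex.im h4
    simp at h5 h6
    have h7 := (hW.pos hρ).ne'
    rw [← h5] at h6
    simp at h6
    exact h7 h6

theorem infinite_of_isOpen {I : Set ℝ} (hI : IsOpen I) (h : I.Nonempty) : I.Infinite := by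
  obtain ⟨t, ht⟩ := h
  exact infinite_of_mem_nhds t (hI.mem_nhds ht)

/-- The equivalence group of the class `𝒱`. -/
theorem isEquivTransf_classV_iff (hn : 1 ≤ n) (hI : IsOpen I) (hI' : IsConnected I)
    (hD : IsOpen D) (hD' : IsConnected D) (hA : IsOpen A) (hA' : IsConnected A)
    (hA0 : (0 : ℂ) ∉ A) :
    (classV n).IsEquivTransf (I ×ˢ D ×ˢ A) φ Λ ↔
        ∃ (T : ℝ → ℝ) (O : Space n ≃ₗᵢ[ℝ] Space n) (X : ℝ → Space n)
          (Sig : ℝ → ℝ) (Z : ℝ) (c : ℂ),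
          ContDiffOn ℝ ∞ T I ∧ ContDiffOn ℝ ∞ X I ∧ ContDiffOn ℝ ∞ Sig I ∧
          (∀ t ∈ I, deriv T t ≠ 0) ∧ (∀ t ∈ I, deriv (deriv T) t = 0) ∧
          (∀ p ∈ I ×ˢ D ×ˢ A, φ p = varTransf T O X Sig (fun _ => Z) p) ∧
          (∀ p ∈ I ×ˢ D ×ˢ A, ∀ v, Λ p v = elemTransf T O X Sig c p v) := by
  have hW := isEqDomain_prod hI hI' hD hD' hA hA' hA0
  constructor
  · intro h
    -- The point transformation φ is common to all equations, so one equation with a nonreal ratio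
    -- already determines its form.
    obtain ⟨f₀, hf₀, hnr⟩ := exists_nonlinearity_not_real hW
    obtain ⟨f', V', hf', -, S, S', hm, hS, hS'⟩ := exists_transformed_elems h hf₀
      (V := fun _ => 0) contDiffOn_const
    obtain ⟨T, O, X, Sig, Z, hM⟩ := exists_modularMap (V := fun _ => 0) hn hI hI' hD hD' hA
      hA' hA0 h.transf hm hS hS' hf₀ hf'
    obtain ⟨z, hM', h2⟩ := hM.exists_rigid hI hI' hW hnr
    have key : ∀ f V, IsNonlinearity (I ×ˢ D ×ˢ A) f → IsPotential (I ×ˢ D ×ˢ A) V →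
        ∃ c, ∀ p ∈ I ×ˢ D ×ˢ A, Λ p ![f ‖p.2.2‖, V (base p)]
          = elemTransf T O X Sig c p ![f ‖p.2.2‖, V (base p)] := by
      intro f V hf hV
      obtain ⟨f', V', hf', hΛ, S, S', hm, hS, hS'⟩ := exists_transformed_elems h hf hV
      obtain ⟨c, hc⟩ := (modularMap_of_maps hn hI hI' hD hD' hA hA0 hM'.param h.transf hM'.eq hm
        hS hS' hf hf').exists_const hI hI' hW h2
      exact ⟨c, fun p hp => (hΛ p hp).trans (hc p hp)⟩
    -- So far c may depend on (f, V). An f affine in ρ and a V affine in t take two prescribed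
    -- values at two points, so these points share c; distinct v 0 keep f_ρ ≠ 0.
    have link : ∀ p ∈ I ×ˢ D ×ˢ A, ∀ p' ∈ I ×ˢ D ×ˢ A, ∀ v v' : Fin 2 → ℂ, p.1 ≠ p'.1 →
        ‖p.2.2‖ ≠ ‖p'.2.2‖ → v 0 ≠ v' 0 →
        ∃ c, Λ p v = elemTransf T O X Sig c p v ∧ Λ p' v' = elemTransf T O X Sig c p' v' := by
      intro p hp p' hp' v v' ht hρ hv
      have hρ' : ((‖p'.2.2‖ : ℝ) : ℂ) - ((‖p.2.2‖ : ℝ) : ℂ) ≠ 0 :=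
        sub_ne_zero.2 fun h => hρ (Complex.ofReal_injective h).symm
      have ht' : ((p'.1 : ℝ) : ℂ) - ((p.1 : ℝ) : ℂ) ≠ 0 :=
        sub_ne_zero.2 fun h => ht (Complex.ofReal_injective h).symm
      obtain ⟨c, hc⟩ := key (fun ρ => v 0 + (ρ - ((‖p.2.2‖ : ℝ) : ℂ))
          * ((v' 0 - v 0) / (((‖p'.2.2‖ : ℝ) : ℂ) - ((‖p.2.2‖ : ℝ) : ℂ))))
        (fun q => v 1 + (((q.1 : ℝ) : ℂ) - ((p.1 : ℝ) : ℂ))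
          * ((v' 1 - v 1) / (((p'.1 : ℝ) : ℂ) - ((p.1 : ℝ) : ℂ))))
        (isNonlinearity_affine _ _ _ (div_ne_zero (sub_ne_zero.2 hv.symm) hρ'))
        (contDiff_const.add (((Complex.ofRealCLM.contDiff.comp contDiff_fst).sub
          contDiff_const).mul contDiff_const)).contDiffOn
      have h1 := hc p hp
      have h3 := hc p' hp'
      have e1 : ∀ w : Fin 2 → ℂ, ![w 0, w 1] = w := fun w => by
        ext i; fin_cases i <;> rfl
      simp only [base, sub_self, zero_mul, add_zero, mul_div_cancel₀ _ hρ', mul_div_cancel₀ _ ht',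
        add_sub_cancel, e1] at h1 h3
      exact ⟨c, h1, h3⟩
    obtain ⟨p₀, hp₀⟩ := hW.2.1.nonempty
    have hc0 : ∀ (c : ℂ) (p : Var n) (v : Fin 2 → ℂ), c = elemTransf T O X Sig c p v 0
        - hat (deriv T p.1) (v 0) / ((|deriv T p.1| : ℝ) : ℂ) := fun c p v => by
      simp [elemTransf]
    refine ⟨T, O, X, Sig, z, Λ p₀ 0 0, hM'.param.smooth_T, hM'.param.smooth_X,
      hM'.param.smooth_Sig, hM'.param.deriv_ne, h2, hM'.eq, fun p hp v => ?_⟩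
    -- An auxiliary point with t, ρ and the value w of f different from those at both p and p₀ links
    -- an arbitrary (p, v) to the reference (p₀, 0) in two steps.
    obtain ⟨t, ht, htn⟩ := (infinite_of_isOpen hI hI'.nonempty).exists_notMem_finset {p.1, p₀.1}
    obtain ⟨ρ, hρ, hρn⟩ := (infinite_of_isOpen hW.isOpen_rhoRange
      hW.isConnected_rhoRange.nonempty).exists_notMem_finset {‖p.2.2‖, ‖p₀.2.2‖}
    obtain ⟨w, hw⟩ := Infinite.exists_notMem_finset ({v 0, 0} : Finset ℂ)
    obtain ⟨y, hy, rfl⟩ := (mem_rhoRange_prod hI'.nonempty hD'.nonempty).1 hρ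
    simp only [Finset.mem_insert, Finset.mem_singleton, not_or] at htn hρn hw
    have hp' : (t, p.2.1, y) ∈ I ×ˢ D ×ˢ A := ⟨ht, hp.2.1, hy⟩
    obtain ⟨c₁, h1, h3⟩ := link _ hp' p₀ hp₀ ![w, 0] 0 htn.2 hρn.2 hw.2
    obtain ⟨c₂, h4, h5⟩ := link _ hp' p hp ![w, 0] v htn.1 hρn.1 hw.1
    have h6 : c₁ = c₂ := by
      rw [hc0 c₁ (t, p.2.1, y) ![w, 0], hc0 c₂ (t, p.2.1, y) ![w, 0], ← h1, ← h4]
    have h7 : c₁ = Λ p₀ 0 0 := by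
      rw [hc0 c₁ p₀ 0, ← h3]
      simp [hat_eq_zero.2]
    rw [h5, ← h6, h7]
  · rintro ⟨T, O, X, Sig, Z, c, hT, hX, hSig, hT0, h2, hφ, hΛ⟩
    exact isEquivTransf_modularClass hn hI hI' hD hD' hA hA' hA0
      ⟨hT, hX, hSig, contDiffOn_const, hT0⟩ h2 hφ hΛ fun _ _ _ _ => Iff.rfl

theorem contDiffOn_log {R : Set ℝ} (hR : ∀ ρ ∈ R, 0 < ρ) : ContDiffOn ℝ ∞ Real.log R :=
  fun ρ hρ => (Real.contDiffAt_log.2 (hR ρ hρ).ne').contDiffWithinAt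

theorem isNonlinearity_log {W : Set (Var n)} (hW : IsEqDomain W) :
    IsNonlinearity W fun ρ => (Real.log ρ : ℂ) := by
  refine ⟨Complex.ofRealCLM.contDiff.comp_contDiffOn (contDiffOn_log fun ρ hρ => hW.pos hρ),
    fun ρ hρ => ?_⟩
  have h := (Real.hasDerivAt_log (hW.pos hρ).ne').ofReal_comp
  rw [h.deriv]
  exact Complex.ofReal_ne_zero.2 (inv_ne_zero (hW.pos hρ).ne')

/-- The class `𝒱` is not normalized, because of the logarithmic nonlinearity. -/
theorem not_isNormalized_classV (hn : 1 ≤ n) (hI : IsOpen I) (hI' : IsConnected I)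
    (hD : IsOpen D) (hD' : IsConnected D) (hA : IsOpen A) (hA' : IsConnected A)
    (hA0 : (0 : ℂ) ∉ A) : ¬ (classV n).IsNormalized (I ×ˢ D ×ˢ A) := by
  intro hnorm
  have hW := isEqDomain_prod hI hI' hD hD' hA hA' hA0
  have hd : deriv (fun t : ℝ => t) = fun _ => 1 := by funext t; simp
  -- The counterexample is ψ̃ = e^t ψ with f = ln ρ: the identity ln|ψ| = ln|ψ̃| − t and the term
  -- iψ_t turn V = 0 into −t − i. In the equivalence group Z is constant, here it is t.
  have hP : IsParam (n := n) I (fun t => t) (fun _ => 0) (fun _ => 0) fun t => t :=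
    ⟨contDiffOn_id, contDiffOn_const, contDiffOn_const, contDiffOn_id, fun t _ => by simp [hd]⟩
  have htr := isVarTransf_varTransf (D := D) (LinearIsometryEquiv.refl ℝ (Space n)) hI hI' hP hA0
  have hph : phase (fun t : ℝ => t) (LinearIsometryEquiv.refl ℝ (Space n)) (fun _ => 0)
      = fun _ => 0 := by
    funext q
    simp [phase, phaseQuad, phaseLin, hd]
  have hpot : ∀ q : ℝ × Space n, potShift (fun t : ℝ => t)
      (LinearIsometryEquiv.refl ℝ (Space n)) (fun _ => 0) (fun _ => 0) (fun t => t) q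
      = -Complex.I := by
    intro q
    simp [potShift, hph, phaseGrad, phaseQuad, phaseLin, hd]
  set φ := varTransf (fun t : ℝ => t) (LinearIsometryEquiv.refl ℝ (Space n)) (fun _ => 0)
    (fun _ => 0) fun t => t with hφ
  obtain ⟨Λ, hΛ, -⟩ := hnorm (fun p => ![(Real.log ‖p.2.2‖ : ℂ), 0]) φ
    (fun p => ![(Real.log ‖p.2.2‖ : ℂ), -(p.1 : ℂ) - Complex.I])
    ⟨htr, ⟨_, fun _ => 0, isNonlinearity_log hW, trivial, contDiffOn_const, fun _ _ => rfl⟩,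
      ⟨_, fun q => -(q.1 : ℂ) - Complex.I, isNonlinearity_log (htr.isEqDomain hW), trivial,
        ((Complex.ofRealCLM.contDiff.comp contDiff_fst).neg.sub contDiff_const).contDiffOn,
        fun _ _ => rfl⟩, by
      rw [mapsEquation_varTransf_iff hn _ hI hI' hP hD hA hA0]
      intro p hp
      rw [hpot]
      change ((Real.log ‖(φ p).2.2‖ : ℝ) : ℂ) + (-((φ p).1 : ℂ) - Complex.I)
        = hat _ ((Real.log ‖p.2.2‖ : ℂ) + 0) / _ + _
      have h1 : (φ p).1 = p.1 := by rw [hφ, varTransf_eq]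
      rw [h1, hφ, norm_varTransf, Real.log_mul (Real.exp_ne_zero _)
        (norm_ne_zero_iff.2 (hW.2.2 p hp)), Real.log_exp, add_zero, hat_ofReal, hd]
      simp
      ring⟩
  obtain ⟨T, O, X, Sig, Z, c, -, -, -, -, -, hφe, -⟩ :=
    (isEquivTransf_classV_iff hn hI hI' hD hD' hA hA' hA0).1 hΛ
  have hZ : ∀ t ∈ I, t = Z := by
    intro t ht
    obtain ⟨x, hx⟩ := hD'.nonempty
    obtain ⟨z, hz⟩ := hA'.nonempty
    have hp : ((t, x, z) : Var n) ∈ I ×ˢ D ×ˢ A := ⟨ht, hx, hz⟩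
    have h1 := congrArg (fun p : Var n => ‖p.2.2‖) (hφe _ hp)
    simp only [hφ, norm_varTransf] at h1
    have h2 := mul_right_cancel₀ (norm_ne_zero_iff.2 (hW.2.2 _ hp)) h1
    exact Real.exp_injective h2
  obtain ⟨t, ht, htn⟩ := (infinite_of_isOpen hI hI'.nonempty).exists_notMem_finset {Z}
  exact htn (by simp [hZ t ht])

end

/-! ### Power and logarithmic nonlinearities. -/

/-- The nonlinearities of the class `𝒫_lam` are `δ * powerFn lam ρ` up to additive constants. -/
def powerFn (lam ρ : ℝ) : ℝ := if lam = 0 then Real.log ρ else ρ ^ lam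

/-- The constant factor in the derivative of `powerFn`. -/
def powerConst (lam : ℝ) : ℝ := if lam = 0 then 1 else lam

theorem powerConst_ne_zero (lam : ℝ) : powerConst lam ≠ 0 := by
  unfold powerConst
  split_ifs with h
  · exact one_ne_zero
  · exact h

theorem hasDerivAt_powerFn (lam : ℝ) {ρ : ℝ} (hρ : 0 < ρ) :
    HasDerivAt (powerFn lam) (powerConst lam * ρ ^ (lam - 1)) ρ := by
  unfold powerFn powerConst
  by_cases h : lam = 0
  · simp only [h, if_true, zero_sub, Real.rpow_neg_one, one_mul]
    exact Real.hasDerivAt_log hρ.ne'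
  · simp only [h, if_false]
    exact Real.hasDerivAt_rpow_const (Or.inl hρ.ne')

/-- For λ ≠ 0 a change of scale acts on the power by a factor; for λ = 0 it acts by an additive
term, which the potential can absorb. This is why Z may depend on t for the logarithm without any
constraint from the scale. -/
theorem powerFn_exp_mul (lam z : ℝ) {ρ : ℝ} (hρ : 0 < ρ) : powerFn lam (Real.exp z * ρ)
    = Real.exp (lam * z) * powerFn lam ρ + (if lam = 0 then z else 0) := by
  unfold powerFn
  by_cases h : lam = 0
  · simp only [h, if_true, zero_mul, Real.exp_zero, one_mul]
    rw [Real.log_mul (Real.exp_ne_zero _) hρ.ne', Real.log_exp, add_comm]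
  · simp only [h, if_false, add_zero]
    rw [Real.mul_rpow (Real.exp_pos _).le hρ.le, ← Real.exp_mul, mul_comm z]

theorem powerFn_injOn (lam : ℝ) : Set.InjOn (powerFn lam) (Set.Ioi 0) := by
  intro ρ hρ σ hσ h
  unfold powerFn at h
  by_cases h0 : lam = 0
  · simp only [h0, if_true] at h
    exact Real.log_injOn_pos hρ hσ h
  · simp only [h0, if_false] at h
    exact Real.rpow_left_injOn h0 (Set.mem_Ioi.1 hρ).le (Set.mem_Ioi.1 hσ).le h

theorem contDiffOn_powerFn (lam : ℝ) {R : Set ℝ} (hR : ∀ ρ ∈ R, 0 < ρ) :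
    ContDiffOn ℝ ∞ (powerFn lam) R := by
  intro ρ hρ
  unfold powerFn
  by_cases h : lam = 0
  · simp only [h, if_true]
    exact (Real.contDiffAt_log.2 (hR ρ hρ).ne').contDiffWithinAt
  · simp only [h, if_false]
    exact (Real.contDiffAt_rpow_const_of_ne (hR ρ hρ).ne').contDiffWithinAt

theorem hasDerivAt_mul_powerFn (δ : ℂ) (lam : ℝ) {ρ : ℝ} (hρ : 0 < ρ) :
    HasDerivAt (fun ρ => δ * (powerFn lam ρ : ℂ))
      (δ * powerConst lam * ((ρ ^ (lam - 1) : ℝ) : ℂ)) ρ := by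
  refine ((hasDerivAt_powerFn lam hρ).ofReal_comp.const_mul δ).congr_deriv ?_
  push_cast
  ring

theorem rpow_cast_ne_zero {ρ : ℝ} (hρ : 0 < ρ) (r : ℝ) : ((ρ ^ r : ℝ) : ℂ) ≠ 0 :=
  Complex.ofReal_ne_zero.2 (Real.rpow_pos_of_pos hρ r).ne'

theorem isNonlinearity_mul_powerFn {W : Set (Var n)} (hW : IsEqDomain W) {δ : ℂ} (hδ : δ ≠ 0)
    (lam : ℝ) : IsNonlinearity W fun ρ => δ * (powerFn lam ρ : ℂ) := by
  refine ⟨contDiffOn_const.mul (Complex.ofRealCLM.contDiff.comp_contDiffOn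
    (contDiffOn_powerFn lam fun ρ hρ => hW.pos hρ)), fun ρ hρ => ?_⟩
  rw [(hasDerivAt_mul_powerFn δ lam (hW.pos hρ)).deriv]
  exact mul_ne_zero (mul_ne_zero hδ (Complex.ofReal_ne_zero.2 (powerConst_ne_zero lam)))
    (rpow_cast_ne_zero (hW.pos hρ) _)

theorem ratio_mul_powerFn {δ : ℂ} (hδ : δ ≠ 0) (lam : ℝ) {ρ : ℝ} (hρ : 0 < ρ) :
    ratio (fun ρ => δ * (powerFn lam ρ : ℂ)) ρ = ((lam - 1 : ℝ) : ℂ) := by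
  have h1 : deriv (fun ρ => δ * (powerFn lam ρ : ℂ)) =ᶠ[𝓝 ρ]
      fun ρ => δ * powerConst lam * ((ρ ^ (lam - 1) : ℝ) : ℂ) := by
    filter_upwards [eventually_gt_nhds hρ] with σ hσ
    exact (hasDerivAt_mul_powerFn δ lam hσ).deriv
  have h2 := (((Real.hasDerivAt_rpow_const (p := lam - 1)
    (Or.inl hρ.ne')).ofReal_comp).const_mul (δ * powerConst lam)).deriv
  have hk := Complex.ofReal_ne_zero.2 (powerConst_ne_zero lam)
  have h3 : ρ * ρ ^ (lam - 1 - 1) = ρ ^ (lam - 1) := by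
    rw [mul_comm, ← Real.rpow_add_one hρ.ne', sub_add_cancel]
  have h4 : (ρ : ℂ) * ((ρ ^ (lam - 1 - 1) : ℝ) : ℂ) = ((ρ ^ (lam - 1) : ℝ) : ℂ) := by
    exact_mod_cast h3
  have h5 := rpow_cast_ne_zero hρ (lam - 1)
  rw [ratio, h1.deriv_eq, h1.self_of_nhds, h2, div_eq_iff (mul_ne_zero (mul_ne_zero hδ hk) h5),
    Complex.ofReal_mul, ← h4]
  ring

/-- The nonlinearities with constant `ρ f_ρρ / f_ρ`. -/
theorem exists_eq_mul_powerFn {R : Set ℝ} (hR : IsOpen R) (hR' : IsConnected R)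
    (hpos : ∀ ρ ∈ R, 0 < ρ) {f : ℝ → ℂ} (hf : ContDiffOn ℝ ∞ f R)
    (hf0 : ∀ ρ ∈ R, deriv f ρ ≠ 0) {lam : ℝ}
    (h : ∀ ρ ∈ R, ratio f ρ = ((lam - 1 : ℝ) : ℂ)) :
    ∃ δ c : ℂ, δ ≠ 0 ∧ ∀ ρ ∈ R, f ρ = δ * (powerFn lam ρ : ℂ) + c := by
  obtain ⟨ρ₀, hρ₀⟩ := hR'.nonempty
  -- The condition on the ratio is the equation (ρ^{1−λ} f_ρ)_ρ = 0 in disguise. Its constant a,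
  -- divided by `powerConst`, is δ.
  have hg : ∀ ρ ∈ R, HasDerivAt (fun ρ => deriv f ρ * ((ρ ^ (1 - lam) : ℝ) : ℂ)) 0 ρ := by
    intro ρ hρ
    have h1 := (hasDerivAt_of_contDiffOn hR (contDiffOn_deriv hR hf) hρ).mul
      (Real.hasDerivAt_rpow_const (p := 1 - lam) (Or.inl (hpos ρ hρ).ne')).ofReal_comp
    refine h1.congr_deriv ?_
    have h2 := h ρ hρ
    rw [ratio, div_eq_iff (hf0 ρ hρ)] at h2
    have h3 : ρ * ρ ^ (1 - lam - 1) = ρ ^ (1 - lam) := by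
      rw [mul_comm, ← Real.rpow_add_one (hpos ρ hρ).ne', sub_add_cancel]
    have h4 : (ρ : ℂ) * ((ρ ^ (1 - lam - 1) : ℝ) : ℂ) = ((ρ ^ (1 - lam) : ℝ) : ℂ) := by
      exact_mod_cast h3
    rw [← h4, Complex.ofReal_mul]
    push_cast at h2 ⊢
    linear_combination ((ρ ^ (1 - lam - 1) : ℝ) : ℂ) * h2
  have hconst : ∀ ρ ∈ R, deriv f ρ * ((ρ ^ (1 - lam) : ℝ) : ℂ)
      = deriv f ρ₀ * ((ρ₀ ^ (1 - lam) : ℝ) : ℂ) := fun ρ hρ =>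
    hR.is_const_of_deriv_eq_zero (f := fun ρ => deriv f ρ * ((ρ ^ (1 - lam) : ℝ) : ℂ))
      hR'.isPreconnected (fun σ hσ => (hg σ hσ).differentiableAt.differentiableWithinAt)
      (fun σ hσ => (hg σ hσ).deriv) hρ hρ₀
  set a := deriv f ρ₀ * ((ρ₀ ^ (1 - lam) : ℝ) : ℂ) with ha
  have ha0 : a ≠ 0 := mul_ne_zero (hf0 ρ₀ hρ₀) (rpow_cast_ne_zero (hpos ρ₀ hρ₀) _)
  have hk := Complex.ofReal_ne_zero.2 (powerConst_ne_zero lam)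
  have hd : ∀ ρ ∈ R, HasDerivAt (fun ρ => f ρ - a / powerConst lam * (powerFn lam ρ : ℂ)) 0 ρ := by
    intro ρ hρ
    refine ((hasDerivAt_of_contDiffOn hR hf hρ).sub
      (hasDerivAt_mul_powerFn (a / powerConst lam) lam (hpos ρ hρ))).congr_deriv ?_
    rw [div_mul_cancel₀ _ hk, ← hconst ρ hρ, mul_assoc, ← Complex.ofReal_mul,
      ← Real.rpow_add (hpos ρ hρ)]
    simp
  refine ⟨a / powerConst lam, f ρ₀ - a / powerConst lam * (powerFn lam ρ₀ : ℂ),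
    div_ne_zero ha0 hk, fun ρ hρ => ?_⟩
  have h1 := hR.is_const_of_deriv_eq_zero
    (f := fun ρ => f ρ - a / powerConst lam * (powerFn lam ρ : ℂ))
    hR'.isPreconnected (fun σ hσ => (hd σ hσ).differentiableAt.differentiableWithinAt)
    (fun σ hσ => (hd σ hσ).deriv) hρ hρ₀
  linear_combination h1

/-- The class `𝒫_lam` and its reparameterization consist of the same equations. -/
theorem classP_containsEquation_iff (lam : ℝ) {W : Set (Var n)} (hW : IsEqDomain W)
    (S : Var n → ℂ) :
    (classP n lam).ContainsEquation W S ↔ (classPδ n lam).ContainsEquation W S := by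
  constructor
  · rintro ⟨θ, ⟨f, V, hf, hr, hV, hθ⟩, hS⟩
    obtain ⟨δ, c, hδ, hfe⟩ := exists_eq_mul_powerFn hW.isOpen_rhoRange hW.isConnected_rhoRange
      (fun ρ hρ => hW.pos hρ) hf.1 hf.2 hr
    -- The additive constant of integration moves from f to the potential, so the two classes agree
    -- as sets of equations only.
    refine ⟨fun p => ![δ, V (base p) + c], ⟨δ, fun q => V q + c, hδ,
      ContDiffOn.add hV contDiffOn_const, fun _ _ => rfl⟩, fun p hp => ?_⟩
    rw [hS p hp]
    change θ p 0 + θ p 1 = δ * (powerFn lam ‖p.2.2‖ : ℂ) + (V (base p) + c)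
    rw [hθ p hp]
    change f ‖p.2.2‖ + V (base p) = _
    rw [hfe _ ⟨p, hp, rfl⟩]
    ring
  · rintro ⟨θ, ⟨δ, V, hδ, hV, hθ⟩, hS⟩
    refine ⟨fun p => ![δ * (powerFn lam ‖p.2.2‖ : ℂ), V (base p)],
      ⟨fun ρ => δ * (powerFn lam ρ : ℂ), V, isNonlinearity_mul_powerFn hW hδ lam,
        fun ρ hρ => ratio_mul_powerFn hδ lam (hW.pos hρ), hV, fun _ _ => rfl⟩, fun p hp => ?_⟩
    rw [hS p hp]
    change θ p 0 * (powerFn lam ‖p.2.2‖ : ℂ) + θ p 1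
      = δ * (powerFn lam ‖p.2.2‖ : ℂ) + V (base p)
    rw [hθ p hp]
    rfl

/-- The transformation of the arbitrary elements `(δ, V)`. -/
def powerElemTransf (lam : ℝ) (T : ℝ → ℝ) (O : Space n ≃ₗᵢ[ℝ] Space n) (X : ℝ → Space n)
    (Sig Z : ℝ → ℝ) (κ : ℝ) (p : Var n) (v : Fin 2 → ℂ) : Fin 2 → ℂ :=
  ![hat (deriv T p.1) (v 0) / κ,
    hat (deriv T p.1) (v 1) / ((|deriv T p.1| : ℝ) : ℂ) + potShift T O X Sig Z (base p)
      - ((if lam = 0 then Z p.1 else 0 : ℝ) : ℂ) * (hat (deriv T p.1) (v 0) / κ)]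

section

variable {I : Set ℝ} {D : Set (Space n)} {A : Set ℂ} {φ : Var n → Var n} {T : ℝ → ℝ}
  {O : Space n ≃ₗᵢ[ℝ] Space n} {X : ℝ → Space n} {Sig Z : ℝ → ℝ}

/-- The constancy of |T_t| exp(λZ) is exactly what keeps δ constant. No sign or size restriction on
T_tt and Z_t is needed beyond it, because every other change of the coefficient is a function of (t,
x). -/
theorem isEquivTransf_classPδ (lam : ℝ) (hn : 1 ≤ n) (hI : IsOpen I) (hI' : IsConnected I)
    (hD : IsOpen D) (hD' : IsConnected D) (hA : IsOpen A) (hA' : IsConnected A)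
    (hA0 : (0 : ℂ) ∉ A) (hP : IsParam I T X Sig Z)
    (hφ : ∀ p ∈ I ×ˢ D ×ˢ A, φ p = varTransf T O X Sig Z p) {κ : ℝ} (hκ0 : κ ≠ 0)
    (hκ : ∀ t ∈ I, |deriv T t| * Real.exp (lam * Z t) = κ) :
    (classPδ n lam).IsEquivTransf (I ×ˢ D ×ˢ A) φ (powerElemTransf lam T O X Sig Z κ) := by
  have hW := isEqDomain_prod hI hI' hD hD' hA hA' hA0
  have htr : IsVarTransf (I ×ˢ D ×ˢ A) φ :=
    (isVarTransf_varTransf O hI hI' hP hA0).congr hW.1 hφ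
  obtain ⟨p₀, hp₀⟩ := hW.2.1.nonempty
  have hhat : ∀ t ∈ I, hat (deriv T t) = hat (deriv T p₀.1) := fun t ht =>
    hat_deriv_eq hI hI' hP.smooth_T hP.deriv_ne ht hp₀.1
  have hκC : (κ : ℂ) ≠ 0 := Complex.ofReal_ne_zero.2 hκ0
  have hτ : ∀ t ∈ I, ((|deriv T t| : ℝ) : ℂ) ≠ 0 := fun t ht =>
    Complex.ofReal_ne_zero.2 (abs_ne_zero.2 (hP.deriv_ne t ht))
  have hpot := contDiffOn_potShift O hI hP hD
  have hζ : ContDiffOn ℝ ∞ (fun t => ((if lam = 0 then Z t else 0 : ℝ) : ℂ)) I := by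
    by_cases h : lam = 0
    · simp only [h, if_true]
      exact Complex.ofRealCLM.contDiff.comp_contDiffOn hP.smooth_Z
    · simp only [h, if_false]
      exact contDiffOn_const
  have hjs := joint_of_triangular hI hP.smooth_T hP.deriv_ne hW.1 (fun p hp => hp.1)
    (Λ := powerElemTransf lam T O X Sig Z κ) htr.pointTransf (a := fun _ => (κ : ℂ)⁻¹)
    (b := fun p => ((|deriv T p.1| : ℝ) : ℂ)⁻¹)
    (d := fun _ => 0) (e := fun p => -(((if lam = 0 then Z p.1 else 0 : ℝ) : ℂ) * (κ : ℂ)⁻¹))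
    (f := fun p => potShift T O X Sig Z (base p)) contDiffOn_const
    (ContDiffOn.inv (ContDiffOn.comp_fst (Complex.ofRealCLM.contDiff.comp_contDiffOn
      (contDiffOn_abs_deriv hI hP.smooth_T hP.deriv_ne)) _) fun p hp => hτ p.1 hp.1)
    contDiffOn_const ((ContDiffOn.comp_fst hζ _).mul contDiffOn_const).neg
    (hpot.comp (baseL n).contDiff.contDiffOn fun p hp => ⟨hp.1, hp.2.1⟩)
    (fun _ _ => inv_ne_zero hκC) (fun p hp => inv_ne_zero (hτ p.1 hp.1)) (fun p hp v => by
      simp only [powerElemTransf, div_eq_inv_mul, add_zero]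
      congr 2
      ring)
  refine ⟨htr, hjs.1, hjs.2, ?_, ?_⟩
  · intro θ θ' hθ
    have hQ : ∀ d : ℂ, ContDiffOn ℝ ∞ (fun q : ℝ × Space n => potShift T O X Sig Z q
        - ((if lam = 0 then Z q.1 else 0 : ℝ) : ℂ) * d) (I ×ˢ D) := fun d =>
      hpot.sub ((ContDiffOn.comp_fst hζ D).mul contDiffOn_const)
    have hrel : ∀ (δ : ℂ) (V V' : ℝ × Space n → ℂ), (∀ q ∈ I ×ˢ D, V' (baseMap T O X q)
        = hat (deriv T q.1) (V q) / ((|deriv T q.1| : ℝ) : ℂ) + (potShift T O X Sig Z q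
        - ((if lam = 0 then Z q.1 else 0 : ℝ) : ℂ) * (hat (deriv T p₀.1) δ / κ))) →
        ∀ p ∈ I ×ˢ D ×ˢ A, powerElemTransf lam T O X Sig Z κ p ![δ, V (base p)]
          = ![hat (deriv T p₀.1) δ / κ, V' (base (φ p))] := by
      intro δ V V' hV p hp
      rw [hφ p hp, base_varTransf, hV _ ⟨hp.1, hp.2.1⟩]
      simp only [powerElemTransf, Matrix.cons_val_zero, Matrix.cons_val_one, hhat p.1 hp.1, base,
        add_sub_assoc]
    constructor
    · rintro ⟨δ, V, hδ, hV, hθf⟩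
      obtain ⟨V', hV', hVrel⟩ := exists_potential_push hI hI' hP hD hA'.nonempty hφ hV
        (hQ (hat (deriv T p₀.1) δ / κ))
      refine ⟨hat (deriv T p₀.1) δ / κ, V',
        div_ne_zero (fun h => hδ (hat_eq_zero.1 h)) hκC, hV', ?_⟩
      rintro _ ⟨p, hp, rfl⟩
      rw [hθ p hp, hθf p hp]
      exact hrel δ V V' hVrel p hp
    · rintro ⟨δ', V', hδ', hV', hθf⟩
      obtain ⟨V, hV, hVrel⟩ := exists_potential_pull hI hI' hP hD hA'.nonempty hφ hV' (hQ δ')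
      have hδ : hat (deriv T p₀.1) (hat (deriv T p₀.1) (δ' * κ)) / κ = δ' := by
        rw [hat_hat, mul_div_cancel_right₀ _ hκC]
      refine ⟨hat (deriv T p₀.1) (δ' * κ), V,
        fun h => mul_ne_zero hδ' hκC (hat_eq_zero.1 h), hV, fun p hp => ?_⟩
      have h1 := hrel (hat (deriv T p₀.1) (δ' * κ)) V V' (by rw [hδ]; exact hVrel) p hp
      rw [hδ, ← hθf _ ⟨p, hp, rfl⟩, hθ p hp] at h1
      have h2 := hjs.1.inj (x₁ := (p, ![hat (deriv T p₀.1) (δ' * κ), V (base p)]))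
        (x₂ := (p, θ p)) ⟨hp, trivial⟩ ⟨hp, trivial⟩ (by rw [h1])
      exact (congrArg Prod.snd h2).symm
  · intro θ θ' hθ _
    rw [mapsEquation_iff_rel hn hI hI' hD hA hA0 hP hφ]
    intro p hp
    change θ' (φ p) 0 * (powerFn lam ‖(φ p).2.2‖ : ℂ) + θ' (φ p) 1
      = hat (deriv T p.1) (θ p 0 * (powerFn lam ‖p.2.2‖ : ℂ) + θ p 1) / _ + _
    rw [hθ p hp, hφ p hp, norm_varTransf,
      powerFn_exp_mul lam _ (norm_pos_iff.2 (hW.2.2 p hp)), hat_add, hat_mul, hat_ofReal]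
    have h1 : ((|deriv T p.1| : ℝ) : ℂ) * ((Real.exp (lam * Z p.1) : ℝ) : ℂ) = κ := by
      rw [← Complex.ofReal_mul, hκ p.1 hp.1]
    have h2 := hτ p.1 hp.1
    have h3 : ((Real.exp (lam * Z p.1) : ℝ) : ℂ) ≠ 0 :=
      Complex.ofReal_ne_zero.2 (Real.exp_ne_zero _)
    simp only [powerElemTransf, Matrix.cons_val_zero, Matrix.cons_val_one]
    rw [Complex.ofReal_add, Complex.ofReal_mul, ← h1]
    generalize ((Real.exp (lam * Z p.1) : ℝ) : ℂ) = E at *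
    field_simp
    ring

/-- The class `𝒫_lam` parameterized by `(δ, V)` is normalized. -/
theorem classPδ_isNormalized (lam : ℝ) (hn : 1 ≤ n) (hI : IsOpen I) (hI' : IsConnected I)
    (hD : IsOpen D) (hD' : IsConnected D) (hA : IsOpen A) (hA' : IsConnected A)
    (hA0 : (0 : ℂ) ∉ A) : (classPδ n lam).IsNormalized (I ×ˢ D ×ˢ A) := by
  intro θ φ θ' hadm
  have hW := isEqDomain_prod hI hI' hD hD' hA hA' hA0
  obtain ⟨δ, V, hδ, hV, hθ⟩ := hadm.source
  obtain ⟨δ', V', hδ', hV', hθ'⟩ := hadm.target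
  have hθ'' : ∀ p ∈ I ×ˢ D ×ˢ A, θ' (φ p) = ![δ', V' (base (φ p))] := fun p hp =>
    hθ' _ ⟨p, hp, rfl⟩
  obtain ⟨T, O, X, Sig, Z, hM⟩ := exists_modularMap (f := fun ρ => δ * (powerFn lam ρ : ℂ))
    (V := V) (f' := fun ρ => δ' * (powerFn lam ρ : ℂ)) (V' := V')
    hn hI hI' hD hD' hA hA' hA0 hadm.transf hadm.maps
    (fun p hp => by
      change θ p 0 * (powerFn lam ‖p.2.2‖ : ℂ) + θ p 1 = _; rw [hθ p hp]; rfl)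
    (fun p hp => by
      change θ' (φ p) 0 * (powerFn lam ‖(φ p).2.2‖ : ℂ) + θ' (φ p) 1 = _; rw [hθ'' p hp]; rfl)
    (isNonlinearity_mul_powerFn hW hδ lam)
    (isNonlinearity_mul_powerFn (hadm.transf.isEqDomain hW) hδ' lam)
  obtain ⟨ρ₁, hρ₁⟩ := hW.isConnected_rhoRange.nonempty
  obtain ⟨ρ₂, hρ₂, hne⟩ := (infinite_of_isOpen hW.isOpen_rhoRange
    hW.isConnected_rhoRange.nonempty).exists_notMem_finset {ρ₁}
  have hτ : ∀ t ∈ I, ((|deriv T t| : ℝ) : ℂ) ≠ 0 := fun t ht =>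
    Complex.ofReal_ne_zero.2 (abs_ne_zero.2 (hM.param.deriv_ne t ht))
  have hrel : ∀ q ∈ I ×ˢ D, ∀ ρ ∈ rhoRange (I ×ˢ D ×ˢ A),
      δ' * (((Real.exp (lam * Z q.1) : ℝ) : ℂ) * (powerFn lam ρ : ℂ)
        + ((if lam = 0 then Z q.1 else 0 : ℝ) : ℂ)) + V' (baseMap T O X q)
      = hat (deriv T q.1) δ * (powerFn lam ρ : ℂ) / ((|deriv T q.1| : ℝ) : ℂ)
        + hat (deriv T q.1) (V q) / ((|deriv T q.1| : ℝ) : ℂ) + potShift T O X Sig Z q := by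
    intro q hq ρ hρ
    have h1 := hM.rel q hq ρ hρ
    rw [powerFn_exp_mul lam _ (hW.pos hρ), hat_mul, hat_ofReal, Complex.ofReal_add,
      Complex.ofReal_mul] at h1
    exact h1
  -- The relation at two values of ρ over the same (t, x) is subtracted; `powerFn` separates these
  -- values, so the coefficients of the nonlinear parts must agree.
  have hδrel : ∀ t ∈ I, ((|deriv T t| * Real.exp (lam * Z t) : ℝ) : ℂ) * δ'
      = hat (deriv T t) δ := by
    intro t ht
    obtain ⟨x, hx⟩ := hD'.nonempty
    have h1 := hrel (t, x) ⟨ht, hx⟩ ρ₁ hρ₁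
    have h2 := hrel (t, x) ⟨ht, hx⟩ ρ₂ hρ₂
    have h3 : (powerFn lam ρ₂ : ℂ) - (powerFn lam ρ₁ : ℂ) ≠ 0 := by
      rw [sub_ne_zero]
      intro h
      refine hne (Finset.mem_singleton.2 (powerFn_injOn lam (hW.pos hρ₂) (hW.pos hρ₁) ?_))
      exact_mod_cast h
    have h4 := hτ t ht
    have h5 : (δ' * ((Real.exp (lam * Z t) : ℝ) : ℂ)
        - hat (deriv T t) δ / ((|deriv T t| : ℝ) : ℂ))
        * ((powerFn lam ρ₂ : ℂ) - (powerFn lam ρ₁ : ℂ)) = 0 := by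
      simp only at h1 h2
      linear_combination h2 - h1
    have h6 := (mul_eq_zero.1 h5).resolve_right h3
    rw [sub_eq_zero, eq_div_iff h4] at h6
    rw [Complex.ofReal_mul, ← h6]
    ring
  have hδ0 : ‖δ'‖ ≠ 0 := norm_ne_zero_iff.2 hδ'
  -- The modulus removes the conjugation and yields a constant independent of t, determined by δ and
  -- δ'.
  have hκ : ∀ t ∈ I, |deriv T t| * Real.exp (lam * Z t) = ‖δ‖ / ‖δ'‖ := by
    intro t ht
    have h1 := congrArg norm (hδrel t ht)
    rw [norm_mul, norm_hat, Complex.norm_real, Real.norm_of_nonneg (by positivity)] at h1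
    rw [eq_div_iff hδ0, h1]
  have hκ0 : ‖δ‖ / ‖δ'‖ ≠ 0 := div_ne_zero (norm_ne_zero_iff.2 hδ) hδ0
  refine ⟨powerElemTransf lam T O X Sig Z (‖δ‖ / ‖δ'‖), isEquivTransf_classPδ lam hn hI hI' hD hD'
    hA hA' hA0 hM.param hM.eq hκ0 hκ, fun p hp => ?_⟩
  have h1 : hat (deriv T p.1) δ / ((‖δ‖ / ‖δ'‖ : ℝ) : ℂ) = δ' := by
    rw [div_eq_iff (Complex.ofReal_ne_zero.2 hκ0), ← hδrel p.1 hp.1, hκ p.1 hp.1, mul_comm]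
  rw [hθ'' p hp, hθ p hp]
  simp only [powerElemTransf, Matrix.cons_val_zero, Matrix.cons_val_one, h1]
  congr 1
  have h2 := hrel (base p) ⟨hp.1, hp.2.1⟩ ρ₁ hρ₁
  have h3 := hδrel p.1 hp.1
  have h4 := hτ p.1 hp.1
  have h5 : hat (deriv T p.1) δ * (powerFn lam ρ₁ : ℂ) / ((|deriv T p.1| : ℝ) : ℂ)
      = ((Real.exp (lam * Z p.1) : ℝ) : ℂ) * δ' * (powerFn lam ρ₁ : ℂ) := by
    rw [← h3, Complex.ofReal_mul]
    field_simp
  rw [hM.eq p hp, base_varTransf]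
  simp only [base] at h2 ⊢
  rw [h5] at h2
  funext i
  simp only [Matrix.cons_val_fin_one]
  linear_combination h2

end

end NLS

end

theorem mainTheorem7 (n : ℕ) (hn : 1 ≤ n)
    (I : Set ℝ) (D : Set (NLS.Space n)) (A : Set ℂ)
    (hI : IsOpen I) (hI' : IsConnected I) (hD : IsOpen D) (hD' : IsConnected D)
    (hA : IsOpen A) (hA' : IsConnected A) (hA0 : (0 : ℂ) ∉ A) :
    -- the class `𝒱` is not normalized
    ¬ (NLS.classV n).IsNormalized (I ×ˢ D ×ˢ A) ∧
    -- the equivalence group of the class `𝒱`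
    (∀ (φ : NLS.Var n → NLS.Var n) (Λ : NLS.Var n → (Fin 2 → ℂ) → (Fin 2 → ℂ)),
      (NLS.classV n).IsEquivTransf (I ×ˢ D ×ˢ A) φ Λ ↔
        ∃ (T : ℝ → ℝ) (O : NLS.Space n ≃ₗᵢ[ℝ] NLS.Space n) (X : ℝ → NLS.Space n)
          (Sig : ℝ → ℝ) (Z : ℝ) (c : ℂ),
          ContDiffOn ℝ ∞ T I ∧ ContDiffOn ℝ ∞ X I ∧ ContDiffOn ℝ ∞ Sig I ∧
          (∀ t ∈ I, deriv T t ≠ 0) ∧ (∀ t ∈ I, deriv (deriv T) t = 0) ∧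
          (∀ p ∈ I ×ˢ D ×ˢ A, φ p = NLS.varTransf T O X Sig (fun _ => Z) p) ∧
          (∀ p ∈ I ×ˢ D ×ˢ A, ∀ v, Λ p v = NLS.elemTransf T O X Sig c p v)) ∧
    -- `𝒱` is the disjoint union of the subclasses `𝒱'` and `𝒫_lam`
    (∀ W : Set (NLS.Var n), NLS.IsEqDomain W →
      (NLS.classV n).elems W = ⋃ i, (NLS.subclass n i).elems W ∧
      Pairwise fun i j => Disjoint ((NLS.subclass n i).elems W) ((NLS.subclass n j).elems W)) ∧
    -- `𝒱'` is normalized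
    (NLS.classV' n).IsNormalized (I ×ˢ D ×ˢ A) ∧
    -- `𝒫_lam` consists of the same equations as its reparameterization by `(δ, V)`,
    -- which is normalized
    (∀ lam : ℝ,
      (∀ W : Set (NLS.Var n), NLS.IsEqDomain W → ∀ S : NLS.Var n → ℂ,
        (NLS.classP n lam).ContainsEquation W S ↔ (NLS.classPδ n lam).ContainsEquation W S) ∧
      (NLS.classPδ n lam).IsNormalized (I ×ˢ D ×ˢ A)) ∧
    -- no point transformation relates equations from different subclasses
    (∀ i j : Option ℝ, i ≠ j → ∀ θ φ θ',
      ¬ (NLS.subclass n i).IsAdmissible (NLS.subclass n j) (I ×ˢ D ×ˢ A) θ φ θ') := by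
  exact ⟨NLS.not_isNormalized_classV hn hI hI' hD hD' hA hA' hA0,
    fun _ _ => NLS.isEquivTransf_classV_iff hn hI hI' hD hD' hA hA' hA0,
    fun _ hW => NLS.classV_partition hW,
    NLS.classV'_isNormalized hn hI hI' hD hD' hA hA' hA0,
    fun lam => ⟨fun _ hW S => NLS.classP_containsEquation_iff lam hW S,
      NLS.classPδ_isNormalized lam hn hI hI' hD hD' hA hA' hA0⟩,
    NLS.not_isAdmissible_subclass hn hI hI' hD hD' hA hA' hA0⟩
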